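/- Let $M$ be a smooth Hausdorff manifold of dimension $n$, let $f(u,q)$ be a family of vector fields on $M$ and $L(u,q)$ a function, both smooth in $(u,q)\in\mathbb R^k\times M$, let $N_0\subset M$ be an embedded submanifold, and let $T>0$. Consider the optimal control problem $$\dot q=f(u,q),\qquad q(0)\in N_0,\qquad J_T=\int_0^T L(u,q)\,dt\to\min ,\qquad u\in L^\infty([0,T],\mathbb R^k).$$ For $t\in[0,T]$ let $E_{N_0,t}$ and $J_t$ be the end-point map $(q(\cdot),u)\mapsto q(t)$ and the functional $\int_0^tL(u,q)\,d\tau$ on the space of admissible pairs on $[0,t]$ starting on $N_0$, which is locally modelled on $\mathbb R^{\dim N_0}\times L^\infty([0,t],\mathbb R^k)$. Let $\tilde\omega=(\tilde q,\tilde u)$ be an admissible pair on $[0,T]$ with $\tilde q(0)\in N_0$, let $\nu\in\{0,1\}$, put $h(u,\lambda)=\langle\lambda,f(u,q)\rangle-\nu L(u,q)$ for $\lambda\in T_q^*M$, and let $\lambda(t)\in T^*_{\tilde q(t)}M$, $t\in[0,T]$, be a solution of the Hamiltonian system $\dot\lambda=\vec h(\tilde u(t),\lambda)$ such that $(\tilde\omega,\lambda(T))$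 is a Lagrange point: $$\langle\lambda(T),dE_{N_0,T}[\tilde\omega](w)\rangle-\nu\, dJ_T[\tilde\omega](w)=0\quad\text{for all variations } w .$$ Assume that the positive or the negative inertia index of the Hessian $\big(\nu\, d^2J_T[\tilde\omega]-\langle\lambda(T),d^2E_{N_0,T}[\tilde\omega]\rangle\big)\big|_{\ker dE_{N_0,T}[\tilde\omega]}$ is finite. For a finite-dimensional space $W$ of variations on $[0,t]$, let $\mathcal L(E_{N_0,t},\nu J_t)[\tilde\omega,\lambda(t)](W)\subset T_{\lambda(t)}(T^*M)$ be the set of the vectors $(\xi,dE_{N_0,t}[\tilde\omega](v))$ (in canonical coordinates) with $v\in W$ and $$\langle\xi,dE_{N_0,t}[\tilde\omega](w)\rangle+\langle\lambda(t),d^2E_{N_0,t}[\tilde\omega](v,w)\rangle-\nu\, d^2J_t[\tilde\omega](v,w)=0\quad\text{for all } w\in W ,$$ and let the $\mathcal L$-derivative $\mathcal L(E_{N_0,t},\nu J_t)[\tilde\omega,\lambda(t)]$ be the generalized limit of these subspaces in the Grassmannian over the increasing finite-dimensional subspaces $W$ of the space of all variations on $[0,t]$. Let $\Phi_t$ be the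 flow of $\vec h(\tilde u(t),\cdot)$, and let $\mathcal L_t=\Phi_t^*\,\mathcal L(E_{N_0,t},\nu J_t)[\tilde\omega,\lambda(t)]\subset T_{\lambda(0)}(T^*M)$ be the preimage of the $\mathcal L$-derivative under $d_{\lambda(0)}\Phi_t$. Then for every $t\in[0,T]$ the limit exists and $\mathcal L_t$ is a Lagrangian subspace of $T_{\lambda(0)}(T^*M)$, and the Jacobi curve $t\mapsto\mathcal L_t$ is left continuous at every $t\in(0,T]$. -/

import Mathlib

open scoped Manifold ContDiff Topology
open Bundle MeasureTheory Set

noncomputable section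

/-- The Euclidean space `ℝⁿ`. -/
abbrev Euc (n : ℕ) := EuclideanSpace ℝ (Fin n)

/-! ### Trajectories of non-autonomous vector fields -/

section Trajectories

variable {E H P : Type*} [NormedAddCommGroup E] [NormedSpace ℝ E] [TopologicalSpace H]
  [TopologicalSpace P] [ChartedSpace H P]

/-- `γ` is a (Carathéodory) trajectory on `[0, T]` of the time dependent vector field `X`: it is
continuous, Lipschitz in charts, and satisfies `γ' = X(t, γ)` for almost every `t ∈ [0, T]`. -/
structure IsTrajectory (I : ModelWithCorners ℝ E H) (X : ℝ → (p : P) → TangentSpace I p)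
    (T : ℝ) (γ : ℝ → P) : Prop where
  continuousOn : ContinuousOn γ (Icc 0 T)
  lipschitz : ∀ t₀ ∈ Icc 0 T, ∃ K : NNReal, ∃ s ∈ 𝓝[Icc 0 T] t₀,
    LipschitzOnWith K (fun t => extChartAt I (γ t₀) (γ t)) s
  ode : ∀ᵐ t ∂(volume.restrict (Icc 0 T)),
    HasMFDerivAt 𝓘(ℝ, ℝ) I γ t (ContinuousLinearMap.smulRight (1 : ℝ →L[ℝ] ℝ) (X t (γ t)))

open Classical in
/-- The trajectory on `[0, T]` of `X` that starts at `p` (constant if there is none). -/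
def trajectory (I : ModelWithCorners ℝ E H) (X : ℝ → (p : P) → TangentSpace I p)
    (T : ℝ) (p : P) : ℝ → P :=
  if h : ∃ γ : ℝ → P, IsTrajectory I X T γ ∧ γ 0 = p then h.choose else fun _ => p

end Trajectories

/-! ### The symplectic space `ℝⁿ × (ℝⁿ)*` and its subspaces -/

/-- `ℝⁿ × (ℝⁿ)*`: the model, in canonical coordinates `(x, ξ)`, of the tangent spaces of the
cotangent bundle of an `n`-manifold. -/
abbrev PhaseSpace (n : ℕ) := Euc n × (Euc n →L[ℝ] ℝ)

/-- The canonical symplectic form `dξ ∧ dx`. -/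
def symp {n : ℕ} (a b : PhaseSpace n) : ℝ := a.2 b.1 - b.2 a.1

/-- Lagrangian subspaces: isotropic and of dimension `n`. -/
def IsLagrangianSubspace {n : ℕ} (Λ : Submodule ℝ (PhaseSpace n)) : Prop :=
  (∀ a ∈ Λ, ∀ b ∈ Λ, symp a b = 0) ∧ Module.finrank ℝ Λ = n

/-- The topology of the Grassmannian of all subspaces: the disjoint union over `r` of the
Grassmannians of `r`-planes, each with the quotient topology from the space of `r`-frames.
The Lagrangian Grassmannian is a subspace of it. -/
instance grassmannianTopology (n : ℕ) : TopologicalSpace (Submodule ℝ (PhaseSpace n)) :=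
  TopologicalSpace.coinduced
    (fun b : Σ r : ℕ, {b : Fin r → PhaseSpace n // LinearIndependent ℝ b} =>
      Submodule.span ℝ (range b.2.1)) inferInstance

/-! ### `𝓛`-derivatives of maps with smooth finite-dimensional restrictions

`F : X → ℝⁿ` and `J : X → ℝ` are a constraint map and a functional written in coordinates in
which the point under consideration is `0 ∈ X`; `p` is the covector in the dual coordinates. -/

section LDerivatives

variable {X : Type*} [NormedAddCommGroup X] [NormedSpace ℝ X]

section

variable {Y : Type*} [NormedAddCommGroup Y] [NormedSpace ℝ Y]

/-- The first differential at `0` of the restriction of `F` to the subspace `W`. -/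
def diff1 (F : X → Y) (W : Submodule ℝ X) : W →L[ℝ] Y :=
  fderiv ℝ (fun w : W => F w) 0

/-- The second differential at `0` of the restriction of `F` to the subspace `W`. -/
def diff2 (F : X → Y) (W : Submodule ℝ X) : W →L[ℝ] W →L[ℝ] Y :=
  fderiv ℝ (fderiv ℝ (fun w : W => F w)) 0

end

variable {n : ℕ} (F : X → Euc n) (J : X → ℝ) (ν : ℝ) (p : Euc n →L[ℝ] ℝ)

/-- The Lagrange multiplier rule `⟨p, dF(w)⟩ - ν dJ(w) = 0` for all variations `w`. -/
def IsLagrangePoint : Prop :=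
  ∀ W : Submodule ℝ X, FiniteDimensional ℝ W → ∀ w : W,
    p (diff1 F W w) - ν * diff1 J W w = 0

/-- `Q(v, w) = ⟨p, d²F(v, w)⟩ - ν d²J(v, w)`. -/
def formQ (W : Submodule ℝ X) (v w : W) : ℝ :=
  p (diff2 F W v w) - ν * diff2 J W v w

/-- The Hessian `(ν d²J - ⟨p, d²F⟩)|_{ker dF}` has finite positive inertia index. -/
def HasFinitePosIndex : Prop :=
  ∃ d : ℕ, ∀ W : Submodule ℝ X, FiniteDimensional ℝ W →
    (∀ w : W, diff1 F W w = 0) → (∀ w : W, w ≠ 0 → 0 < - formQ F J ν p W w w) →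
    Module.finrank ℝ W ≤ d

/-- The Hessian `(ν d²J - ⟨p, d²F⟩)|_{ker dF}` has finite negative inertia index. -/
def HasFiniteNegIndex : Prop :=
  ∃ d : ℕ, ∀ W : Submodule ℝ X, FiniteDimensional ℝ W →
    (∀ w : W, diff1 F W w = 0) → (∀ w : W, w ≠ 0 → - formQ F J ν p W w w < 0) →
    Module.finrank ℝ W ≤ d

/-- The `𝓛`-derivative over a space of variations `W`: the vectors `(dF(v), ξ)` with `v ∈ W` and
`⟨ξ, dF(w)⟩ + Q(v, w) = 0` for all `w ∈ W`. -/
def lDerivative (W : Submodule ℝ X) : Submodule ℝ (PhaseSpace n) where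
  carrier := {η | ∃ v : W, diff1 F W v = η.1 ∧
    ∀ w : W, η.2 (diff1 F W w) + formQ F J ν p W v w = 0}
  zero_mem' := ⟨0, by simp, fun w => by simp [formQ]⟩
  add_mem' := by
    rintro a b ⟨v, hv, hv'⟩ ⟨v', hw, hw'⟩
    refine ⟨v + v', by simp [hv, hw], fun w => ?_⟩
    have h1 := hv' w
    have h2 := hw' w
    simp only [formQ, Prod.snd_add, map_add, _root_.add_apply] at h1 h2 ⊢
    linarith
  smul_mem' := by
    rintro c a ⟨v, hv, hv'⟩
    refine ⟨c • v, by simp [hv], fun w => ?_⟩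
    have h1 := hv' w
    simp only [formQ, Prod.smul_snd, map_smul, _root_.smul_apply,
      smul_eq_mul] at h1 ⊢
    linear_combination c * h1

/-- `Λ` is the `𝓛`-derivative over the whole space of variations `X`: the generalized limit of the
`𝓛`-derivatives over the increasing finite-dimensional subspaces of `X`. -/
def IsLDerivative (Λ : Submodule ℝ (PhaseSpace n)) : Prop :=
  ∀ O : Set (Submodule ℝ (PhaseSpace n)), IsOpen O → Λ ∈ O →
    ∃ V : Submodule ℝ X, FiniteDimensional ℝ V ∧
      ∀ W : Submodule ℝ X, FiniteDimensional ℝ W → V ≤ W → lDerivative F J ν p W ∈ O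

end LDerivatives

/-! ### Cotangent bundle and Hamiltonian vector fields -/

section Cotangent

variable {n : ℕ} {M : Type*} [TopologicalSpace M] [ChartedSpace (Euc n) M]
  [IsManifold 𝓘(ℝ, Euc n) ∞ M]

/-- The cotangent bundle `T*M`. -/
abbrev CotBundle (n : ℕ) (M : Type*) [TopologicalSpace M] [ChartedSpace (Euc n) M]
    [IsManifold 𝓘(ℝ, Euc n) ∞ M] :=
  TotalSpace (Euc n →L[ℝ] ℝ)
    (fun x : M => TangentSpace 𝓘(ℝ, Euc n) x →L[ℝ] Bundle.Trivial M ℝ x)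

/-- The model with corners of `T*M`. -/
abbrev cotModel (n : ℕ) := 𝓘(ℝ, Euc n).prod 𝓘(ℝ, Euc n →L[ℝ] ℝ)

/-- The differential at `l ∈ T*M` of a function on `T*M`, in the canonical coordinates induced by
the preferred chart of `M` at the base point of `l`. (In Mathlib `T_l(T*M)` is `ℝⁿ × (ℝⁿ)*`, by
these coordinates.) -/
def phaseDiff (h : CotBundle n M → ℝ) (l : CotBundle n M) : PhaseSpace n →L[ℝ] ℝ :=
  mfderiv (cotModel n) 𝓘(ℝ, ℝ) h l

/-- The Hamiltonian vector field `(∂h/∂ξ, -∂h/∂x)` of a function `h` on `T*M`. -/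
def hamVec (h : CotBundle n M → ℝ) (l : CotBundle n M) : TangentSpace (cotModel n) l :=
  ((WithLp.toLp 2 fun i => phaseDiff h l (0, EuclideanSpace.proj i),
    -(phaseDiff h l).comp (ContinuousLinearMap.inl ℝ (Euc n) (Euc n →L[ℝ] ℝ))) : PhaseSpace n)

/-- The defining relation `σ(·, hamVec h) = dh` of the Hamiltonian vector field. -/
theorem symp_hamVec (h : CotBundle n M → ℝ) (l : CotBundle n M) (a : PhaseSpace n) :
    symp a (hamVec h l) = phaseDiff h l a := by
  have h2 : a.2 = ∑ i, a.2 (EuclideanSpace.single i 1) • (EuclideanSpace.proj i : Euc n →L[ℝ] ℝ) := by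
    ext y
    conv_lhs => rw [← (EuclideanSpace.basisFun (Fin n) ℝ).sum_repr y]
    simp [mul_comm]
  have h1 : phaseDiff h l (0, a.2) =
      a.2 (WithLp.toLp 2 fun i => phaseDiff h l (0, EuclideanSpace.proj i)) := by
    have h3 : ∀ b : Euc n →L[ℝ] ℝ, phaseDiff h l (0, b) =
        (phaseDiff h l).comp (ContinuousLinearMap.inr ℝ (Euc n) (Euc n →L[ℝ] ℝ)) b :=
      fun b => rfl
    rw [h3]
    conv_lhs => rw [h2]
    conv_rhs => rw [h2]
    simp only [map_sum, map_smul, _root_.sum_apply, _root_.smul_apply]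
    rfl
  have h4 : phaseDiff h l a = phaseDiff h l (a.1, 0) + phaseDiff h l (0, a.2) := by
    rw [← map_add]; simp
  rw [h4, h1]
  change a.2 (WithLp.toLp 2 fun i => phaseDiff h l (0, EuclideanSpace.proj i)) -
    (-(phaseDiff h l).comp (ContinuousLinearMap.inl ℝ (Euc n) (Euc n →L[ℝ] ℝ))) a.1 = _
  simp [add_comm]

end Cotangent

/-! ### Optimal control problems -/

/-- An optimal control problem `q' = f(u, q)`, `∫ L(u, q) dt → min` on `M`, with controls in `ℝᵏ`
and with initial points on the embedded submanifold `ι(N)` of `M`. -/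
structure ControlProblem (n k m : ℕ) (M N : Type*)
    [TopologicalSpace M] [ChartedSpace (Euc n) M] [IsManifold 𝓘(ℝ, Euc n) ∞ M]
    [TopologicalSpace N] [ChartedSpace (Euc m) N] where
  /-- the dynamics -/
  f : Euc k → (q : M) → TangentSpace 𝓘(ℝ, Euc n) q
  /-- the Lagrangian -/
  L : Euc k → M → ℝ
  /-- the inclusion of the initial submanifold -/
  ι : N → M
  smooth_f : ContMDiff (𝓘(ℝ, Euc k).prod 𝓘(ℝ, Euc n)) 𝓘(ℝ, Euc n).tangent ∞
    (fun z : Euc k × M => (⟨z.2, f z.1 z.2⟩ : TangentBundle 𝓘(ℝ, Euc n) M))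
  smooth_L : ContMDiff (𝓘(ℝ, Euc k).prod 𝓘(ℝ, Euc n)) 𝓘(ℝ, ℝ) ∞
    (fun z : Euc k × M => L z.1 z.2)
  embedding_ι : Manifold.IsSmoothEmbedding 𝓘(ℝ, Euc m) 𝓘(ℝ, Euc n) ∞ ι

namespace ControlProblem

variable {n k m : ℕ} {M N : Type*}
  [TopologicalSpace M] [ChartedSpace (Euc n) M] [IsManifold 𝓘(ℝ, Euc n) ∞ M]
  [TopologicalSpace N] [ChartedSpace (Euc m) N] (P : ControlProblem n k m M N)

/-- The trajectory on `[0, t]` with control `u` that starts at `x`. -/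
def traj (t : ℝ) (x : M) (u : ℝ → Euc k) : ℝ → M :=
  trajectory 𝓘(ℝ, Euc n) (fun τ q => P.f (u τ) q) t x

/-- The value of the functional on `[0, t]`. -/
def cost (t : ℝ) (x : M) (u : ℝ → Euc k) : ℝ :=
  ∫ τ in (0 : ℝ)..t, P.L (u τ) (P.traj t x u τ)

/-- The space of variations of an admissible pair on `[0, t]`: variations of the initial point in
`N` and variations of the control in `L^∞([0, t], ℝᵏ)`. -/
abbrev Variations (k m : ℕ) (t : ℝ) :=
  Euc m × Lp (Euc k) ⊤ (volume.restrict (Icc (0 : ℝ) t))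

/-- The point of the initial submanifold with coordinate `ζ` in the preferred chart of `N` at `x₀`,
centred at `x₀`. -/
def initialPoint (x₀ : N) (ζ : Euc m) : M :=
  P.ι ((extChartAt 𝓘(ℝ, Euc m) x₀).symm (extChartAt 𝓘(ℝ, Euc m) x₀ x₀ + ζ))

/-- The end-point map at time `t` on the admissible pairs that start on the initial submanifold:
read in the local coordinates `(ζ, v)` of the pairs around the pair with initial point `x₀` and
control `u`, and in the preferred chart of `M` at `q`. -/
def endPointMap (x₀ : N) (u : ℝ → Euc k) (t : ℝ) (q : M) (z : Variations k m t) : Euc n :=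
  extChartAt 𝓘(ℝ, Euc n) q
    (P.traj t (P.initialPoint x₀ z.1) (fun τ => u τ + z.2 τ) t)

/-- The functional on `[0, t]` in the same local coordinates. -/
def costMap (x₀ : N) (u : ℝ → Euc k) (t : ℝ) (z : Variations k m t) : ℝ :=
  P.cost t (P.initialPoint x₀ z.1) (fun τ => u τ + z.2 τ)

/-- The Hamiltonian `h(u, l) = ⟨l, f(u, q)⟩ - ν L(u, q)`, `l ∈ T*_q M`. -/
def hamiltonian (ν : ℝ) (u : Euc k) (l : CotBundle n M) : ℝ :=
  l.2 (P.f u l.1) - ν * P.L u l.1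

/-- The time dependent Hamiltonian vector field on `T*M` given by the control `u`. -/
def hamField (ν : ℝ) (u : ℝ → Euc k) (t : ℝ) (l : CotBundle n M) :
    TangentSpace (cotModel n) l :=
  hamVec (P.hamiltonian ν (u t)) l

/-- The flow `Φ_t` of the Hamiltonian vector field of the control `u`. -/
def hamFlow (ν : ℝ) (u : ℝ → Euc k) (t : ℝ) (l : CotBundle n M) : CotBundle n M :=
  trajectory (cotModel n) (P.hamField ν u) t l t

/-- The differential of `Φ_t` at `l`. -/
def hamFlowDeriv (ν : ℝ) (u : ℝ → Euc k) (t : ℝ) (l : CotBundle n M) :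
    PhaseSpace n →L[ℝ] PhaseSpace n :=
  mfderiv (cotModel n) (cotModel n) (P.hamFlow ν u t) l

/-- `Λ ⊆ T_{l(0)}(T*M)` is the value at time `t` of the Jacobi curve: the pull-back by `Φ_t` of the
`𝓛`-derivative at `l(t)` of the end-point map and the functional on `[0, t]`. -/
def IsJacobiValue (ν : ℝ) (x₀ : N) (u : ℝ → Euc k) (l : ℝ → CotBundle n M) (t : ℝ)
    (Λ : Submodule ℝ (PhaseSpace n)) : Prop :=
  ∃ Γ : Submodule ℝ (PhaseSpace n),
    IsLDerivative (P.endPointMap x₀ u t (l t).1) (P.costMap x₀ u t) ν (l t).2 Γ ∧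
    Λ = Γ.comap (P.hamFlowDeriv ν u t (l 0)).toLinearMap

end ControlProblem

end

open scoped Manifold ContDiff Topology
open Bundle MeasureTheory Set

set_option linter.unusedSectionVars false

noncomputable section

/-! ### Superposition operators on `L^∞` -/

section Superposition

universe uB

variable {α : Type*} [MeasurableSpace α] {μ : Measure α}

theorem Lp.ae_norm_le_norm_top {B : Type*} [NormedAddCommGroup B] (b : Lp B ⊤ μ) :
    ∀ᵐ t ∂μ, ‖b t‖ ≤ ‖b‖ := by
  filter_upwards [ae_le_eLpNormEssSup (f := b) (μ := μ)] with t ht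
  rw [Lp.norm_def, eLpNorm_exponent_top]
  rw [← toReal_enorm]
  refine ENNReal.toReal_mono ?_ ht
  have := Lp.eLpNorm_ne_top b
  rwa [eLpNorm_exponent_top] at this

theorem Lp.norm_top_le_of_ae_bound [IsFiniteMeasure μ] {B : Type*} [NormedAddCommGroup B]
    {b : Lp B ⊤ μ} {C : ℝ} (hC : 0 ≤ C) (h : ∀ᵐ t ∂μ, ‖b t‖ ≤ C) : ‖b‖ ≤ C := by
  simpa using Lp.norm_le_of_ae_bound hC h

variable {B F : Type uB} [NormedAddCommGroup B] [NormedAddCommGroup F]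

theorem memLp_top_comp_of_continuous [ProperSpace B] {Y : B → F} (hY : Continuous Y)
    {b : α → B} (hb : MemLp b ⊤ μ) : MemLp (fun t => Y (b t)) ⊤ μ := by
  obtain ⟨C, hC⟩ := ((isCompact_closedBall (0 : B) ‖hb.toLp b‖).bddAbove_image hY.norm.continuousOn)
  refine memLp_top_of_bound (hY.comp_aestronglyMeasurable hb.1) C ?_
  filter_upwards [Lp.ae_norm_le_norm_top (hb.toLp b), hb.coeFn_toLp] with t ht ht'
  rw [ht'] at ht
  exact hC ⟨b t, by simpa using ht, rfl⟩

/-- The superposition operator `b ↦ Y ∘ b` on `L^∞`. -/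
def superpos (μ : Measure α) [ProperSpace B] {Y : B → F} (hY : Continuous Y) (b : Lp B ⊤ μ) :
    Lp F ⊤ μ :=
  (memLp_top_comp_of_continuous hY (Lp.memLp b)).toLp

theorem coeFn_superpos [ProperSpace B] {Y : B → F} (hY : Continuous Y) (b : Lp B ⊤ μ) :
    superpos μ hY b =ᵐ[μ] fun t => Y (b t) := MemLp.coeFn_toLp _

variable [NormedSpace ℝ B] [NormedSpace ℝ F]

/-- Multiplication of `L^∞` functions with values in operators. -/
def mulTop (μ : Measure α) (B F : Type uB) [NormedAddCommGroup B] [NormedAddCommGroup F]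
    [NormedSpace ℝ B] [NormedSpace ℝ F] :
    Lp (B →L[ℝ] F) ⊤ μ →L[ℝ] Lp B ⊤ μ →L[ℝ] Lp F ⊤ μ :=
  (ContinuousLinearMap.id ℝ (B →L[ℝ] F)).holderL μ ⊤ ⊤ ⊤

theorem coeFn_mulTop (a : Lp (B →L[ℝ] F) ⊤ μ) (b : Lp B ⊤ μ) :
    mulTop μ B F a b =ᵐ[μ] fun t => a t (b t) :=
  (ContinuousLinearMap.id ℝ (B →L[ℝ] F)).coeFn_holder a b

theorem hasFDerivAt_superpos [IsFiniteMeasure μ] [FiniteDimensional ℝ B] [ProperSpace B] {Y : B → F}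
    (hY : ContDiff ℝ 2 Y) (b : Lp B ⊤ μ) :
    HasFDerivAt (superpos μ hY.continuous)
      (mulTop μ B F (superpos μ (hY.continuous_fderiv (by simp)) b)) b := by
  set R := ‖b‖ + 1
  have h1 : ContDiff ℝ 1 (fderiv ℝ Y) := hY.fderiv_right (by norm_num)
  obtain ⟨K, hK⟩ := h1.contDiffOn.exists_lipschitzOnWith (by simp)
    (convex_closedBall (0 : B) R) (isCompact_closedBall _ _)
  rw [hasFDerivAt_iff_isLittleO_nhds_zero]
  have key : ∀ h : Lp B ⊤ μ, ‖h‖ ≤ 1 → ‖superpos μ hY.continuous (b + h) -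
      superpos μ hY.continuous b - mulTop μ B F
        (superpos μ (hY.continuous_fderiv (by simp)) b) h‖ ≤ K * ‖h‖ ^ 2 := by
    intro h hh
    refine Lp.norm_top_le_of_ae_bound (by positivity) ?_
    filter_upwards [Lp.coeFn_sub (superpos μ hY.continuous (b + h) - superpos μ hY.continuous b)
        (mulTop μ B F (superpos μ (hY.continuous_fderiv (by simp)) b) h),
      Lp.coeFn_sub (superpos μ hY.continuous (b + h)) (superpos μ hY.continuous b),
      coeFn_superpos (μ := μ) hY.continuous (b + h), coeFn_superpos (μ := μ) hY.continuous b,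
      coeFn_mulTop (superpos μ (hY.continuous_fderiv (by simp)) b) h,
      coeFn_superpos (μ := μ) (hY.continuous_fderiv (by simp)) b,
      Lp.coeFn_add b h, Lp.ae_norm_le_norm_top b, Lp.ae_norm_le_norm_top h]
      with t e1 e2 e3 e4 e5 e6 e7 nb nh
    rw [e1, Pi.sub_apply, e2, Pi.sub_apply, e3, e4, e5, e6, e7, Pi.add_apply]
    have hb1 : b t ∈ Metric.closedBall (0 : B) R := by
      simp only [mem_closedBall_zero_iff]; linarith
    have hb2 : b t + h t ∈ Metric.closedBall (0 : B) R := by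
      simp only [mem_closedBall_zero_iff]
      exact (norm_add_le _ _).trans (by linarith)
    have hseg : segment ℝ (b t) (b t + h t) ⊆ Metric.closedBall (0 : B) R :=
      (convex_closedBall _ _).segment_subset hb1 hb2
    have := Convex.norm_image_sub_le_of_norm_fderiv_le' (𝕜 := ℝ) (f := Y)
      (φ := fderiv ℝ Y (b t)) (C := K * ‖h t‖) (s := segment ℝ (b t) (b t + h t))
      (x := b t) (y := b t + h t)
      (fun x _ => (hY.differentiable (by simp)).differentiableAt) (fun x hx => ?_)
      (convex_segment _ _) (left_mem_segment _ _ _) (right_mem_segment _ _ _)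
    · rw [add_sub_cancel_left] at this
      refine this.trans ?_
      rw [mul_assoc, ← sq]
      gcongr
    · have h3 := hK.norm_sub_le (hseg hx) hb1
      refine h3.trans ?_
      gcongr
      rw [segment_eq_image'] at hx
      obtain ⟨θ, hθ, rfl⟩ := hx
      simp only [add_sub_cancel_left, norm_smul, Real.norm_eq_abs, abs_of_nonneg hθ.1]
      exact mul_le_of_le_one_left (norm_nonneg _) hθ.2
  refine Asymptotics.IsBigO.trans_isLittleO (g := fun h : Lp B ⊤ μ => ‖h‖ ^ 2) ?_ ?_
  · refine Asymptotics.IsBigO.of_bound K ?_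
    filter_upwards [Metric.closedBall_mem_nhds (0 : Lp B ⊤ μ) one_pos] with h hh
    rw [mem_closedBall_zero_iff] at hh
    simpa using key h hh
  · exact Asymptotics.isLittleO_norm_pow_id one_lt_two

theorem contDiff_superpos_nat [IsFiniteMeasure μ] {B : Type uB} [NormedAddCommGroup B] [NormedSpace ℝ B]
    [FiniteDimensional ℝ B] [ProperSpace B] (n : ℕ) :
    ∀ {F : Type uB} [NormedAddCommGroup F] [NormedSpace ℝ F] {Y : B → F} (hY : ContDiff ℝ ∞ Y),
    ContDiff ℝ n (superpos μ hY.continuous) := by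
  induction n with
  | zero =>
    intro F _ _ Y hY
    refine contDiff_zero.2 ?_
    exact continuous_iff_continuousAt.2 fun b =>
      (hasFDerivAt_superpos (contDiff_infty.1 hY 2) b).continuousAt
  | succ n ih =>
    intro F _ _ Y hY
    rw [Nat.cast_succ, contDiff_succ_iff_hasFDerivAt]
    have h1 : ContDiff ℝ ∞ (fderiv ℝ Y) := hY.fderiv_right (by rfl)
    exact ⟨fun b => mulTop μ B F (superpos μ h1.continuous b),
      (mulTop μ B F).contDiff.comp (ih h1),
      fun b => hasFDerivAt_superpos (contDiff_infty.1 hY 2) b⟩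

theorem contDiff_superpos [IsFiniteMeasure μ] [FiniteDimensional ℝ B] [ProperSpace B] {Y : B → F}
    (hY : ContDiff ℝ ∞ Y) : ContDiff ℝ ∞ (superpos μ hY.continuous) :=
  contDiff_infty.2 fun n => contDiff_superpos_nat n hY

end Superposition

/-! ### Smooth dependence of solutions over a short interval -/

/-- Perturbations `(ϑ, v)` of a control `u`; they stand for the control `u + (1 - ϑ) v`, for `ϑ`
with values in `{0, 1}`. -/
abbrev Perturb (k : ℕ) := Lp ℝ 1 (volume : Measure ℝ) × Lp (Euc k) ⊤ (volume : Measure ℝ)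

section Primitive

variable {μ : Measure ℝ} [IsFiniteMeasure μ] [NullSingletonClass μ]
  {E : Type*} [NormedAddCommGroup E] [NormedSpace ℝ E]

theorem Lp.intervalIntegrable_one (f : Lp E 1 μ) (a b : ℝ) : IntervalIntegrable f μ a b :=
  (L1.integrable_coeFn f).intervalIntegrable

theorem Lp.norm_primitive_le (f : Lp E 1 μ) (a t : ℝ) : ‖∫ s in a..t, f s ∂μ‖ ≤ ‖f‖ := by
  rw [L1.norm_eq_integral_norm]
  exact intervalIntegral.norm_integral_le_integral_norm_uIoc.trans
    (setIntegral_le_integral (L1.integrable_coeFn f).norm (.of_forall fun _ => norm_nonneg _))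

theorem Lp.memLp_top_primitive (f : Lp E 1 μ) (a : ℝ) :
    MemLp (fun t => ∫ s in a..t, f s ∂μ) ⊤ μ :=
  memLp_top_of_bound (intervalIntegral.continuous_primitive
    (Lp.intervalIntegrable_one f) a).aestronglyMeasurable ‖f‖
    (.of_forall fun t => Lp.norm_primitive_le f a t)

/-- The operator `f ↦ ∫_a^t f` from `L^1` to `L^∞`. -/
def primitiveCLM (μ : Measure ℝ) [IsFiniteMeasure μ] [NullSingletonClass μ]
    (E : Type*) [NormedAddCommGroup E] [NormedSpace ℝ E] (a : ℝ) : Lp E 1 μ →L[ℝ] Lp E ⊤ μ :=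
  LinearMap.mkContinuous
    { toFun := fun f => (Lp.memLp_top_primitive f a).toLp
      map_add' := fun f g => by
        rw [← MemLp.toLp_add]
        refine MemLp.toLp_congr _ _ (.of_forall fun t => ?_)
        simp only [Pi.add_apply]
        rw [← intervalIntegral.integral_add (Lp.intervalIntegrable_one f a t)
          (Lp.intervalIntegrable_one g a t)]
        exact intervalIntegral.integral_congr_ae_restrict
          (ae_restrict_of_ae (Lp.coeFn_add f g))
      map_smul' := fun c f => by
        rw [RingHom.id_apply, ← MemLp.toLp_const_smul]
        refine MemLp.toLp_congr _ _ (.of_forall fun t => ?_)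
        simp only [Pi.smul_apply]
        rw [← intervalIntegral.integral_smul]
        exact intervalIntegral.integral_congr_ae_restrict
          (ae_restrict_of_ae (Lp.coeFn_smul c f)) } 1 (fun f => by
      rw [one_mul]
      refine Lp.norm_top_le_of_ae_bound (norm_nonneg _) ?_
      filter_upwards [MemLp.coeFn_toLp (Lp.memLp_top_primitive f a)] with t ht
      exact (congrArg norm ht).le.trans (Lp.norm_primitive_le f a t))

theorem coeFn_primitiveCLM (f : Lp E 1 μ) (a : ℝ) :
    primitiveCLM μ E a f =ᵐ[μ] fun t => ∫ s in a..t, f s ∂μ :=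
  MemLp.coeFn_toLp (Lp.memLp_top_primitive f a)

end Primitive

section ShortTime

variable {k : ℕ} {E : Type} [NormedAddCommGroup E] [NormedSpace ℝ E] [FiniteDimensional ℝ E]
  [ProperSpace E] {G : Euc k × E → E × ℝ} {μ : Measure ℝ} [IsFiniteMeasure μ]

/-- The pairing of two `L^∞` functions. -/
def pairTop (μ : Measure ℝ) (k : ℕ) (E : Type) [NormedAddCommGroup E] [NormedSpace ℝ E] :
    Lp (Euc k) ⊤ μ × Lp E ⊤ μ →L[ℝ] Lp (Euc k × E) ⊤ μ :=
  ((ContinuousLinearMap.inl ℝ (Euc k) E).compLpL ⊤ μ).coprod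
    ((ContinuousLinearMap.inr ℝ (Euc k) E).compLpL ⊤ μ)

omit [FiniteDimensional ℝ E] [ProperSpace E] [IsFiniteMeasure μ] in
theorem coeFn_pairTop (v : Lp (Euc k) ⊤ μ) (x : Lp E ⊤ μ) :
    pairTop μ k E (v, x) =ᵐ[μ] fun t => (v t, x t) := by
  have : pairTop μ k E (v, x) = (ContinuousLinearMap.inl ℝ (Euc k) E).compLpL ⊤ μ v +
    (ContinuousLinearMap.inr ℝ (Euc k) E).compLpL ⊤ μ x := rfl
  rw [this]
  filter_upwards [Lp.coeFn_add ((ContinuousLinearMap.inl ℝ (Euc k) E).compLpL ⊤ μ v)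
    ((ContinuousLinearMap.inr ℝ (Euc k) E).compLpL ⊤ μ x),
    (ContinuousLinearMap.inl ℝ (Euc k) E).coeFn_compLpL v,
    (ContinuousLinearMap.inr ℝ (Euc k) E).coeFn_compLpL x] with t h1 h2 h3
  rw [h1, Pi.add_apply, h2, h3]
  simp

/-- Multiplication of `L^1` and `L^∞` functions. -/
def smulOneTop (μ : Measure ℝ) (F : Type*) [NormedAddCommGroup F] [NormedSpace ℝ F] :
    Lp ℝ 1 μ →L[ℝ] Lp F ⊤ μ →L[ℝ] Lp F 1 μ :=
  (ContinuousLinearMap.lsmul ℝ ℝ).holderL μ 1 ⊤ 1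

omit [IsFiniteMeasure μ] in
theorem coeFn_smulOneTop {F : Type*} [NormedAddCommGroup F] [NormedSpace ℝ F] (ϑ : Lp ℝ 1 μ)
    (f : Lp F ⊤ μ) : smulOneTop μ F ϑ f =ᵐ[μ] fun t => ϑ t • f t :=
  (ContinuousLinearMap.lsmul ℝ ℝ).coeFn_holder ϑ f

/-- The right hand side `G(u, x) + (1 - ϑ) (G(u + v, x) - G(u, x))` as an `L^1` function. -/
def rhsLp (hG : ContDiff ℝ ∞ G) (u : Lp (Euc k) ⊤ μ)
    (z : (Lp ℝ 1 μ × Lp (Euc k) ⊤ μ) × Lp E ⊤ μ) : Lp (E × ℝ) 1 μ :=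
  smulOneTop μ (E × ℝ) (Lp.const 1 μ 1) (superpos μ hG.continuous (pairTop μ k E (u, z.2))) +
  smulOneTop μ (E × ℝ) (Lp.const 1 μ 1 - z.1.1)
    (superpos μ hG.continuous (pairTop μ k E (u + z.1.2, z.2)) -
      superpos μ hG.continuous (pairTop μ k E (u, z.2)))

theorem coeFn_rhsLp (hG : ContDiff ℝ ∞ G) (u : Lp (Euc k) ⊤ μ)
    (z : (Lp ℝ 1 μ × Lp (Euc k) ⊤ μ) × Lp E ⊤ μ) :
    rhsLp hG u z =ᵐ[μ] fun t => G (u t, z.2 t) +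
      (1 - z.1.1 t) • (G (u t + z.1.2 t, z.2 t) - G (u t, z.2 t)) := by
  unfold rhsLp
  set a := superpos μ hG.continuous (pairTop μ k E (u, z.2))
  set b := superpos μ hG.continuous (pairTop μ k E (u + z.1.2, z.2))
  filter_upwards [Lp.coeFn_add (smulOneTop μ (E × ℝ) (Lp.const 1 μ 1) a)
      (smulOneTop μ (E × ℝ) (Lp.const 1 μ 1 - z.1.1) (b - a)),
    coeFn_smulOneTop (Lp.const 1 μ 1) a, coeFn_smulOneTop (Lp.const 1 μ 1 - z.1.1) (b - a),
    Lp.coeFn_sub b a, Lp.coeFn_sub (Lp.const 1 μ 1) z.1.1, Lp.coeFn_const 1 μ (1 : ℝ),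
    coeFn_superpos hG.continuous (pairTop μ k E (u, z.2)),
    coeFn_superpos hG.continuous (pairTop μ k E (u + z.1.2, z.2)),
    coeFn_pairTop u z.2, coeFn_pairTop (u + z.1.2) z.2, Lp.coeFn_add u z.1.2]
    with t h1 h2 h3 h4 h5 h6 h7 h8 h9 h10 h11
  rw [h1, Pi.add_apply, h2, h3, h4, Pi.sub_apply, h5, Pi.sub_apply, h6, h7, h8, h9, h10, h11]
  simp

theorem contDiff_rhsLp (hG : ContDiff ℝ ∞ G) (u : Lp (Euc k) ⊤ μ) :
    ContDiff ℝ ∞ (rhsLp hG u) := by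
  have hs := contDiff_superpos (μ := μ) hG
  have h0 : ContDiff ℝ ∞ (fun z : (Lp ℝ 1 μ × Lp (Euc k) ⊤ μ) × Lp E ⊤ μ =>
      superpos μ hG.continuous (pairTop μ k E (u, z.2))) :=
    hs.comp ((pairTop μ k E).contDiff.comp (contDiff_const.prodMk contDiff_snd))
  have h1 : ContDiff ℝ ∞ (fun z : (Lp ℝ 1 μ × Lp (Euc k) ⊤ μ) × Lp E ⊤ μ =>
      superpos μ hG.continuous (pairTop μ k E (u + z.1.2, z.2))) :=
    hs.comp ((pairTop μ k E).contDiff.comp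
      ((contDiff_const.add (contDiff_snd.comp contDiff_fst)).prodMk contDiff_snd))
  exact ((smulOneTop μ (E × ℝ) (Lp.const 1 μ 1)).contDiff.comp h0).add
    (((smulOneTop μ (E × ℝ)).contDiff.comp
      (contDiff_const.sub (contDiff_fst.comp contDiff_fst))).clm_apply (h1.sub h0))

/-- The derivative of the unperturbed right hand side in the state. -/
theorem hasFDerivAt_rhsLp_zero (hG : ContDiff ℝ ∞ G) (u : Lp (Euc k) ⊤ μ) (x : Lp E ⊤ μ) :
    HasFDerivAt (fun y => rhsLp hG u (0, y))
      ((smulOneTop μ (E × ℝ) (Lp.const 1 μ 1)).comp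
        ((mulTop μ (Euc k × E) (E × ℝ) (superpos μ (hG.continuous_fderiv (by simp))
          (pairTop μ k E (u, x)))).comp
          ((pairTop μ k E).comp (ContinuousLinearMap.inr ℝ (Lp (Euc k) ⊤ μ) (Lp E ⊤ μ))))) x := by
  have h : (fun y => rhsLp hG u (0, y)) = fun y => smulOneTop μ (E × ℝ) (Lp.const 1 μ 1)
      (superpos μ hG.continuous (pairTop μ k E (u, y))) := by
    funext y
    simp [rhsLp]
  rw [h]
  have h1 : HasFDerivAt (fun y : Lp E ⊤ μ => (u, y))
      (ContinuousLinearMap.inr ℝ (Lp (Euc k) ⊤ μ) (Lp E ⊤ μ)) x :=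
    hasFDerivAt_prodMk_right u x
  exact (smulOneTop μ (E × ℝ) (Lp.const 1 μ 1)).hasFDerivAt.comp x
    ((hasFDerivAt_superpos (contDiff_infty.1 hG 2) _).comp x
      ((pairTop μ k E).hasFDerivAt.comp x h1))

theorem coeFn_fderiv_rhsLp_zero (hG : ContDiff ℝ ∞ G) (u : Lp (Euc k) ⊤ μ) (x h : Lp E ⊤ μ) :
    ((fderiv ℝ (fun y => rhsLp hG u (0, y)) x h : Lp (E × ℝ) 1 μ) : ℝ → E × ℝ) =ᵐ[μ]
      fun t => fderiv ℝ G (u t, x t) (0, h t) := by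
  rw [(hasFDerivAt_rhsLp_zero hG u x).fderiv]
  simp only [ContinuousLinearMap.comp_apply]
  rw [ContinuousLinearMap.inr_apply]
  set a := superpos μ (hG.continuous_fderiv (by simp)) (pairTop μ k E (u, x))
  filter_upwards [coeFn_smulOneTop (Lp.const 1 μ 1)
      (mulTop μ (Euc k × E) (E × ℝ) a (pairTop μ k E (0, h))),
    coeFn_mulTop a (pairTop μ k E (0, h)), Lp.coeFn_const 1 μ (1 : ℝ),
    coeFn_superpos (hG.continuous_fderiv (by simp)) (pairTop μ k E (u, x)),
    coeFn_pairTop u x, coeFn_pairTop (0 : Lp (Euc k) ⊤ μ) h,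
    Lp.coeFn_zero (Euc k) ⊤ μ] with t h1 h2 h3 h4 h5 h6 h7
  rw [h1, h2, h3, h4, h5, h6, h7]
  simp

end ShortTime

section ShortTimeSolution

/-- Lebesgue measure on `[a, b]`. -/
abbrev resMeas (a b : ℝ) : Measure ℝ := volume.restrict (Icc a b)

variable {k : ℕ} {E : Type} [NormedAddCommGroup E] [NormedSpace ℝ E] [FiniteDimensional ℝ E]
  [ProperSpace E] {G : Euc k × E → E × ℝ} {a b : ℝ}

/-- Restriction of perturbations to `[a, b]`. -/
def restrictPerturb (k : ℕ) (a b : ℝ) : Perturb k →L[ℝ]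
    Lp ℝ 1 (resMeas a b) × Lp (Euc k) ⊤ (resMeas a b) :=
  (LpToLpRestrictCLM ℝ ℝ ℝ volume 1 (Icc a b)).prodMap
    (LpToLpRestrictCLM ℝ (Euc k) ℝ volume ⊤ (Icc a b))

/-- The integral operator of the differential equation. -/
def stateOp (E : Type) [NormedAddCommGroup E] [NormedSpace ℝ E] (a b : ℝ) :
    Lp (E × ℝ) 1 (resMeas a b) →L[ℝ] Lp E ⊤ (resMeas a b) :=
  (primitiveCLM (resMeas a b) E a).comp
    ((ContinuousLinearMap.fst ℝ E ℝ).compLpL 1 (resMeas a b))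

theorem coeFn_stateOp (f : Lp (E × ℝ) 1 (resMeas a b)) :
    stateOp E a b f =ᵐ[volume.restrict (Icc a b)] fun t => ∫ s in a..t, (f s).1 := by
  have h1 := (ContinuousLinearMap.fst ℝ E ℝ).coeFn_compLpL f
  filter_upwards [coeFn_primitiveCLM ((ContinuousLinearMap.fst ℝ E ℝ).compLpL 1 _ f) a,
    ae_restrict_mem measurableSet_Icc] with t ht hmem
  rw [stateOp, ContinuousLinearMap.comp_apply, ht, intervalIntegral.integral_of_le hmem.1,
    intervalIntegral.integral_of_le hmem.1, Measure.restrict_restrict measurableSet_Ioc,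
    inter_eq_left.2 (Ioc_subset_Icc_self.trans (Icc_subset_Icc_right hmem.2))]
  exact setIntegral_congr_ae measurableSet_Ioc (by
    filter_upwards [(ae_restrict_iff' measurableSet_Icc).1 h1] with s hs hs'
    exact hs (Icc_subset_Icc_right hmem.2 (Ioc_subset_Icc_self hs')))

theorem exists_shortTime_solution (hab : a ≤ b) (hG : ContDiff ℝ ∞ G)
    (u : Lp (Euc k) ⊤ (resMeas a b)) (p₀ : E)
    (x : Lp E ⊤ (resMeas a b))
    (hx : x = Lp.const ⊤ _ p₀ + stateOp E a b (rhsLp hG u (0, x))) (K : ℝ) (hK0 : 0 ≤ K)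
    (hK : ∀ᵐ t ∂(resMeas a b), ∀ h : E,
      ‖(fderiv ℝ G (u t, x t) (0, h)).1‖ ≤ K * ‖h‖) (hKab : K * (b - a) < 1) :
    ∃ ψ : E × Perturb k → Lp E ⊤ (resMeas a b),
      ContDiffAt ℝ ∞ ψ (p₀, 0) ∧ ψ (p₀, 0) = x ∧
      ∀ᶠ z in 𝓝 (p₀, 0), ψ z = Lp.const ⊤ _ z.1 +
        stateOp E a b (rhsLp hG u (restrictPerturb k a b z.2, ψ z)) := by
  let Θ : (E × Perturb k) × Lp E ⊤ (resMeas a b) → Lp E ⊤ (resMeas a b) := fun z =>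
    z.2 - Lp.constL ⊤ (resMeas a b) ℝ z.1.1 -
      stateOp E a b (rhsLp hG u (restrictPerturb k a b z.1.2, z.2))
  have hΘ : ContDiff ℝ ∞ Θ := by
    have h1 : ContDiff ℝ ∞ fun z : (E × Perturb k) × Lp E ⊤ (resMeas a b) => Lp.constL ⊤ (resMeas a b) ℝ z.1.1 :=
      ((Lp.constL ⊤ (resMeas a b) ℝ : E →L[ℝ] Lp E ⊤ (resMeas a b)).comp
        ((ContinuousLinearMap.fst ℝ E (Perturb k)).comp (ContinuousLinearMap.fst ℝ
          (E × Perturb k) (Lp E ⊤ (resMeas a b))))).contDiff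
    have h2 : ContDiff ℝ ∞ fun z : (E × Perturb k) × Lp E ⊤ (resMeas a b) => restrictPerturb k a b z.1.2 :=
      (restrictPerturb k a b).contDiff.comp (contDiff_snd.comp contDiff_fst)
    have h3 : ContDiff ℝ ∞ fun z : (E × Perturb k) × Lp E ⊤ (resMeas a b) =>
        rhsLp hG u (restrictPerturb k a b z.1.2, z.2) :=
      (contDiff_rhsLp hG u).comp (h2.prodMk contDiff_snd)
    have h4 : ContDiff ℝ ∞ fun z : (E × Perturb k) × Lp E ⊤ (resMeas a b) =>
        stateOp E a b (rhsLp hG u (restrictPerturb k a b z.1.2, z.2)) :=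
      (stateOp E a b).contDiff.comp h3
    exact (contDiff_snd.sub h1).sub h4
  have hΘ0 : Θ ((p₀, 0), x) = 0 := by
    have h1 : Θ ((p₀, 0), x) = x - Lp.const ⊤ (resMeas a b) p₀ - stateOp E a b (rhsLp hG u (0, x)) := by
      simp only [Θ, map_zero]; rfl
    rw [h1, sub_sub, ← hx, sub_self]
  set D := fderiv ℝ (fun y => rhsLp hG u (0, y)) x with hD
  have hinr : fderiv ℝ Θ ((p₀, 0), x) ∘L ContinuousLinearMap.inr ℝ (E × Perturb k) (Lp E ⊤ (resMeas a b)) =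
      1 - (stateOp E a b).comp D := by
    have h1 : HasFDerivAt (fun y : Lp E ⊤ (resMeas a b) => Θ ((p₀, 0), y))
        (fderiv ℝ Θ ((p₀, 0), x) ∘L ContinuousLinearMap.inr ℝ (E × Perturb k) (Lp E ⊤ (resMeas a b))) x :=
      ((hΘ.differentiable (by simp)) _).hasFDerivAt.comp x (hasFDerivAt_prodMk_right _ x)
    have h2 : HasFDerivAt (fun y : Lp E ⊤ (resMeas a b) => Θ ((p₀, 0), y))
        (1 - (stateOp E a b).comp D) x := by
      have h3 : (fun y : Lp E ⊤ (resMeas a b) => Θ ((p₀, 0), y)) = fun y =>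
          y - Lp.constL ⊤ (resMeas a b) ℝ p₀ - stateOp E a b (rhsLp hG u (0, y)) := by
        funext y; simp only [Θ, map_zero]
      rw [h3]
      exact ((hasFDerivAt_id x).sub_const _).sub ((stateOp E a b).hasFDerivAt.comp x
        (hasFDerivAt_rhsLp_zero hG u x).differentiableAt.hasFDerivAt)
    exact h1.unique h2
  have hnorm : ‖(stateOp E a b).comp D‖ ≤ K * (b - a) := by
    refine ContinuousLinearMap.opNorm_le_bound _ (mul_nonneg hK0 (by linarith)) fun h => ?_
    refine Lp.norm_top_le_of_ae_bound
      (mul_nonneg (mul_nonneg hK0 (by linarith)) (norm_nonneg _)) ?_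
    have h1 : ∀ᵐ t ∂(resMeas a b), ‖((D h : Lp (E × ℝ) 1 (resMeas a b)) t).1‖ ≤ K * ‖h‖ := by
      filter_upwards [coeFn_fderiv_rhsLp_zero hG u x h, hK, Lp.ae_norm_le_norm_top h]
        with t h1 h2 h3
      rw [h1]
      exact (h2 _).trans (by gcongr)
    filter_upwards [coeFn_stateOp (D h), ae_restrict_mem measurableSet_Icc] with t ht hmem
    rw [ContinuousLinearMap.comp_apply, ht]
    have h2 : ‖∫ s in a..t, ((D h : Lp (E × ℝ) 1 (resMeas a b)) s).1‖ ≤ K * ‖h‖ * |t - a| := by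
      refine intervalIntegral.norm_integral_le_of_norm_le_const_ae ?_
      filter_upwards [(ae_restrict_iff' measurableSet_Icc).1 h1] with s hs hs'
      rw [uIoc_of_le hmem.1] at hs'
      exact hs ⟨hs'.1.le, hs'.2.trans hmem.2⟩
    refine h2.trans ?_
    rw [abs_of_nonneg (by linarith [hmem.1])]
    have : K * ‖h‖ * (t - a) ≤ K * ‖h‖ * (b - a) := by
      gcongr
      exact hmem.2
    linarith
  have hinv : (fderiv ℝ Θ ((p₀, 0), x) ∘L
      ContinuousLinearMap.inr ℝ (E × Perturb k) (Lp E ⊤ (resMeas a b))).IsInvertible := by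
    rw [hinr]
    obtain ⟨w, hw⟩ := isUnit_one_sub_of_norm_lt_one (hnorm.trans_lt hKab)
    exact ⟨ContinuousLinearEquiv.unitsEquiv ℝ _ w, hw⟩
  have hΘat : ContDiffAt ℝ ∞ Θ ((p₀, 0), x) := hΘ.contDiffAt
  refine ⟨hΘat.implicitFunction (by simp) hinv, hΘat.contDiffAt_implicitFunction (by simp) hinv,
    hΘat.implicitFunction_apply_self (by simp) hinv, ?_⟩
  filter_upwards [hΘat.eventually_apply_implicitFunction (by simp) hinv] with z hz
  rw [hΘ0] at hz
  simp only [Θ] at hz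
  rw [sub_sub, sub_eq_zero] at hz
  exact hz

end ShortTimeSolution

/-! ### Lipschitz curves and their almost everywhere derivatives -/

section LipschitzCurves

variable {E : Type*} [NormedAddCommGroup E] [NormedSpace ℝ E] [FiniteDimensional ℝ E]
  {a b : ℝ} {x g : ℝ → E}

theorem lipschitz_primitive {C : ℝ} (hC : 0 ≤ C) (hg : IntervalIntegrable g volume a b)
    (hgC : ∀ᵐ t ∂(resMeas a b), ‖g t‖ ≤ C) (p : E) :
    LipschitzOnWith C.toNNReal (fun t => p + ∫ s in a..t, g s) (Icc a b) := by
  refine LipschitzOnWith.of_dist_le_mul fun s hs t ht => ?_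
  have hab : a ≤ b := hs.1.trans hs.2
  have hi : ∀ r ∈ Icc a b, IntervalIntegrable g volume a r := fun r hr =>
    hg.mono_set (by rw [uIcc_of_le hr.1, uIcc_of_le hab]; exact Icc_subset_Icc_right hr.2)
  rw [dist_eq_norm, add_sub_add_left_eq_sub,
    intervalIntegral.integral_interval_sub_left (hi s hs) (hi t ht), Real.coe_toNNReal _ hC,
    Real.dist_eq]
  refine intervalIntegral.norm_integral_le_of_norm_le_const_ae ?_
  filter_upwards [(ae_restrict_iff' measurableSet_Icc).1 hgC] with r hr hr'
  refine hr ?_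
  have := uIoc_subset_uIcc hr'
  exact (uIcc_subset_Icc ht hs) this

theorem hasDerivAt_primitive (hab : a ≤ b) (hg : IntervalIntegrable g volume a b) (p : E) :
    ∀ᵐ t ∂(resMeas a b), HasDerivAt (fun t => p + ∫ s in a..t, g s) (g t) t := by
  rw [ae_restrict_iff' measurableSet_Icc]
  filter_upwards [hg.ae_hasDerivAt_integral] with t ht hmem
  rw [uIcc_of_le hab] at ht
  exact (ht hmem a (left_mem_Icc.2 hab)).const_add p

theorem LipschitzOnWith.eq_primitive {K : NNReal} (hx : LipschitzOnWith K x (Icc a b))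
    (hg : ∀ᵐ t ∂(resMeas a b), HasDerivAt x (g t) t) (hab : a ≤ b) :
    IntervalIntegrable g volume a b ∧ ∀ t ∈ Icc a b, x t = x a + ∫ s in a..t, g s := by
  have hmeas : AEStronglyMeasurable g (resMeas a b) := by
    refine (stronglyMeasurable_deriv x).aestronglyMeasurable.congr ?_
    filter_upwards [hg] with t ht using ht.deriv
  have hIoo : ∀ᵐ t ∂(resMeas a b), t ∈ Ioo a b := by
    rw [resMeas, ← restrict_Ioo_eq_restrict_Icc]
    exact ae_restrict_mem measurableSet_Ioo
  have hbound : ∀ᵐ t ∂(resMeas a b), ‖g t‖ ≤ K := by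
    filter_upwards [hg, hIoo] with t ht hmem
    exact ht.le_of_lipschitzOn (Icc_mem_nhds hmem.1 hmem.2) hx
  have hint : IntervalIntegrable g volume a b := by
    rw [intervalIntegrable_iff_integrableOn_Icc_of_le hab]
    exact Integrable.of_bound hmeas K hbound
  refine ⟨hint, fun t ht => ?_⟩
  have hprim := lipschitz_primitive (K.coe_nonneg) hint hbound 0
  have hac : AbsolutelyContinuousOnInterval (fun t => x t - (0 + ∫ s in a..t, g s)) a b := by
    have h1 : LipschitzOnWith (K + (K : ℝ).toNNReal)
        (fun t => x t - (0 + ∫ s in a..t, g s)) (uIcc a b) := by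
      rw [uIcc_of_le hab]
      exact hx.sub hprim
    exact h1.absolutelyContinuousOnInterval
  obtain ⟨C, hC⟩ := hac.const_of_ae_hasDerivAt_zero (by
    have h2 := (ae_restrict_iff' measurableSet_Icc).1 hg
    have h3 := (ae_restrict_iff' measurableSet_Icc).1 (hasDerivAt_primitive hab hint 0)
    filter_upwards [h2, h3] with t h2 h3 hmem
    rw [uIcc_of_le hab] at hmem
    have h4 := (h2 hmem).sub (h3 hmem)
    rwa [sub_self] at h4)
  rw [uIcc_of_le hab] at hC
  have h1 := hC t ht
  have h2 := hC a (left_mem_Icc.2 hab)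
  simp only [intervalIntegral.integral_same, zero_add, sub_zero] at h1 h2
  rw [h2, ← h1]
  abel

/-- Uniqueness for integral equations over short intervals. -/
theorem eqOn_of_primitive {y h : ℝ → E} (hx : ContinuousOn x (Icc a b))
    (hy : ContinuousOn y (Icc a b)) (hg : IntervalIntegrable g volume a b)
    (hh : IntervalIntegrable h volume a b) (p : E)
    (hxg : ∀ t ∈ Icc a b, x t = p + ∫ s in a..t, g s)
    (hyh : ∀ t ∈ Icc a b, y t = p + ∫ s in a..t, h s) {K : ℝ} (hK : 0 ≤ K)
    (hgh : ∀ᵐ t ∂(resMeas a b), ‖g t - h t‖ ≤ K * ‖x t - y t‖) (hab : a ≤ b)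
    (hKab : K * (b - a) < 1) : EqOn x y (Icc a b) := by
  obtain ⟨t₀, ht₀, hmax⟩ := isCompact_Icc.exists_isMaxOn ⟨a, left_mem_Icc.2 hab⟩ (hx.sub hy).norm
  have hi : ∀ f : ℝ → E, IntervalIntegrable f volume a b → IntervalIntegrable f volume a t₀ :=
    fun f hf => hf.mono_set (by
      rw [uIcc_of_le ht₀.1, uIcc_of_le hab]; exact Icc_subset_Icc_right ht₀.2)
  have h1 : ‖x t₀ - y t₀‖ ≤ K * ‖x t₀ - y t₀‖ * |t₀ - a| := by
    conv_lhs => rw [hxg t₀ ht₀, hyh t₀ ht₀, add_sub_add_left_eq_sub,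
      ← intervalIntegral.integral_sub (hi g hg) (hi h hh)]
    refine intervalIntegral.norm_integral_le_of_norm_le_const_ae ?_
    filter_upwards [(ae_restrict_iff' measurableSet_Icc).1 hgh] with s hs hs'
    rw [uIoc_of_le ht₀.1] at hs'
    have hmem : s ∈ Icc a b := ⟨hs'.1.le, hs'.2.trans ht₀.2⟩
    exact (hs hmem).trans (mul_le_mul_of_nonneg_left (hmax hmem) hK)
  rw [abs_of_nonneg (by linarith [ht₀.1])] at h1
  have h2 : K * (t₀ - a) < 1 := lt_of_le_of_lt
    (mul_le_mul_of_nonneg_left (by linarith [ht₀.2]) hK) hKab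
  have h3 : ‖x t₀ - y t₀‖ ≤ 0 := by nlinarith [norm_nonneg (x t₀ - y t₀)]
  intro t ht
  have h4 : ‖x t - y t‖ ≤ ‖x t₀ - y t₀‖ := hmax ht
  exact sub_eq_zero.1 (norm_le_zero_iff.1 (h4.trans h3))

end LipschitzCurves

/-! ### Trajectories on intervals and their chart representations -/

section TrajectoriesOn

variable {E H P : Type*} [NormedAddCommGroup E] [NormedSpace ℝ E] [TopologicalSpace H]
  [TopologicalSpace P] [ChartedSpace H P]

/-- Trajectories on `[a, b]` of a time dependent vector field. -/
structure IsTrajOn (I : ModelWithCorners ℝ E H) (X : ℝ → (p : P) → TangentSpace I p)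
    (a b : ℝ) (γ : ℝ → P) : Prop where
  continuousOn : ContinuousOn γ (Icc a b)
  lipschitz : ∀ t₀ ∈ Icc a b, ∃ K : NNReal, ∃ s ∈ 𝓝[Icc a b] t₀,
    LipschitzOnWith K (fun t => extChartAt I (γ t₀) (γ t)) s
  ode : ∀ᵐ t ∂(resMeas a b),
    HasMFDerivAt 𝓘(ℝ, ℝ) I γ t (ContinuousLinearMap.smulRight (1 : ℝ →L[ℝ] ℝ) (X t (γ t)))

variable {I : ModelWithCorners ℝ E H} {X X' : ℝ → (p : P) → TangentSpace I p} {a b c : ℝ}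
  {γ η : ℝ → P}

theorem isTrajOn_zero_iff {T : ℝ} : IsTrajOn I X 0 T γ ↔ IsTrajectory I X T γ :=
  ⟨fun h => ⟨h.1, h.2, h.3⟩, fun h => ⟨h.1, h.2, h.3⟩⟩

theorem IsTrajOn.mono {a' b' : ℝ} (h : IsTrajOn I X a b γ) (hab : Icc a' b' ⊆ Icc a b) :
    IsTrajOn I X a' b' γ where
  continuousOn := h.continuousOn.mono hab
  lipschitz t₀ ht₀ := by
    obtain ⟨K, s, hs, hK⟩ := h.lipschitz t₀ (hab ht₀)
    exact ⟨K, s, nhdsWithin_mono _ hab hs, hK⟩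
  ode := ae_restrict_of_ae_restrict_of_subset hab h.ode

theorem ae_mem_Ioo (a b : ℝ) : ∀ᵐ t ∂(resMeas a b), t ∈ Ioo a b := by
  rw [resMeas, ← restrict_Ioo_eq_restrict_Icc]
  exact ae_restrict_mem measurableSet_Ioo

theorem IsTrajOn.congr (h : IsTrajOn I X a b γ) (hη : EqOn η γ (Icc a b)) :
    IsTrajOn I X a b η where
  continuousOn := h.continuousOn.congr hη
  lipschitz t₀ ht₀ := by
    obtain ⟨K, s, hs, hK⟩ := h.lipschitz t₀ ht₀
    refine ⟨K, s ∩ Icc a b, Filter.inter_mem hs self_mem_nhdsWithin, fun x hx y hy => ?_⟩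
    simp only [hη ht₀, hη hx.2, hη hy.2]
    exact hK hx.1 hy.1
  ode := by
    filter_upwards [h.ode, ae_mem_Ioo a b] with t h1 h2
    rw [hη (Ioo_subset_Icc_self h2)]
    refine h1.congr_of_eventuallyEq ?_
    filter_upwards [Icc_mem_nhds h2.1 h2.2] with s hs using hη hs

theorem ae_resMeas_union {p : ℝ → Prop}
    (h1 : ∀ᵐ t ∂(resMeas a b), p t) (h2 : ∀ᵐ t ∂(resMeas b c), p t) :
    ∀ᵐ t ∂(resMeas a c), p t := by
  rw [resMeas, ae_restrict_iff' measurableSet_Icc] at *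
  filter_upwards [h1, h2] with t h1 h2 h3
  rcases le_total t b with h | h
  · exact h1 ⟨h3.1, h⟩
  · exact h2 ⟨h, h3.2⟩

theorem LipschitzOnWith.union_Icc {F : Type*} [PseudoMetricSpace F] {x : ℝ → F} {K : NNReal}
    {s t : Set ℝ} (hs : LipschitzOnWith K x s) (ht : LipschitzOnWith K x t) (hbs : b ∈ s)
    (hbt : b ∈ t) (hs' : ∀ r ∈ s, r ≤ b) (ht' : ∀ r ∈ t, b ≤ r) :
    LipschitzOnWith K x (s ∪ t) := by
  have key : ∀ r ∈ s, ∀ r' ∈ t, dist (x r) (x r') ≤ K * dist r r' := by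
    intro r hr r' hr'
    have h1 := hs.dist_le_mul r hr b hbs
    have h2 := ht.dist_le_mul b hbt r' hr'
    have h3 : dist r r' = dist r b + dist b r' := by
      have e1 := hs' r hr
      have e2 := ht' r' hr'
      rw [dist_comm r r', dist_comm r b, dist_comm b r', Real.dist_eq, Real.dist_eq, Real.dist_eq,
        abs_of_nonneg, abs_of_nonneg, abs_of_nonneg] <;> linarith
    rw [h3, mul_add]
    exact (dist_triangle _ _ _).trans (add_le_add h1 h2)
  refine LipschitzOnWith.of_dist_le_mul ?_
  rintro r (hr | hr) r' (hr' | hr')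
  · exact hs.dist_le_mul r hr r' hr'
  · exact key r hr r' hr'
  · rw [dist_comm, dist_comm r]; exact key r' hr' r hr
  · exact ht.dist_le_mul r hr r' hr'

/-- A curve which is a trajectory on `[a, b]` and on `[b, c]` is a trajectory on `[a, c]`. -/
theorem IsTrajOn.union (hab : a ≤ b) (hbc : b ≤ c) (h1 : IsTrajOn I X a b γ)
    (h2 : IsTrajOn I X b c γ) : IsTrajOn I X a c γ where
  continuousOn := by
    rw [← Icc_union_Icc_eq_Icc hab hbc]
    exact h1.continuousOn.union_of_isClosed h2.continuousOn isClosed_Icc isClosed_Icc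
  lipschitz t₀ ht₀ := by
    have hU := Icc_union_Icc_eq_Icc hab hbc
    rcases lt_trichotomy t₀ b with h | h | h
    · obtain ⟨K, s, hs, hK⟩ := h1.lipschitz t₀ ⟨ht₀.1, h.le⟩
      refine ⟨K, s, ?_, hK⟩
      rwa [← hU, nhdsWithin_union, Filter.mem_sup, and_iff_left_of_imp]
      intro _
      have : 𝓝[Icc b c] t₀ = ⊥ := notMem_closure_iff_nhdsWithin_eq_bot.1
        (by rw [closure_Icc]; exact fun h' => absurd h'.1 (not_le.2 h))
      rw [this]; trivial
    · subst h
      obtain ⟨K, s, hs, hK⟩ := h1.lipschitz t₀ (right_mem_Icc.2 hab)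
      obtain ⟨K', s', hs', hK'⟩ := h2.lipschitz t₀ (left_mem_Icc.2 hbc)
      refine ⟨max K K', (s ∩ Icc a t₀) ∪ (s' ∩ Icc t₀ c), ?_, ?_⟩
      · rw [← hU, nhdsWithin_union, Filter.mem_sup]
        exact ⟨Filter.mem_of_superset (Filter.inter_mem hs self_mem_nhdsWithin)
            subset_union_left,
          Filter.mem_of_superset (Filter.inter_mem hs' self_mem_nhdsWithin) subset_union_right⟩
      · exact LipschitzOnWith.union_Icc (b := t₀)
          ((hK.mono inter_subset_left).weaken (le_max_left _ _))
          ((hK'.mono inter_subset_left).weaken (le_max_right _ _))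
          ⟨mem_of_mem_nhdsWithin (right_mem_Icc.2 hab) hs, right_mem_Icc.2 hab⟩
          ⟨mem_of_mem_nhdsWithin (left_mem_Icc.2 hbc) hs', left_mem_Icc.2 hbc⟩
          (fun r hr => hr.2.2) (fun r hr => hr.2.1)
    · obtain ⟨K, s, hs, hK⟩ := h2.lipschitz t₀ ⟨h.le, ht₀.2⟩
      refine ⟨K, s, ?_, hK⟩
      rwa [← hU, nhdsWithin_union, Filter.mem_sup, and_iff_right_of_imp]
      intro _
      have : 𝓝[Icc a b] t₀ = ⊥ := notMem_closure_iff_nhdsWithin_eq_bot.1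
        (by rw [closure_Icc]; exact fun h' => absurd h'.2 (not_le.2 h))
      rw [this]; trivial
  ode := ae_resMeas_union h1.ode h2.ode

/-- Concatenation of trajectories. -/
theorem IsTrajOn.concat (hab : a ≤ b) (hbc : b ≤ c) (h1 : IsTrajOn I X a b γ)
    (h2 : IsTrajOn I X b c η) (h : γ b = η b) :
    IsTrajOn I X a c (fun t => if t ≤ b then γ t else η t) := by
  refine (h1.congr fun t ht => if_pos ht.2).union hab hbc (h2.congr fun t ht => ?_)
  rcases ht.1.eq_or_lt with rfl | h'
  · simp [h]
  · simp [not_le.2 h']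

variable [IsManifold I ∞ P]

theorem IsTrajOn.ae_hasDerivAt_chart (h : IsTrajOn I X a b γ) (p₀ : P) :
    ∀ᵐ t ∂(resMeas a b), γ t ∈ (extChartAt I p₀).source →
      HasDerivAt (fun t => extChartAt I p₀ (γ t))
        (mfderiv I 𝓘(ℝ, E) (extChartAt I p₀) (γ t) (X t (γ t))) t := by
  filter_upwards [h.ode] with t ht hmem
  rw [extChartAt_source] at hmem
  have h1 := (mdifferentiableAt_extChartAt (I := I) hmem).hasMFDerivAt.comp t ht
  set v : E := mfderiv I 𝓘(ℝ, E) (extChartAt I p₀) (γ t) (X t (γ t)) with hv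
  have h2 : HasFDerivAt (fun t => extChartAt I p₀ (γ t))
      (ContinuousLinearMap.smulRight (1 : ℝ →L[ℝ] ℝ) v) t := by
    refine hasMFDerivAt_iff_hasFDerivAt.1 (h1.congr_mfderiv (ContinuousLinearMap.ext fun r => ?_))
    exact (mfderiv I 𝓘(ℝ, E) (extChartAt I p₀) (γ t)).map_smul (r : ℝ) (X t (γ t))
  simpa using h2.hasDerivAt

variable [I.Boundaryless]

theorem contDiffAt_coord_change {p p' : P} {y : E}
    (hy : y ∈ ((extChartAt I p').symm ≫ extChartAt I p).source) :
    ContDiffAt ℝ ∞ (extChartAt I p ∘ (extChartAt I p').symm) y := by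
  have := contDiffWithinAt_ext_coord_change (I := I) (n := ∞) p p' hy
  rwa [I.range_eq_univ, contDiffWithinAt_univ] at this

/-- If a curve is Lipschitz in some chart then it is Lipschitz in every chart. -/
theorem exists_lipschitzOnWith_chart {s₀ : Set ℝ} {t₀ : ℝ} {p₀ p₁ : P}
    (hc : ContinuousWithinAt γ s₀ t₀)
    (h0 : γ t₀ ∈ (extChartAt I p₀).source) (h1 : γ t₀ ∈ (extChartAt I p₁).source)
    (h : ∃ K : NNReal, ∃ s ∈ 𝓝[s₀] t₀, LipschitzOnWith K (fun t => extChartAt I p₁ (γ t)) s) :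
    ∃ K : NNReal, ∃ s ∈ 𝓝[s₀] t₀, LipschitzOnWith K (fun t => extChartAt I p₀ (γ t)) s := by
  obtain ⟨K, s, hs, hK⟩ := h
  have hy : extChartAt I p₁ (γ t₀) ∈ ((extChartAt I p₁).symm ≫ extChartAt I p₀).source := by
    rw [PartialEquiv.trans_source, PartialEquiv.symm_source]
    exact ⟨(extChartAt I p₁).map_source h1, by
      rwa [mem_preimage, (extChartAt I p₁).left_inv h1]⟩
  obtain ⟨K', U, hU, hK'⟩ := ((contDiffAt_coord_change hy).of_le
    (by exact_mod_cast le_top : (1 : ℕ∞ω) ≤ ∞)).exists_lipschitzOnWith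
  have hc1 : ContinuousWithinAt (fun t => extChartAt I p₁ (γ t)) s₀ t₀ :=
    (continuousAt_extChartAt' h1).comp_continuousWithinAt hc
  refine ⟨K' * K, s ∩ ((fun t => extChartAt I p₁ (γ t)) ⁻¹' U ∩
    γ ⁻¹' (extChartAt I p₁).source), Filter.inter_mem hs (Filter.inter_mem (hc1 hU)
      (hc ((isOpen_extChartAt_source p₁).mem_nhds h1))), ?_⟩
  have h2 : LipschitzOnWith (K' * K) ((extChartAt I p₀ ∘ (extChartAt I p₁).symm) ∘
      (fun t => extChartAt I p₁ (γ t))) (s ∩ ((fun t => extChartAt I p₁ (γ t)) ⁻¹' U ∩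
        γ ⁻¹' (extChartAt I p₁).source)) :=
    hK'.comp (hK.mono inter_subset_left) fun t ht => ht.2.1
  intro x hx y hy
  have := h2 hx hy
  simpa only [Function.comp_apply, (extChartAt I p₁).left_inv hx.2.2,
    (extChartAt I p₁).left_inv hy.2.2] using this

/-- A solution in a chart gives a trajectory. -/
theorem isTrajOn_of_chart {p₀ : P} {x : ℝ → E} {K : NNReal}
    (hx : LipschitzOnWith K x (Icc a b)) (hmem : ∀ t ∈ Icc a b, x t ∈ (extChartAt I p₀).target)
    (hd : ∀ᵐ t ∂(resMeas a b), HasDerivAt x (mfderiv I 𝓘(ℝ, E) (extChartAt I p₀)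
      ((extChartAt I p₀).symm (x t)) (X t ((extChartAt I p₀).symm (x t)))) t) :
    IsTrajOn I X a b (fun t => (extChartAt I p₀).symm (x t)) := by
  have hcont : ContinuousOn (fun t => (extChartAt I p₀).symm (x t)) (Icc a b) :=
    (continuousOn_extChartAt_symm p₀).comp hx.continuousOn hmem
  refine ⟨hcont, fun t₀ ht₀ => ?_, ?_⟩
  · refine exists_lipschitzOnWith_chart (p₁ := p₀) (hcont t₀ ht₀)
      (mem_extChartAt_source _) ((extChartAt I p₀).map_target (hmem t₀ ht₀))
      ⟨K, Icc a b, self_mem_nhdsWithin, fun r hr r' hr' => ?_⟩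
    simpa only [(extChartAt I p₀).right_inv (hmem r hr), (extChartAt I p₀).right_inv (hmem r' hr')]
      using hx hr hr'
  · filter_upwards [hd, ae_mem_Ioo a b] with t ht htm
    have hm := hmem t (Ioo_subset_Icc_self htm)
    have h1 := mdifferentiableWithinAt_extChartAt_symm (I := I) hm
    rw [I.range_eq_univ, mdifferentiableWithinAt_univ] at h1
    have h2 := mfderivWithin_extChartAt_symm_comp_mfderiv_extChartAt (I := I) hm
    rw [I.range_eq_univ, mfderivWithin_univ] at h2
    have h3 := h1.hasMFDerivAt.comp t (hasMFDerivAt_iff_hasFDerivAt.2 ht.hasFDerivAt)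
    refine h3.congr_mfderiv ?_
    have h4 := DFunLike.congr_fun h2 (X t ((extChartAt I p₀).symm (x t)))
    refine ContinuousLinearMap.ext fun r => ?_
    refine ((mfderiv 𝓘(ℝ, E) I (extChartAt I p₀).symm (x t)).map_smul (r : ℝ) _).trans ?_
    exact congrArg (HSMul.hSMul (α := ℝ) r) h4

end TrajectoriesOn

/-! ### Control systems, uniqueness of trajectories -/

section ControlSystems

variable {k : ℕ} {E : Type} {H P : Type*} [NormedAddCommGroup E] [NormedSpace ℝ E]
  [FiniteDimensional ℝ E] [TopologicalSpace H] [TopologicalSpace P] [ChartedSpace H P]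

/-- The chart representation of a family of vector fields. -/
def chartField (I : ModelWithCorners ℝ E H) (Y : Euc k → (p : P) → TangentSpace I p) (p₀ : P)
    (z : Euc k × E) : E :=
  mfderiv I 𝓘(ℝ, E) (extChartAt I p₀) ((extChartAt I p₀).symm z.2)
    (Y z.1 ((extChartAt I p₀).symm z.2))

/-- Families of vector fields and of functions that are smooth, jointly with the control, in all
charts. -/
structure SmoothSystem (I : ModelWithCorners ℝ E H) (Y : Euc k → (p : P) → TangentSpace I p)
    (L : Euc k → P → ℝ) : Prop where
  field : ∀ p₀ : P, ContDiffOn ℝ ∞ (chartField I Y p₀) (univ ×ˢ (extChartAt I p₀).target)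
  cost : ∀ p₀ : P, ContDiffOn ℝ ∞ (fun z : Euc k × E => L z.1 ((extChartAt I p₀).symm z.2))
    (univ ×ˢ (extChartAt I p₀).target)

variable {I : ModelWithCorners ℝ E H} [I.Boundaryless] [IsManifold I ∞ P]
  {Y : Euc k → (p : P) → TangentSpace I p} {L : Euc k → P → ℝ}

omit [FiniteDimensional ℝ E] [I.Boundaryless] [IsManifold I ∞ P] in
theorem chartField_apply {p₀ q : P} (hq : q ∈ (extChartAt I p₀).source) (c : Euc k) :
    chartField I Y p₀ (c, extChartAt I p₀ q) = mfderiv I 𝓘(ℝ, E) (extChartAt I p₀) q (Y c q) :=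
  congrArg (fun q' => (mfderiv I 𝓘(ℝ, E) (extChartAt I p₀) q' (Y c q') : E))
    ((extChartAt I p₀).left_inv hq)

/-- A system that is smooth in charts agrees, near a point, with a globally defined one. -/
theorem SmoothSystem.exists_cutoff (hS : SmoothSystem I Y L) (p₀ : P) :
    ∃ G : Euc k × E → E × ℝ, ContDiff ℝ ∞ G ∧ ∃ ρ > 0,
      Metric.closedBall (extChartAt I p₀ p₀) ρ ⊆ (extChartAt I p₀).target ∧
      ∀ c, ∀ y ∈ Metric.closedBall (extChartAt I p₀ p₀) ρ,
        G (c, y) = (chartField I Y p₀ (c, y), L c ((extChartAt I p₀).symm y)) := by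
  obtain ⟨r, hr, hrt⟩ := Metric.nhds_basis_closedBall.mem_iff.1
    (extChartAt_target_mem_nhds (I := I) p₀)
  let χ : ContDiffBump (extChartAt I p₀ p₀) := ⟨r / 3, r / 2, by linarith, by linarith⟩
  let F : Euc k × E → E × ℝ := fun z =>
    (chartField I Y p₀ z, L z.1 ((extChartAt I p₀).symm z.2))
  have hF : ContDiffOn ℝ ∞ F (univ ×ˢ (extChartAt I p₀).target) :=
    (hS.field p₀).prodMk (hS.cost p₀)
  have hχ : ContDiff ℝ ∞ (fun z : Euc k × E => χ z.2) := χ.contDiff.comp contDiff_snd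
  refine ⟨fun z => χ z.2 • F z, ?_, r / 3, by linarith,
    (Metric.closedBall_subset_closedBall (by linarith)).trans hrt, fun c y hy => ?_⟩
  · rw [contDiff_iff_contDiffAt]
    rintro ⟨c, y⟩
    by_cases hy : y ∈ Metric.closedBall (extChartAt I p₀ p₀) (r / 2)
    · refine hχ.contDiffAt.smul (hF.contDiffAt ?_)
      exact (isOpen_univ.prod (isOpen_extChartAt_target p₀)).mem_nhds
        ⟨trivial, hrt (Metric.closedBall_subset_closedBall (by linarith) hy)⟩
    · refine (contDiffAt_const (c := (0 : E × ℝ))).congr_of_eventuallyEq ?_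
      have : ∀ᶠ z : Euc k × E in 𝓝 (c, y), z.2 ∉ Metric.closedBall (extChartAt I p₀ p₀) (r / 2) :=
        (Metric.isClosed_closedBall.isOpen_compl.preimage continuous_snd).mem_nhds
          (show (c, y).2 ∉ _ from hy)
      filter_upwards [this] with z hz
      rw [Metric.mem_closedBall, not_le] at hz
      rw [χ.zero_of_le_dist hz.le, zero_smul]
  · have h1 : χ y = 1 := χ.one_of_mem_closedBall hy
    simp only [h1, one_smul, F]

theorem exists_bound_fderiv {G : Euc k × E → E × ℝ} (hG : ContDiff ℝ ∞ G) (R : ℝ) (y₀ : E)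
    (ρ : ℝ) : ∃ K : ℝ, 0 ≤ K ∧ ∀ c : Euc k, ‖c‖ ≤ R → ∀ y ∈ Metric.closedBall y₀ ρ,
      ‖fderiv ℝ G (c, y)‖ ≤ K := by
  have : ProperSpace E := FiniteDimensional.proper ℝ E
  obtain ⟨K, hK⟩ := ((isCompact_closedBall (0 : Euc k) R).prod
    (isCompact_closedBall y₀ ρ)).bddAbove_image
      (hG.continuous_fderiv (by simp)).norm.continuousOn
  exact ⟨max K 0, le_max_right _ _, fun c hc y hy =>
    (hK ⟨(c, y), ⟨by simpa using hc, hy⟩, rfl⟩).trans (le_max_left _ _)⟩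

theorem norm_sub_le_of_fderiv_bound {G : Euc k × E → E × ℝ} (hG : ContDiff ℝ ∞ G) {y₀ : E}
    {ρ K : ℝ} {c : Euc k} (hK : ∀ y ∈ Metric.closedBall y₀ ρ, ‖fderiv ℝ G (c, y)‖ ≤ K) {y y' : E}
    (hy : y ∈ Metric.closedBall y₀ ρ) (hy' : y' ∈ Metric.closedBall y₀ ρ) :
    ‖G (c, y) - G (c, y')‖ ≤ K * ‖y - y'‖ := by
  refine (convex_closedBall y₀ ρ).norm_image_sub_le_of_norm_hasFDerivWithin_le
    (f := fun y => G (c, y))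
    (f' := fun y => (fderiv ℝ G (c, y)).comp (ContinuousLinearMap.inr ℝ (Euc k) E)) (𝕜 := ℝ)
    (fun x _ => ?_) (fun x hx => ?_) hy' hy
  · exact ((hG.differentiable (by simp) (c, x)).hasFDerivAt.comp x
      (hasFDerivAt_prodMk_right c x)).hasFDerivWithinAt
  · refine (ContinuousLinearMap.opNorm_comp_le _ _).trans ?_
    refine (mul_le_of_le_one_right (norm_nonneg _)
      (ContinuousLinearMap.norm_inr_le_one ℝ (Euc k) E)).trans (hK x hx)

/-- A trajectory stays in a chart, and is Lipschitz there, over a short interval. -/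
theorem IsTrajOn.exists_chart_interval {X : ℝ → (p : P) → TangentSpace I p} {a b : ℝ}
    {γ : ℝ → P} (h : IsTrajOn I X a b γ) {t₀ : ℝ} (ht₀ : t₀ ∈ Icc a b) {ρ : ℝ} (hρ : 0 < ρ) :
    ∃ δ > 0, ∃ K : NNReal,
      (∀ t ∈ Icc a b, |t - t₀| < δ → γ t ∈ (extChartAt I (γ t₀)).source ∧
        extChartAt I (γ t₀) (γ t) ∈ Metric.closedBall (extChartAt I (γ t₀) (γ t₀)) ρ) ∧
      LipschitzOnWith K (fun t => extChartAt I (γ t₀) (γ t)) {t ∈ Icc a b | |t - t₀| < δ} := by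
  obtain ⟨K, s, hs, hK⟩ := h.lipschitz t₀ ht₀
  have h1 := h.continuousOn t₀ ht₀
  have h2 : ContinuousWithinAt (fun t => extChartAt I (γ t₀) (γ t)) (Icc a b) t₀ :=
    (continuousAt_extChartAt (γ t₀)).comp_continuousWithinAt h1
  have h3 := Filter.inter_mem hs (Filter.inter_mem (h1 (extChartAt_source_mem_nhds (I := I) (γ t₀)))
    (h2 (Metric.closedBall_mem_nhds _ hρ)))
  obtain ⟨δ, hδ, hsub⟩ := Metric.mem_nhdsWithin_iff.1 h3
  have h4 : ∀ t ∈ Icc a b, |t - t₀| < δ → t ∈ Metric.ball t₀ δ ∩ Icc a b := fun t ht htδ =>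
    ⟨by rwa [Metric.mem_ball, Real.dist_eq], ht⟩
  exact ⟨δ, hδ, K, fun t ht htδ => (hsub (h4 t ht htδ)).2,
    hK.mono fun t ht => (hsub (h4 t ht.1 ht.2)).1⟩

/-- The integral equation of a trajectory in a chart. -/
theorem IsTrajOn.chart_eq_primitive {G : Euc k × E → E × ℝ} {p₀ : P} {ρ : ℝ}
    (hG : ∀ c, ∀ y ∈ Metric.closedBall (extChartAt I p₀ p₀) ρ,
        G (c, y) = (chartField I Y p₀ (c, y), L c ((extChartAt I p₀).symm y)))
    {c : ℝ → Euc k} {a b : ℝ} {γ : ℝ → P} (h : IsTrajOn I (fun t => Y (c t)) a b γ) (hab : a ≤ b)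
    (hmem : ∀ t ∈ Icc a b, γ t ∈ (extChartAt I p₀).source ∧
      extChartAt I p₀ (γ t) ∈ Metric.closedBall (extChartAt I p₀ p₀) ρ) {K : NNReal}
    (hK : LipschitzOnWith K (fun t => extChartAt I p₀ (γ t)) (Icc a b)) :
    IntervalIntegrable (fun t => (G (c t, extChartAt I p₀ (γ t))).1) volume a b ∧
    ∀ t ∈ Icc a b, extChartAt I p₀ (γ t) = extChartAt I p₀ (γ a) +
      ∫ s in a..t, (G (c s, extChartAt I p₀ (γ s))).1 := by
  refine hK.eq_primitive ?_ hab
  filter_upwards [h.ae_hasDerivAt_chart p₀, ae_restrict_mem measurableSet_Icc] with t ht htm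
  obtain ⟨h1, h2⟩ := hmem t htm
  refine (ht h1).congr_deriv ?_
  rw [hG _ _ h2, chartField_apply h1]

theorem MemLp.exists_ae_bound {c : ℝ → Euc k} {a b : ℝ} (hc : MemLp c ⊤ (resMeas a b)) :
    ∃ R : ℝ, ∀ᵐ t ∂(resMeas a b), ‖c t‖ ≤ R := by
  refine ⟨‖hc.toLp c‖, ?_⟩
  filter_upwards [Lp.ae_norm_le_norm_top (hc.toLp c), hc.coeFn_toLp] with t h1 h2
  rwa [h2] at h1

theorem ae_resMeas_mono {a b a' b' : ℝ} (h : Icc a' b' ⊆ Icc a b) {p : ℝ → Prop}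
    (hp : ∀ᵐ t ∂(resMeas a b), p t) : ∀ᵐ t ∂(resMeas a' b'), p t :=
  ae_restrict_of_ae_restrict_of_subset h hp

theorem MemLp.resMeas_mono {a b a' b' : ℝ} (h : Icc a' b' ⊆ Icc a b) {c : ℝ → Euc k}
    (hc : MemLp c ⊤ (resMeas a b)) : MemLp c ⊤ (resMeas a' b') :=
  hc.mono_measure (Measure.restrict_mono h le_rfl)

theorem IsTrajOn.eventually_eq_right (hS : SmoothSystem I Y L) {c : ℝ → Euc k} {a b : ℝ}
    (hc : MemLp c ⊤ (resMeas a b)) {γ η : ℝ → P} (hγ : IsTrajOn I (fun t => Y (c t)) a b γ)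
    (hη : IsTrajOn I (fun t => Y (c t)) a b η) {t₀ : ℝ} (ht₀ : t₀ ∈ Ico a b)
    (h : γ t₀ = η t₀) : ∀ᶠ t in 𝓝[>] t₀, γ t = η t := by
  obtain ⟨G, hG, ρ, hρ, hρt, hGeq⟩ := hS.exists_cutoff (γ t₀)
  obtain ⟨R, hR⟩ := MemLp.exists_ae_bound hc
  obtain ⟨K, hK0, hK⟩ := exists_bound_fderiv hG R (extChartAt I (γ t₀) (γ t₀)) ρ
  obtain ⟨δ₁, hδ₁, K₁, hm₁, hL₁⟩ := hγ.exists_chart_interval (Ico_subset_Icc_self ht₀) hρ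
  obtain ⟨δ₂, hδ₂, K₂, hm₂, hL₂⟩ := hη.exists_chart_interval (Ico_subset_Icc_self ht₀) hρ
  rw [← h] at hm₂ hL₂
  set δ := min (min (δ₁ / 2) (δ₂ / 2)) (min (b - t₀) (1 / (2 * (K + 1)))) with hδ
  have hδ0 : 0 < δ := by
    have := ht₀.2
    refine lt_min (lt_min (by linarith) (by linarith)) (lt_min (by linarith) (by positivity))
  have hd1 : δ ≤ δ₁ / 2 := (min_le_left _ _).trans (min_le_left _ _)
  have hd2 : δ ≤ δ₂ / 2 := (min_le_left _ _).trans (min_le_right _ _)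
  have hd3 : δ ≤ b - t₀ := (min_le_right _ _).trans (min_le_left _ _)
  have hd4 : δ ≤ 1 / (2 * (K + 1)) := (min_le_right _ _).trans (min_le_right _ _)
  have hsub : Icc t₀ (t₀ + δ) ⊆ Icc a b := Icc_subset_Icc ht₀.1 (by linarith)
  have hs1 : ∀ t ∈ Icc t₀ (t₀ + δ), |t - t₀| < δ₁ := fun t ht => by
    rw [abs_of_nonneg (by linarith [ht.1])]; linarith [ht.2]
  have hs2 : ∀ t ∈ Icc t₀ (t₀ + δ), |t - t₀| < δ₂ := fun t ht => by
    rw [abs_of_nonneg (by linarith [ht.1])]; linarith [ht.2]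
  have hle : t₀ ≤ t₀ + δ := by linarith
  have hL₁' : LipschitzOnWith K₁ (fun t => extChartAt I (γ t₀) (γ t)) (Icc t₀ (t₀ + δ)) :=
    hL₁.mono fun t ht => ⟨hsub ht, hs1 t ht⟩
  have hL₂' : LipschitzOnWith K₂ (fun t => extChartAt I (γ t₀) (η t)) (Icc t₀ (t₀ + δ)) :=
    hL₂.mono fun t ht => ⟨hsub ht, hs2 t ht⟩
  have hm₁' := fun t (ht : t ∈ Icc t₀ (t₀ + δ)) => hm₁ t (hsub ht) (hs1 t ht)
  have hm₂' := fun t (ht : t ∈ Icc t₀ (t₀ + δ)) => hm₂ t (hsub ht) (hs2 t ht)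
  obtain ⟨i1, e1⟩ := (hγ.mono hsub).chart_eq_primitive hGeq hle hm₁' hL₁'
  obtain ⟨i2, e2⟩ := (hη.mono hsub).chart_eq_primitive hGeq hle hm₂' hL₂'
  rw [← h] at e2
  have heq := eqOn_of_primitive hL₁'.continuousOn hL₂'.continuousOn i1 i2 _ e1 e2 hK0 (by
    filter_upwards [ae_resMeas_mono hsub hR, ae_restrict_mem measurableSet_Icc] with t ht htm
    rw [← Prod.fst_sub]
    exact (norm_fst_le _).trans (norm_sub_le_of_fderiv_bound hG (hK _ ht) (hm₁' t htm).2
      (hm₂' t htm).2)) hle (by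
    have h1 : K * δ ≤ K * (1 / (2 * (K + 1))) := mul_le_mul_of_nonneg_left hd4 hK0
    have h2 : K * (1 / (2 * (K + 1))) < 1 := by
      rw [mul_one_div, div_lt_one (by positivity)]; linarith
    rw [add_sub_cancel_left]; linarith)
  filter_upwards [Ioc_mem_nhdsGT (show t₀ < t₀ + δ by linarith)] with t ht
  have ht' : t ∈ Icc t₀ (t₀ + δ) := Ioc_subset_Icc_self ht
  exact (extChartAt I (γ t₀)).injOn (hm₁' t ht').1 (hm₂' t ht').1 (heq ht')

/-- Trajectories of a smooth control system are unique. -/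
theorem IsTrajOn.eqOn [T2Space P] (hS : SmoothSystem I Y L) {c : ℝ → Euc k} {a b : ℝ}
    (hc : MemLp c ⊤ (resMeas a b)) {γ η : ℝ → P} (hγ : IsTrajOn I (fun t => Y (c t)) a b γ)
    (hη : IsTrajOn I (fun t => Y (c t)) a b η) (h : γ a = η a) : EqOn γ η (Icc a b) := by
  have hcl : IsClosed ({t | γ t = η t} ∩ Icc a b) := by
    have h1 : ContinuousOn (fun t => (γ t, η t)) (Icc a b) :=
      hγ.continuousOn.prodMk hη.continuousOn
    have h2 := h1.preimage_isClosed_of_isClosed isClosed_Icc isClosed_diagonal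
    convert h2 using 1
    ext t
    simp [and_comm]
  exact hcl.Icc_subset_of_forall_mem_nhdsWithin h fun t ht =>
    IsTrajOn.eventually_eq_right hS hc hγ hη ht.2 ht.1

end ControlSystems

/-! ### Flows of control systems over short intervals -/

section ChartFlow

variable {k : ℕ} {E : Type} {H P : Type*} [NormedAddCommGroup E] [NormedSpace ℝ E]
  [FiniteDimensional ℝ E] [ProperSpace E] {a b : ℝ} {G : Euc k × E → E × ℝ}

/-- `c` is the perturbation `u + (1 - ϑ) v` of `u` on `[a, b]`, where `ϑ` has values in `{0, 1}`. -/
def IsPerturbation (u : ℝ → Euc k) (v : Perturb k) (a b : ℝ) (c : ℝ → Euc k) : Prop :=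
  ∀ᵐ t ∂(resMeas a b), (v.1 t = 0 ∨ v.1 t = 1) ∧ c t = u t + (1 - v.1 t) • v.2 t

/-- The right hand side along a family `ψ` of solutions. -/
def flowRhs (hG : ContDiff ℝ ∞ G) (u : Lp (Euc k) ⊤ (resMeas a b))
    (ψ : E × Perturb k → Lp E ⊤ (resMeas a b)) (z : E × Perturb k) : Lp (E × ℝ) 1 (resMeas a b) :=
  rhsLp hG u (restrictPerturb k a b z.2, ψ z)

/-- The end point and the value of the functional along a family `ψ` of solutions. -/
def flowEnd (hG : ContDiff ℝ ∞ G) (u : Lp (Euc k) ⊤ (resMeas a b))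
    (ψ : E × Perturb k → Lp E ⊤ (resMeas a b)) (z : E × Perturb k) : E × ℝ :=
  (z.1, 0) + L1.integralCLM (flowRhs hG u ψ z)

/-- The family `ψ` of solutions as a family of continuous curves. -/
def flowCurve (hG : ContDiff ℝ ∞ G) (u : Lp (Euc k) ⊤ (resMeas a b))
    (ψ : E × Perturb k → Lp E ⊤ (resMeas a b)) (z : E × Perturb k) (t : ℝ) : E :=
  z.1 + ∫ s in a..t, (flowRhs hG u ψ z s).1

variable {hG : ContDiff ℝ ∞ G} {u : Lp (Euc k) ⊤ (resMeas a b)}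
  {ψ : E × Perturb k → Lp E ⊤ (resMeas a b)} {z₀ : E × Perturb k}

theorem contDiffAt_flowRhs (hψ : ContDiffAt ℝ ∞ ψ z₀) :
    ContDiffAt ℝ ∞ (flowRhs hG u ψ) z₀ := by
  have h1 : ContDiffAt ℝ ∞ (fun z : E × Perturb k => restrictPerturb k a b z.2) z₀ :=
    ((restrictPerturb k a b).contDiff.comp contDiff_snd).contDiffAt
  exact (contDiff_rhsLp hG u).contDiffAt.comp z₀ (h1.prodMk hψ)

theorem contDiffAt_flowEnd (hψ : ContDiffAt ℝ ∞ ψ z₀) :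
    ContDiffAt ℝ ∞ (flowEnd hG u ψ) z₀ := by
  have h1 : ContDiffAt ℝ ∞ (fun z : E × Perturb k => ((z.1, 0) : E × ℝ)) z₀ :=
    (contDiff_fst.prodMk contDiff_const).contDiffAt
  have h2 : ContDiffAt ℝ ∞ (fun z => L1.integralCLM (flowRhs hG u ψ z)) z₀ :=
    (L1.integralCLM (E := E × ℝ) (μ := resMeas a b)).contDiff.contDiffAt.comp z₀
      (contDiffAt_flowRhs hψ)
  exact h1.add h2

theorem integrable_flowRhs (z : E × Perturb k) :
    Integrable (fun s => flowRhs hG u ψ z s) (resMeas a b) := L1.integrable_coeFn _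

theorem intervalIntegrable_flowRhs (hab : a ≤ b) (z : E × Perturb k) :
    IntervalIntegrable (fun s => flowRhs hG u ψ z s) volume a b := by
  rw [intervalIntegrable_iff_integrableOn_Icc_of_le hab]
  exact integrable_flowRhs z

theorem integralCLM_eq_intervalIntegral (hab : a ≤ b) (f : Lp (E × ℝ) 1 (resMeas a b)) :
    L1.integralCLM f = (∫ s in a..b, (f s).1, ∫ s in a..b, (f s).2) := by
  have h0 := L1.integrable_coeFn f
  rw [← L1.integral_eq, L1.integral_eq_integral, intervalIntegral.integral_of_le hab,
    intervalIntegral.integral_of_le hab, ← integral_Icc_eq_integral_Ioc,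
    ← integral_Icc_eq_integral_Ioc]
  exact integral_pair h0.fst h0.snd

theorem flowEnd_eq (hab : a ≤ b) (z : E × Perturb k) :
    flowEnd hG u ψ z = (flowCurve hG u ψ z b, ∫ s in a..b, (flowRhs hG u ψ z s).2) := by
  rw [flowEnd, integralCLM_eq_intervalIntegral hab, Prod.mk_add_mk, zero_add]
  rfl

theorem coeFn_eq_flowCurve {z : E × Perturb k} (hz : ψ z = Lp.const ⊤ _ z.1 +
    stateOp E a b (flowRhs hG u ψ z)) :
    ψ z =ᵐ[resMeas a b] flowCurve hG u ψ z := by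
  rw [hz]
  filter_upwards [Lp.coeFn_add (Lp.const ⊤ (resMeas a b) z.1) (stateOp E a b (flowRhs hG u ψ z)),
    coeFn_stateOp (flowRhs hG u ψ z), Lp.coeFn_const ⊤ (resMeas a b) z.1] with t h1 h2 h3
  rw [h1, Pi.add_apply, h2, h3]
  rfl

theorem tendsto_flowCurve (hψ : ContDiffAt ℝ ∞ ψ z₀) {ε : ℝ} (hε : 0 < ε) :
    ∀ᶠ z in 𝓝 z₀, ∀ t ∈ Icc a b, ‖flowCurve hG u ψ z t - flowCurve hG u ψ z₀ t‖ < ε := by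
  have h1 : ContinuousAt (fun z => ‖z.1 - z₀.1‖ + ‖flowRhs hG u ψ z - flowRhs hG u ψ z₀‖) z₀ :=
    ((continuousAt_fst.sub continuousAt_const).norm).add
      (((contDiffAt_flowRhs hψ).continuousAt.sub continuousAt_const).norm)
  have h2 : ∀ᶠ z in 𝓝 z₀, ‖z.1 - z₀.1‖ + ‖flowRhs hG u ψ z - flowRhs hG u ψ z₀‖ < ε := by
    refine h1.eventually (gt_mem_nhds ?_)
    simpa using hε
  filter_upwards [h2] with z hz t ht
  refine lt_of_le_of_lt ?_ hz
  have hi : ∀ z, IntervalIntegrable (fun s => (flowRhs hG u ψ z s).1) volume a t := fun z => by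
    rw [intervalIntegrable_iff_integrableOn_Icc_of_le ht.1]
    exact (integrable_flowRhs z).fst.mono_measure
      (Measure.restrict_mono (Icc_subset_Icc_right ht.2) le_rfl)
  rw [flowCurve, flowCurve, add_sub_add_comm, ← intervalIntegral.integral_sub (hi z) (hi z₀)]
  refine (norm_add_le _ _).trans (add_le_add le_rfl ?_)
  rw [intervalIntegral.integral_of_le ht.1, L1.norm_eq_integral_norm]
  refine (norm_integral_le_integral_norm _).trans ?_
  have h3 : ∀ᵐ s ∂(resMeas a b), ‖(flowRhs hG u ψ z s).1 - (flowRhs hG u ψ z₀ s).1‖ ≤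
      ‖(flowRhs hG u ψ z - flowRhs hG u ψ z₀ : Lp (E × ℝ) 1 (resMeas a b)) s‖ := by
    filter_upwards [Lp.coeFn_sub (flowRhs hG u ψ z) (flowRhs hG u ψ z₀)] with s hs
    rw [hs]
    exact norm_fst_le (flowRhs hG u ψ z s - flowRhs hG u ψ z₀ s)
  have hsub : Ioc a t ⊆ Icc a b := Ioc_subset_Icc_self.trans (Icc_subset_Icc_right ht.2)
  have h5 : Integrable (fun s => ‖(flowRhs hG u ψ z s).1 - (flowRhs hG u ψ z₀ s).1‖)
      (resMeas a b) := ((integrable_flowRhs z).fst.sub (integrable_flowRhs z₀).fst).norm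
  calc ∫ s in Ioc a t, ‖(flowRhs hG u ψ z s).1 - (flowRhs hG u ψ z₀ s).1‖
      ≤ ∫ s in Icc a b, ‖(flowRhs hG u ψ z s).1 - (flowRhs hG u ψ z₀ s).1‖ :=
        setIntegral_mono_set h5 (.of_forall fun _ => norm_nonneg _) hsub.eventuallyLE
    _ ≤ _ := integral_mono_ae h5 (L1.integrable_coeFn _).norm h3

variable [TopologicalSpace H] [TopologicalSpace P] [ChartedSpace H P]
  {I : ModelWithCorners ℝ E H} [I.Boundaryless] [IsManifold I ∞ P]
  {Y : Euc k → (p : P) → TangentSpace I p} {L : Euc k → P → ℝ}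

/-- The solutions in a chart are trajectories of the perturbed controls. -/
theorem isTrajOn_flowCurve {p₀ : P} {ρ : ℝ} {u₀ : ℝ → Euc k} {z : E × Perturb k}
    (hρ : Metric.closedBall (extChartAt I p₀ p₀) ρ ⊆ (extChartAt I p₀).target)
    (hGeq : ∀ c, ∀ y ∈ Metric.closedBall (extChartAt I p₀ p₀) ρ,
        G (c, y) = (chartField I Y p₀ (c, y), L c ((extChartAt I p₀).symm y)))
    (hab : a ≤ b) (hu : u =ᵐ[resMeas a b] u₀)
    (hz : ψ z = Lp.const ⊤ _ z.1 + stateOp E a b (flowRhs hG u ψ z))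
    (hmem : ∀ t ∈ Icc a b,
      flowCurve hG u ψ z t ∈ Metric.closedBall (extChartAt I p₀ p₀) ρ)
    {c : ℝ → Euc k} (hc : IsPerturbation u₀ z.2 a b c) :
    IsTrajOn I (fun t => Y (c t)) a b
      (fun t => (extChartAt I p₀).symm (flowCurve hG u ψ z t)) ∧
    IntervalIntegrable (fun t => L (c t) ((extChartAt I p₀).symm (flowCurve hG u ψ z t)))
      volume a b ∧
    ((extChartAt I p₀).symm (flowCurve hG u ψ z b),
      ∫ t in a..b, L (c t) ((extChartAt I p₀).symm (flowCurve hG u ψ z t))) =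
      ((extChartAt I p₀).symm (flowEnd hG u ψ z).1, (flowEnd hG u ψ z).2) := by
  have hN : ∀ᵐ t ∂(resMeas a b), flowRhs hG u ψ z t = G (c t, flowCurve hG u ψ z t) := by
    filter_upwards [coeFn_rhsLp hG u (restrictPerturb k a b z.2, ψ z), hc, hu,
      coeFn_eq_flowCurve hz, LpToLpRestrictCLM_coeFn ℝ (Icc a b) z.2.1,
      LpToLpRestrictCLM_coeFn ℝ (Icc a b) z.2.2] with t h1 h2 h3 h4 h5 h6
    have e5 : (restrictPerturb k a b z.2).1 t = z.2.1 t := h5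
    have e6 : (restrictPerturb k a b z.2).2 t = z.2.2 t := h6
    rw [flowRhs, h1]
    simp only [e5, e6, h3, h4]
    rcases h2.1 with h | h
    · rw [h2.2, h]; simp
    · rw [h2.2, h]; simp
  have hcL : MemLp c ⊤ (resMeas a b) := by
    have h0 : MemLp (fun t => u t + z.2.2 t) ⊤ (resMeas a b) :=
      (Lp.memLp u).add ((Lp.memLp z.2.2).mono_measure Measure.restrict_le_self)
    have h1 : AEStronglyMeasurable c (resMeas a b) := by
      have h2 : AEStronglyMeasurable (fun t => u t + (1 - z.2.1 t) • z.2.2 t) (resMeas a b) :=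
        (Lp.aestronglyMeasurable u).add (((aestronglyMeasurable_const).sub
          ((Lp.aestronglyMeasurable z.2.1).mono_measure Measure.restrict_le_self)).smul
          ((Lp.aestronglyMeasurable z.2.2).mono_measure Measure.restrict_le_self))
      refine h2.congr ?_
      filter_upwards [hc, hu] with t h3 h4
      rw [h3.2, h4]
    have hb : ∀ᵐ t ∂(resMeas a b), ‖c t‖ ≤ ‖u‖ + ‖z.2.2‖ := by
      filter_upwards [hc, hu, Lp.ae_norm_le_norm_top u,
        ae_restrict_of_ae (Lp.ae_norm_le_norm_top z.2.2)] with t h3 h4 h5 h6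
      rw [h3.2, ← h4]
      refine (norm_add_le _ _).trans (add_le_add h5 ?_)
      rcases h3.1 with h | h <;> rw [h] <;> simp [h6]
    exact memLp_top_of_bound h1 _ hb
  obtain ⟨R, hR⟩ := MemLp.exists_ae_bound hcL
  obtain ⟨C, hC⟩ := ((isCompact_closedBall (0 : Euc k) R).prod
    (isCompact_closedBall (extChartAt I p₀ p₀) ρ)).bddAbove_image hG.continuous.norm.continuousOn
  have hbound : ∀ᵐ t ∂(resMeas a b), ‖(flowRhs hG u ψ z t).1‖ ≤ max C 0 := by
    filter_upwards [hN, hR, ae_restrict_mem measurableSet_Icc] with t h1 h2 h3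
    rw [h1]
    exact ((norm_fst_le _).trans (hC ⟨(c t, flowCurve hG u ψ z t),
      ⟨by simpa using h2, hmem t h3⟩, rfl⟩)).trans (le_max_left _ _)
  have hi := intervalIntegrable_flowRhs (hG := hG) (u := u) (ψ := ψ) hab z
  have hi1 : IntervalIntegrable (fun s => (flowRhs hG u ψ z s).1) volume a b := by
    rw [intervalIntegrable_iff_integrableOn_Icc_of_le hab]
    exact (integrable_flowRhs z).fst
  have hi2 : IntervalIntegrable (fun s => (flowRhs hG u ψ z s).2) volume a b := by
    rw [intervalIntegrable_iff_integrableOn_Icc_of_le hab]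
    exact (integrable_flowRhs z).snd
  have hN2 : (fun s => (flowRhs hG u ψ z s).2) =ᵐ[resMeas a b]
      fun t => L (c t) ((extChartAt I p₀).symm (flowCurve hG u ψ z t)) := by
    filter_upwards [hN, ae_restrict_mem measurableSet_Icc] with t h2 h3
    rw [h2, hGeq _ _ (hmem t h3)]
  refine ⟨isTrajOn_of_chart (lipschitz_primitive (le_max_right _ _) hi1 hbound z.1)
    (fun t ht => hρ (hmem t ht)) ?_, ?_, ?_⟩
  · filter_upwards [hasDerivAt_primitive hab hi1 z.1, hN, ae_restrict_mem measurableSet_Icc]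
      with t h1 h2 h3
    refine h1.congr_deriv ?_
    rw [h2, hGeq _ _ (hmem t h3)]
    rfl
  · rw [intervalIntegrable_iff_integrableOn_Icc_of_le hab] at hi2 ⊢
    exact hi2.congr hN2
  · rw [flowEnd_eq hab]
    congr 1
    rw [intervalIntegral.integral_of_le hab, intervalIntegral.integral_of_le hab,
      ← integral_Icc_eq_integral_Ioc, ← integral_Icc_eq_integral_Ioc]
    exact integral_congr_ae hN2.symm

/-- Smooth families of solutions near a trajectory over a short interval. -/
theorem IsTrajOn.exists_chart_flow (hS : SmoothSystem I Y L) {u : ℝ → Euc k} {A B : ℝ}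
    (hu : MemLp u ⊤ (resMeas A B)) {γ : ℝ → P} (hγ : IsTrajOn I (fun t => Y (u t)) A B γ)
    {t₀ : ℝ} (ht₀ : t₀ ∈ Icc A B) :
    ∃ (G : Euc k × E → E × ℝ) (hG : ContDiff ℝ ∞ G) (ρ : ℝ), 0 < ρ ∧
      Metric.closedBall (extChartAt I (γ t₀) (γ t₀)) ρ ⊆ (extChartAt I (γ t₀)).target ∧
      (∀ c, ∀ y ∈ Metric.closedBall (extChartAt I (γ t₀) (γ t₀)) ρ,
        G (c, y) = (chartField I Y (γ t₀) (c, y), L c ((extChartAt I (γ t₀)).symm y))) ∧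
      ∃ δ > 0, ∀ a b, a ≤ b → Icc a b ⊆ Icc A B → |a - t₀| < δ → |b - t₀| < δ →
        (∀ t ∈ Icc a b, γ t ∈ (extChartAt I (γ t₀)).source) ∧
        ∃ (uL : Lp (Euc k) ⊤ (resMeas a b)) (ψ : E × Perturb k → Lp E ⊤ (resMeas a b)),
          uL =ᵐ[resMeas a b] u ∧ ContDiffAt ℝ ∞ ψ (extChartAt I (γ t₀) (γ a), 0) ∧
          (∀ t ∈ Icc a b, flowCurve hG uL ψ (extChartAt I (γ t₀) (γ a), 0) t =
            extChartAt I (γ t₀) (γ t)) ∧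
          ∀ᶠ z in 𝓝 (extChartAt I (γ t₀) (γ a), 0),
            ψ z = Lp.const ⊤ _ z.1 + stateOp E a b (flowRhs hG uL ψ z) ∧
            ∀ t ∈ Icc a b, flowCurve hG uL ψ z t ∈
              Metric.ball (extChartAt I (γ t₀) (γ t₀)) ρ := by
  obtain ⟨G, hG, ρ, hρ, hρt, hGeq⟩ := hS.exists_cutoff (γ t₀)
  refine ⟨G, hG, ρ, hρ, hρt, hGeq, ?_⟩
  obtain ⟨R, hR⟩ := MemLp.exists_ae_bound hu
  obtain ⟨K, hK0, hK⟩ := exists_bound_fderiv hG R (extChartAt I (γ t₀) (γ t₀)) ρ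
  obtain ⟨δ₁, hδ₁, K₁, hm₁, hL₁⟩ := hγ.exists_chart_interval ht₀ (half_pos hρ)
  refine ⟨min δ₁ (1 / (2 * (K + 1))), lt_min hδ₁ (by positivity), fun a b hab hsub ha hb => ?_⟩
  have hin : ∀ t ∈ Icc a b, |t - t₀| < min δ₁ (1 / (2 * (K + 1))) := fun t ht => by
    rw [abs_lt] at ha hb ⊢
    exact ⟨by linarith [ht.1], by linarith [ht.2]⟩
  have hin₁ : ∀ t ∈ Icc a b, |t - t₀| < δ₁ := fun t ht => (hin t ht).trans_le (min_le_left _ _)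
  have hm := fun t (ht : t ∈ Icc a b) => hm₁ t (hsub ht) (hin₁ t ht)
  have hmρ : ∀ t ∈ Icc a b, γ t ∈ (extChartAt I (γ t₀)).source ∧
      extChartAt I (γ t₀) (γ t) ∈ Metric.closedBall (extChartAt I (γ t₀) (γ t₀)) ρ := fun t ht =>
    ⟨(hm t ht).1, Metric.closedBall_subset_closedBall (by linarith) (hm t ht).2⟩
  have hL' : LipschitzOnWith K₁ (fun t => extChartAt I (γ t₀) (γ t)) (Icc a b) :=
    hL₁.mono fun t ht => ⟨hsub ht, hin₁ t ht⟩
  obtain ⟨i1, e1⟩ := (hγ.mono hsub).chart_eq_primitive hGeq hab hmρ hL'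
  have huab := MemLp.resMeas_mono hsub hu
  have hxmem : MemLp (fun t => extChartAt I (γ t₀) (γ t)) ⊤ (resMeas a b) := by
    refine memLp_top_of_bound (hL'.continuousOn.aestronglyMeasurable measurableSet_Icc)
      (‖extChartAt I (γ t₀) (γ t₀)‖ + ρ) ?_
    filter_upwards [ae_restrict_mem measurableSet_Icc] with t ht
    have := (hmρ t ht).2
    rw [mem_closedBall_iff_norm] at this
    linarith [norm_le_norm_add_norm_sub' (extChartAt I (γ t₀) (γ t))
      (extChartAt I (γ t₀) (γ t₀))]
  set uL := huab.toLp u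
  set xL := hxmem.toLp (fun t => extChartAt I (γ t₀) (γ t))
  have hrhs : ∀ᵐ t ∂(resMeas a b), (rhsLp hG uL (0, xL) : Lp (E × ℝ) 1 (resMeas a b)) t =
      G (u t, extChartAt I (γ t₀) (γ t)) := by
    filter_upwards [coeFn_rhsLp hG uL (0, xL), huab.coeFn_toLp, hxmem.coeFn_toLp,
      Lp.coeFn_zero (Euc k) ⊤ (resMeas a b), Lp.coeFn_zero ℝ 1 (resMeas a b)] with t h1 h2 h3 h4 h5
    have e4 : ((0 : Lp ℝ 1 (resMeas a b) × Lp (Euc k) ⊤ (resMeas a b)).2 : ℝ → Euc k) t = 0 := h4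
    rw [h1, h2, h3, e4]
    simp
  have hprim : ∀ t ∈ Icc a b, ∫ s in a..t, ((rhsLp hG uL (0, xL) : Lp (E × ℝ) 1 (resMeas a b)) s).1
      = ∫ s in a..t, (G (u s, extChartAt I (γ t₀) (γ s))).1 := fun t ht => by
    refine intervalIntegral.integral_congr_ae ?_
    filter_upwards [(ae_restrict_iff' measurableSet_Icc).1 hrhs] with s hs hs'
    rw [uIoc_of_le ht.1] at hs'
    rw [hs ⟨hs'.1.le, hs'.2.trans ht.2⟩]
  obtain ⟨ψ, hψ, hψ0, hψe⟩ := exists_shortTime_solution hab hG uL (extChartAt I (γ t₀) (γ a)) xL (by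
    refine Lp.ext ?_
    filter_upwards [Lp.coeFn_add (Lp.const ⊤ (resMeas a b) (extChartAt I (γ t₀) (γ a)))
      (stateOp E a b (rhsLp hG uL (0, xL))), coeFn_stateOp (rhsLp hG uL (0, xL)),
      Lp.coeFn_const ⊤ (resMeas a b) (extChartAt I (γ t₀) (γ a)), hxmem.coeFn_toLp,
      ae_restrict_mem measurableSet_Icc] with t h1 h2 h3 h4 h5
    rw [h1, Pi.add_apply, h2, h3, h4, hprim t h5]
    exact e1 t h5) K hK0 (by
    filter_upwards [huab.coeFn_toLp, hxmem.coeFn_toLp, ae_resMeas_mono hsub hR,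
      ae_restrict_mem measurableSet_Icc] with t h1 h2 h3 h4 h
    rw [h1, h2]
    refine (norm_fst_le _).trans ((ContinuousLinearMap.le_opNorm _ _).trans ?_)
    refine mul_le_mul (hK _ h3 _ (hmρ t h4).2) ?_ (norm_nonneg _) hK0
    simp [Prod.norm_def]) (by
    have h1 := (abs_lt.1 (hin a (left_mem_Icc.2 hab))).1
    have h2 := (abs_lt.1 (hin b (right_mem_Icc.2 hab))).2
    have h3 : b - a < 1 / (K + 1) := by
      have h4 := min_le_right δ₁ (1 / (2 * (K + 1)))
      have h5 : 1 / (K + 1) = 1 / (2 * (K + 1)) + 1 / (2 * (K + 1)) := by field_simp; norm_num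
      linarith
    have h4 : K * (b - a) ≤ K * (1 / (K + 1)) := mul_le_mul_of_nonneg_left h3.le hK0
    have h5 : K * (1 / (K + 1)) < 1 := by
      rw [mul_one_div, div_lt_one (by positivity)]; linarith
    linarith)
  have hcurve : ∀ t ∈ Icc a b, flowCurve hG uL ψ (extChartAt I (γ t₀) (γ a), 0) t =
      extChartAt I (γ t₀) (γ t) := fun t ht => by
    rw [flowCurve, flowRhs, hψ0, map_zero, hprim t ht]
    exact (e1 t ht).symm
  refine ⟨fun t ht => (hm t ht).1, uL, ψ, huab.coeFn_toLp, hψ, hcurve, ?_⟩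
  filter_upwards [hψe, tendsto_flowCurve (hG := hG) (u := uL) hψ (half_pos hρ)] with z h1 h2
  refine ⟨h1, fun t ht => ?_⟩
  have h3 := h2 t ht
  rw [hcurve t ht] at h3
  have h4 := (hm t ht).2
  rw [Metric.mem_ball]
  rw [Metric.mem_closedBall] at h4
  rw [← dist_eq_norm] at h3
  linarith [dist_triangle (flowCurve hG uL ψ z t) (extChartAt I (γ t₀) (γ t))
    (extChartAt I (γ t₀) (γ t₀))]

end ChartFlow

/-! ### Flows of control systems along a trajectory -/

/-- A transitive relation between times that holds locally holds globally. -/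
theorem interval_chain {R : ℝ → ℝ → Prop} {A B : ℝ} (hAB : A ≤ B)
    (htrans : ∀ a b c, A ≤ a → a ≤ b → b ≤ c → c ≤ B → R a b → R b c → R a c)
    (hloc : ∀ t₀ ∈ Icc A B, ∃ δ > 0, ∀ a b, a ≤ b → Icc a b ⊆ Icc A B → |a - t₀| < δ →
      |b - t₀| < δ → R a b) : R A B := by
  choose! δ hδ hR using hloc
  obtain ⟨t, ht0, hmono, ⟨m, hm⟩, hcov⟩ := exists_monotone_Icc_subset_open_cover_Icc hAB
    (c := fun i : Icc A B => {s : Icc A B | |(s : ℝ) - i| < δ i})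
    (fun i => isOpen_lt ((continuous_subtype_val.sub continuous_const).abs) continuous_const)
    (fun s _ => mem_iUnion.2 ⟨s, by simpa using hδ s s.2⟩)
  have key : ∀ n, R A (t (n + 1)) := by
    have step : ∀ n, R (t n) (t (n + 1)) := fun n => by
      obtain ⟨i, hi⟩ := hcov n
      have hle : t n ≤ t (n + 1) := hmono n.le_succ
      exact hR i i.2 _ _ hle (Icc_subset_Icc (t n).2.1 (t (n + 1)).2.2)
        (hi (left_mem_Icc.2 hle)) (hi (right_mem_Icc.2 hle))
    intro n
    induction n with
    | zero => simpa [ht0] using step 0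
    | succ n ih =>
      exact htrans _ _ _ le_rfl (t (n + 1)).2.1 (hmono (n + 1).le_succ) (t (n + 2)).2.2 ih
        (step (n + 1))
  have := key m
  rwa [hm (m + 1) (Nat.le_succ m)] at this

section Flows

variable {k : ℕ} {E : Type} {H P : Type*} [NormedAddCommGroup E] [NormedSpace ℝ E]
  [FiniteDimensional ℝ E] [TopologicalSpace H] [TopologicalSpace P] [ChartedSpace H P]

/-- `Ψ` is the flow from time `a` to time `b`, together with the value of the functional, near the
trajectory `γ` of the control `u`, as a smooth function of the initial point and of the perturbation
of the control. -/
structure IsFlow (I : ModelWithCorners ℝ E H) (Y : Euc k → (p : P) → TangentSpace I p)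
    (L : Euc k → P → ℝ) (u : ℝ → Euc k) (γ : ℝ → P) (a b : ℝ)
    (Ψ : P × Perturb k → P × ℝ) : Prop where
  smooth : ContMDiffAt (I.prod 𝓘(ℝ, Perturb k)) (I.prod 𝓘(ℝ, ℝ)) ∞ Ψ (γ a, 0)
  apply_self : (Ψ (γ a, 0)).1 = γ b
  traj : ∀ᶠ z in 𝓝 (γ a, 0), ∀ c, IsPerturbation u z.2 a b c → ∃ η : ℝ → P,
    IsTrajOn I (fun t => Y (c t)) a b η ∧ η a = z.1 ∧ η b = (Ψ z).1 ∧
    IntervalIntegrable (fun t => L (c t) (η t)) volume a b ∧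
    ∫ t in a..b, L (c t) (η t) = (Ψ z).2

variable {I : ModelWithCorners ℝ E H} [I.Boundaryless] [IsManifold I ∞ P]
  {Y : Euc k → (p : P) → TangentSpace I p} {L : Euc k → P → ℝ}

theorem IsPerturbation.mono {u : ℝ → Euc k} {v : Perturb k} {a b a' b' : ℝ} {c : ℝ → Euc k}
    (h : IsPerturbation u v a b c) (hab : Icc a' b' ⊆ Icc a b) : IsPerturbation u v a' b' c :=
  ae_resMeas_mono hab h

/-- The flow read from a chart. -/
theorem IsFlow.of_chart [ProperSpace E] {G : Euc k × E → E × ℝ} {hG : ContDiff ℝ ∞ G}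
    {u : ℝ → Euc k} {γ : ℝ → P} {p₀ : P} {ρ : ℝ}
    (hρ : Metric.closedBall (extChartAt I p₀ p₀) ρ ⊆ (extChartAt I p₀).target)
    (hGeq : ∀ c, ∀ y ∈ Metric.closedBall (extChartAt I p₀ p₀) ρ,
        G (c, y) = (chartField I Y p₀ (c, y), L c ((extChartAt I p₀).symm y)))
    {a b : ℝ} (hab : a ≤ b) (hmem : ∀ t ∈ Icc a b, γ t ∈ (extChartAt I p₀).source)
    {uL : Lp (Euc k) ⊤ (resMeas a b)} (huL : uL =ᵐ[resMeas a b] u)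
    {ψ : E × Perturb k → Lp E ⊤ (resMeas a b)}
    (hψ : ContDiffAt ℝ ∞ ψ (extChartAt I p₀ (γ a), 0))
    (hcurve : ∀ t ∈ Icc a b, flowCurve hG uL ψ (extChartAt I p₀ (γ a), 0) t =
      extChartAt I p₀ (γ t))
    (hev : ∀ᶠ z in 𝓝 (extChartAt I p₀ (γ a), 0),
      ψ z = Lp.const ⊤ _ z.1 + stateOp E a b (flowRhs hG uL ψ z) ∧
      ∀ t ∈ Icc a b, flowCurve hG uL ψ z t ∈ Metric.ball (extChartAt I p₀ p₀) ρ) :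
    IsFlow I Y L u γ a b (fun z =>
      ((extChartAt I p₀).symm (flowEnd hG uL ψ (extChartAt I p₀ z.1, z.2)).1,
        (flowEnd hG uL ψ (extChartAt I p₀ z.1, z.2)).2)) := by
  have ha := hmem a (left_mem_Icc.2 hab)
  have hb := hmem b (right_mem_Icc.2 hab)
  have ha' := ha
  rw [extChartAt_source] at ha'
  have hend : (flowEnd hG uL ψ (extChartAt I p₀ (γ a), 0)).1 = extChartAt I p₀ (γ b) := by
    rw [flowEnd_eq hab]
    exact hcurve b (right_mem_Icc.2 hab)
  have h1 : ContMDiffAt (I.prod 𝓘(ℝ, Perturb k)) 𝓘(ℝ, E × Perturb k) ∞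
      (fun z : P × Perturb k => (extChartAt I p₀ z.1, z.2)) (γ a, 0) := by
    have h0 : ContMDiffAt (I.prod 𝓘(ℝ, Perturb k)) 𝓘(ℝ, E) ∞
        (fun z : P × Perturb k => extChartAt I p₀ z.1) (γ a, 0) :=
      ContMDiffAt.comp (γ a, (0 : Perturb k)) (contMDiffAt_extChartAt' ha') contMDiffAt_fst
    exact h0.prodMk_space contMDiffAt_snd
  have h2 : ContMDiffAt (I.prod 𝓘(ℝ, Perturb k)) 𝓘(ℝ, E × ℝ) ∞
      (fun z : P × Perturb k => flowEnd hG uL ψ (extChartAt I p₀ z.1, z.2)) (γ a, 0) :=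
    (contDiffAt_flowEnd (hG := hG) (u := uL) hψ).contMDiffAt.comp (γ a, (0 : Perturb k)) h1
  have h3 : ContMDiffAt 𝓘(ℝ, E) I ∞ (extChartAt I p₀).symm
      (flowEnd hG uL ψ (extChartAt I p₀ (γ a), 0)).1 := by
    rw [hend]
    exact (contMDiffOn_extChartAt_symm p₀).contMDiffAt
      ((isOpen_extChartAt_target p₀).mem_nhds ((extChartAt I p₀).map_source hb))
  refine ⟨?_, ?_, ?_⟩
  · refine ContMDiffAt.prodMk ?_ ?_
    · exact h3.comp (γ a, (0 : Perturb k))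
        ((contDiff_fst.contDiffAt.contMDiffAt).comp (γ a, (0 : Perturb k)) h2)
    · exact (contDiff_snd.contDiffAt.contMDiffAt).comp (γ a, (0 : Perturb k)) h2
  · simp only [hend]
    exact (extChartAt I p₀).left_inv hb
  · have h4 : ∀ᶠ z : P × Perturb k in 𝓝 (γ a, 0), z.1 ∈ (extChartAt I p₀).source :=
      continuousAt_fst.eventually ((isOpen_extChartAt_source p₀).mem_nhds ha)
    filter_upwards [h1.continuousAt.eventually hev, h4] with z hz hz4 c hc
    obtain ⟨hz1, hz2⟩ := hz
    obtain ⟨t1, t2, t3⟩ := isTrajOn_flowCurve hρ hGeq hab huL hz1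
      (fun t ht => Metric.ball_subset_closedBall (hz2 t ht)) hc
    refine ⟨_, t1, ?_, congrArg Prod.fst t3, t2, congrArg Prod.snd t3⟩
    rw [flowCurve, intervalIntegral.integral_same, add_zero]
    exact (extChartAt I p₀).left_inv hz4

theorem IsFlow.comp {u : ℝ → Euc k} {γ : ℝ → P} {a b c : ℝ} (hab : a ≤ b) (hbc : b ≤ c)
    {Ψ Ψ' : P × Perturb k → P × ℝ} (h : IsFlow I Y L u γ a b Ψ) (h' : IsFlow I Y L u γ b c Ψ') :
    IsFlow I Y L u γ a c (fun z =>
      ((Ψ' ((Ψ z).1, z.2)).1, (Ψ z).2 + (Ψ' ((Ψ z).1, z.2)).2)) := by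
  have h1 : ContMDiffAt (I.prod 𝓘(ℝ, Perturb k)) (I.prod 𝓘(ℝ, Perturb k)) ∞
      (fun z : P × Perturb k => ((Ψ z).1, z.2)) (γ a, 0) :=
    (contMDiffAt_fst.comp (γ a, (0 : Perturb k)) h.smooth).prodMk contMDiffAt_snd
  have hpt : ((Ψ (γ a, 0)).1, (0 : Perturb k)) = (γ b, 0) := by rw [h.apply_self]
  have h2 : ContMDiffAt (I.prod 𝓘(ℝ, Perturb k)) (I.prod 𝓘(ℝ, ℝ)) ∞
      (fun z : P × Perturb k => Ψ' ((Ψ z).1, z.2)) (γ a, 0) := by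
    have h3 := h'.smooth
    rw [← hpt] at h3
    exact h3.comp (γ a, (0 : Perturb k)) h1
  refine ⟨?_, ?_, ?_⟩
  · refine (contMDiffAt_fst.comp (γ a, (0 : Perturb k)) h2).prodMk ?_
    have h3 : ContMDiffAt (I.prod 𝓘(ℝ, Perturb k)) 𝓘(ℝ, ℝ) ∞
      (fun z : P × Perturb k => (Ψ z).2) (γ a, 0) :=
      contMDiffAt_snd.comp (γ a, (0 : Perturb k)) h.smooth
    have h4 : ContMDiffAt (I.prod 𝓘(ℝ, Perturb k)) 𝓘(ℝ, ℝ) ∞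
      (fun z : P × Perturb k => (Ψ' ((Ψ z).1, z.2)).2) (γ a, 0) :=
      contMDiffAt_snd.comp (γ a, (0 : Perturb k)) h2
    exact h3.add h4
  · simp only [hpt, h'.apply_self]
  · have h5 := h1.continuousAt
    rw [ContinuousAt, hpt] at h5
    filter_upwards [h.traj, h5.eventually h'.traj] with z hz hz' w hw
    obtain ⟨η, e1, e2, e3, e4, e5⟩ := hz w (hw.mono (Icc_subset_Icc_right hbc))
    obtain ⟨η', f1, f2, f3, f4, f5⟩ := hz' w (hw.mono (Icc_subset_Icc_left hab))
    have g1 : EqOn (fun t => L (w t) (η t)) (fun t => L (w t) (if t ≤ b then η t else η' t))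
        (uIcc a b) := by
      intro t ht
      rw [uIcc_of_le hab] at ht
      simp [ht.2]
    have g2 : EqOn (fun t => L (w t) (η' t)) (fun t => L (w t) (if t ≤ b then η t else η' t))
        (uIcc b c) := by
      intro t ht
      rw [uIcc_of_le hbc] at ht
      rcases ht.1.eq_or_lt with rfl | h
      · simp [e3, f2]
      · simp [not_le.2 h]
    have i1 := e4.congr (fun t ht => g1 (uIoc_subset_uIcc ht))
    have i2 := f4.congr (fun t ht => g2 (uIoc_subset_uIcc ht))
    refine ⟨_, e1.concat hab hbc f1 (by rw [e3, f2]), ?_, ?_, i1.trans i2, ?_⟩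
    · simp [hab, e2]
    · rcases hbc.eq_or_lt with rfl | h
      · simpa [e3, f2] using f3
      · simpa [not_le.2 h] using f3
    · rw [← intervalIntegral.integral_add_adjacent_intervals i1 i2,
        ← intervalIntegral.integral_congr g1, ← intervalIntegral.integral_congr g2, e5, f5]

/-- Existence of smooth flows along a trajectory. -/
theorem IsTrajOn.exists_isFlow (hS : SmoothSystem I Y L) {u : ℝ → Euc k} {A B : ℝ} (hAB : A ≤ B)
    (hu : MemLp u ⊤ (resMeas A B)) {γ : ℝ → P} (hγ : IsTrajOn I (fun t => Y (u t)) A B γ) :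
    ∃ Ψ, IsFlow I Y L u γ A B Ψ := by
  have : ProperSpace E := FiniteDimensional.proper ℝ E
  refine interval_chain (R := fun a b => ∃ Ψ, IsFlow I Y L u γ a b Ψ) hAB ?_ ?_
  · rintro a b c - hab hbc - ⟨Ψ, h⟩ ⟨Ψ', h'⟩
    exact ⟨_, h.comp hab hbc h'⟩
  · intro t₀ ht₀
    obtain ⟨G, hG, ρ, hρ, hρt, hGeq, δ, hδ, hflow⟩ := hγ.exists_chart_flow hS hu ht₀
    refine ⟨δ, hδ, fun a b hab hsub ha hb => ?_⟩
    obtain ⟨hmem, uL, ψ, huL, hψ, hcurve, hev⟩ := hflow a b hab hsub ha hb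
    exact ⟨_, IsFlow.of_chart hρt hGeq hab hmem huL hψ hcurve hev⟩

end Flows

/-! ### Canonical coordinates on the cotangent bundle -/

section CotangentCharts

variable {n : ℕ} {M : Type*} [TopologicalSpace M] [ChartedSpace (Euc n) M]
  [IsManifold 𝓘(ℝ, Euc n) ∞ M]

theorem relation_fderiv {Φ : PhaseSpace n → PhaseSpace n} {Φ' : PhaseSpace n →L[ℝ] PhaseSpace n}
    {p : PhaseSpace n} (hΦ : HasFDerivAt Φ Φ' p) {R : Euc n → Euc n} {S : Euc n → ℝ}
    (hR : ContDiffAt ℝ 2 R p.1) (hS : ContDiffAt ℝ 2 S p.1)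
    (h : ∀ᶠ y in 𝓝 p, (Φ y).1 = R y.1 ∧ (Φ y).2.comp (fderiv ℝ R y.1) - fderiv ℝ S y.1 = y.2)
    (a : PhaseSpace n) :
    (Φ' a).1 = fderiv ℝ R p.1 a.1 ∧
    ∀ w, (Φ' a).2 (fderiv ℝ R p.1 w) + (Φ p).2 (fderiv ℝ (fderiv ℝ R) p.1 a.1 w) -
      fderiv ℝ (fderiv ℝ S) p.1 a.1 w = a.2 w := by
  have h1 : HasFDerivAt (fun y : PhaseSpace n => y.1) (ContinuousLinearMap.fst ℝ _ _) p :=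
    hasFDerivAt_fst
  have dR : DifferentiableAt ℝ (fderiv ℝ R) p.1 :=
    (hR.fderiv_right (m := 1) (by norm_num)).differentiableAt (by norm_num)
  have dS : DifferentiableAt ℝ (fderiv ℝ S) p.1 :=
    (hS.fderiv_right (m := 1) (by norm_num)).differentiableAt (by norm_num)
  have e1 : HasFDerivAt (fun y => (Φ y).1) ((ContinuousLinearMap.fst ℝ _ _).comp Φ') p :=
    hasFDerivAt_fst.comp p hΦ
  have e2 : HasFDerivAt (fun y => (Φ y).2) ((ContinuousLinearMap.snd ℝ _ _).comp Φ') p :=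
    hasFDerivAt_snd.comp p hΦ
  have f1 : HasFDerivAt (fun y : PhaseSpace n => R y.1)
      ((fderiv ℝ R p.1).comp (ContinuousLinearMap.fst ℝ _ _)) p :=
    (hR.differentiableAt (by norm_num)).hasFDerivAt.comp p h1
  constructor
  · have := e1.unique (f1.congr_of_eventuallyEq (h.mono fun y hy => hy.1))
    exact congrArg (fun A => A a) this
  · intro w
    have g2 : HasFDerivAt (fun y : PhaseSpace n => fderiv ℝ R y.1)
        ((fderiv ℝ (fderiv ℝ R) p.1).comp (ContinuousLinearMap.fst ℝ _ _)) p :=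
      dR.hasFDerivAt.comp p h1
    have g3 : HasFDerivAt (fun y : PhaseSpace n => fderiv ℝ S y.1)
        ((fderiv ℝ (fderiv ℝ S) p.1).comp (ContinuousLinearMap.fst ℝ _ _)) p :=
      dS.hasFDerivAt.comp p h1
    have g4 := (e2.clm_comp g2).sub g3
    have g5 := g4.unique ((hasFDerivAt_snd (𝕜 := ℝ) (p := p)).congr_of_eventuallyEq
      (h.mono fun y hy => hy.2))
    have g6 := congrArg (fun A => A a w) g5
    simp at g6
    linarith

theorem symp_relation_fderiv {Φ : PhaseSpace n → PhaseSpace n} {Φ' : PhaseSpace n →L[ℝ] PhaseSpace n}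
    {p : PhaseSpace n} (hΦ : HasFDerivAt Φ Φ' p) {R : Euc n → Euc n} {S : Euc n → ℝ}
    (hR : ContDiffAt ℝ 2 R p.1) (hS : ContDiffAt ℝ 2 S p.1)
    (h : ∀ᶠ y in 𝓝 p, (Φ y).1 = R y.1 ∧ (Φ y).2.comp (fderiv ℝ R y.1) - fderiv ℝ S y.1 = y.2)
    (a b : PhaseSpace n) : symp (Φ' a) (Φ' b) = symp a b := by
  obtain ⟨a1, a2⟩ := relation_fderiv hΦ hR hS h a
  obtain ⟨b1, b2⟩ := relation_fderiv hΦ hR hS h b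
  have sR := hR.isSymmSndFDerivAt (by simp) a.1 b.1
  have sS := hS.isSymmSndFDerivAt (by simp) a.1 b.1
  have a3 := a2 b.1
  have b3 := b2 a.1
  rw [sR, sS] at a3
  rw [symp, symp, a1, b1, ← a3, ← b3]
  ring

theorem mem_extChartAt_cot_source {l₀ l : CotBundle n M} :
    l ∈ (extChartAt (cotModel n) l₀).source ↔ l.1 ∈ (extChartAt 𝓘(ℝ, Euc n) l₀.1).source := by
  rw [FiberBundle.extChartAt]
  simp only [PartialEquiv.trans_source, PartialEquiv.prod_source, PartialEquiv.refl_source,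
    extChartAt_source, mem_inter_iff, mem_preimage]
  constructor
  · exact fun h => h.2.1
  · intro h
    refine ⟨?_, h, trivial⟩
    change l ∈ (trivializationAt (Euc n →L[ℝ] ℝ) (fun x : M => TangentSpace 𝓘(ℝ, Euc n) x →L[ℝ] Bundle.Trivial M ℝ x) l₀.1).source
    rw [hom_trivializationAt_source]
    exact ⟨h, trivial⟩

theorem extChartAt_cot_target (l₀ : CotBundle n M) : (extChartAt (cotModel n) l₀).target =
    (extChartAt 𝓘(ℝ, Euc n) l₀.1).target ×ˢ univ := by
  rw [FiberBundle.extChartAt_target, inter_eq_left.2]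
  intro x hx
  have := (extChartAt 𝓘(ℝ, Euc n) l₀.1).map_target hx
  rw [extChartAt_source] at this
  exact ⟨this, trivial⟩

theorem extChartAt_cot_fst (l₀ l : CotBundle n M) :
    (extChartAt (cotModel n) l₀ l).1 = extChartAt 𝓘(ℝ, Euc n) l₀.1 l.1 := by
  rw [FiberBundle.extChartAt]
  rfl

theorem extChartAt_cot_snd (l₀ l : CotBundle n M)
    (h : l.1 ∈ (extChartAt 𝓘(ℝ, Euc n) l₀.1).source) (w : TangentSpace 𝓘(ℝ, Euc n) l.1) :
    ((extChartAt (cotModel n) l₀ l).2 : Euc n →L[ℝ] ℝ)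
      (mfderiv 𝓘(ℝ, Euc n) 𝓘(ℝ, Euc n) (extChartAt 𝓘(ℝ, Euc n) l₀.1) l.1 w) = l.2 w := by
  have hs : l.1 ∈ (chartAt (Euc n) l₀.1).source := by rwa [extChartAt_source] at h
  have h1 : ((extChartAt (cotModel n) l₀ l).2 : Euc n →L[ℝ] ℝ) =
      ContinuousLinearMap.inCoordinates (Euc n) (TangentSpace 𝓘(ℝ, Euc n)) ℝ (Bundle.Trivial M ℝ)
        l₀.1 l.1 l₀.1 l.1 l.2 := by
    rw [FiberBundle.extChartAt]
    exact congrArg Prod.snd (hom_trivializationAt_apply (RingHom.id ℝ) l₀.1 l)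
  have h2 : mfderiv 𝓘(ℝ, Euc n) 𝓘(ℝ, Euc n) (extChartAt 𝓘(ℝ, Euc n) l₀.1) l.1 w =
      (trivializationAt (Euc n) (TangentSpace 𝓘(ℝ, Euc n)) l₀.1).continuousLinearMapAt ℝ l.1 w :=
    congrArg (fun A => A w) (TangentBundle.continuousLinearMapAt_trivializationAt hs).symm
  have h3 := (trivializationAt (Euc n) (TangentSpace 𝓘(ℝ, Euc n)) l₀.1).symmL_continuousLinearMapAt
    (R := ℝ) (b := l.1) hs w
  have h4 : ∀ x : Euc n, ContinuousLinearMap.inCoordinates (Euc n) (TangentSpace 𝓘(ℝ, Euc n)) ℝ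
      (Bundle.Trivial M ℝ) l₀.1 l.1 l₀.1 l.1 l.2 x =
      l.2 ((trivializationAt (Euc n) (TangentSpace 𝓘(ℝ, Euc n)) l₀.1).symmL ℝ l.1 x) := fun x =>
    congrArg (fun A => A (l.2 ((trivializationAt (Euc n) (TangentSpace 𝓘(ℝ, Euc n)) l₀.1).symmL ℝ
      l.1 x))) (Bundle.Trivial.continuousLinearMapAt_trivialization ℝ M ℝ l.1)
  rw [h1]
  exact (h4 _).trans (congrArg l.2 ((congrArg
    ((trivializationAt (Euc n) (TangentSpace 𝓘(ℝ, Euc n)) l₀.1).symmL ℝ l.1) h2).trans h3))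

instance [T2Space M] : T2Space (CotBundle n M) where
  t2 l l' hne := by
    by_cases h : l.1 = l'.1
    · have h1 : l ∈ (extChartAt (cotModel n) l).source := mem_extChartAt_source l
      have h2 : l' ∈ (extChartAt (cotModel n) l).source := by
        rw [mem_extChartAt_cot_source, ← h]
        exact mem_extChartAt_source _
      have h3 : extChartAt (cotModel n) l l ≠ extChartAt (cotModel n) l l' :=
        fun he => hne ((extChartAt (cotModel n) l).injOn h1 h2 he)
      obtain ⟨U, V, hU, hV, hlU, hlV, hd⟩ := t2_separation h3
      refine ⟨_, _, (continuousOn_extChartAt l).isOpen_inter_preimage (isOpen_extChartAt_source l) hU,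
        (continuousOn_extChartAt l).isOpen_inter_preimage (isOpen_extChartAt_source l) hV,
        ⟨h1, hlU⟩, ⟨h2, hlV⟩, ?_⟩
      exact (hd.preimage _).mono inter_subset_right inter_subset_right
    · obtain ⟨U, V, hU, hV, hlU, hlV, hd⟩ := t2_separation h
      have hc : Continuous (TotalSpace.proj : CotBundle n M → M) :=
        FiberBundle.continuous_proj (Euc n →L[ℝ] ℝ) _
      exact ⟨_, _, hU.preimage hc, hV.preimage hc, hlU, hlV, hd.preimage _⟩

theorem mdifferentiableAt_extChartAt_cot {l₀ l : CotBundle n M}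
    (h : l ∈ (extChartAt (cotModel n) l₀).source) :
    MDifferentiableAt (cotModel n) 𝓘(ℝ, PhaseSpace n) (extChartAt (cotModel n) l₀) l :=
  mdifferentiableAt_extChartAt (by rwa [extChartAt_source] at h)

/-- The first component of the coordinates of the differential of a map, in the charts used for the
tangent spaces. -/
theorem HasMFDerivAt.hasFDerivAt_coord {E H P E' H' P' : Type*} [NormedAddCommGroup E]
    [NormedSpace ℝ E] [TopologicalSpace H] [TopologicalSpace P] [ChartedSpace H P]
    [NormedAddCommGroup E'] [NormedSpace ℝ E'] [TopologicalSpace H'] [TopologicalSpace P']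
    [ChartedSpace H' P'] {I : ModelWithCorners ℝ E H} [I.Boundaryless]
    {I' : ModelWithCorners ℝ E' H'} {f : P → P'} {x : P} {f' : E →L[ℝ] E'}
    (h : HasMFDerivAt I I' f x f') :
    HasFDerivAt (fun y => extChartAt I' (f x) (f ((extChartAt I x).symm y))) f'
      (extChartAt I x x) := by
  have h2 : HasFDerivWithinAt (fun y => extChartAt I' (f x) (f ((extChartAt I x).symm y))) f'
      (range I) (extChartAt I x x) := h.2
  rwa [I.range_eq_univ, hasFDerivWithinAt_univ] at h2

theorem HasMFDerivAt.hasFDerivAt_symm {E H P E' : Type*} [NormedAddCommGroup E]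
    [NormedSpace ℝ E] [TopologicalSpace H] [TopologicalSpace P] [ChartedSpace H P]
    [NormedAddCommGroup E'] [NormedSpace ℝ E'] {I : ModelWithCorners ℝ E H} [I.Boundaryless]
    {f : P → E'} {x : P} {f' : E →L[ℝ] E'} (h : HasMFDerivAt I 𝓘(ℝ, E') f x f') :
    HasFDerivAt (fun y => f ((extChartAt I x).symm y)) f' (extChartAt I x x) :=
  h.hasFDerivAt_coord

theorem extChartAt_symm_cot_fst (l₀ : CotBundle n M) {y : PhaseSpace n}
    (hy : y ∈ (extChartAt (cotModel n) l₀).target) :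
    ((extChartAt (cotModel n) l₀).symm y).1 = (extChartAt 𝓘(ℝ, Euc n) l₀.1).symm y.1 := by
  have h1 := extChartAt_cot_fst l₀ ((extChartAt (cotModel n) l₀).symm y)
  rw [(extChartAt (cotModel n) l₀).right_inv hy] at h1
  rw [h1, (extChartAt 𝓘(ℝ, Euc n) l₀.1).left_inv
    (mem_extChartAt_cot_source.1 ((extChartAt (cotModel n) l₀).map_target hy))]

theorem fderiv_coord_change_mfderiv {E H P : Type*} [NormedAddCommGroup E]
    [NormedSpace ℝ E] [TopologicalSpace H] [TopologicalSpace P] [ChartedSpace H P]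
    {I : ModelWithCorners ℝ E H} [I.Boundaryless] [IsManifold I ∞ P] {p p' q : P}
    (h : q ∈ (extChartAt I p).source) (h' : q ∈ (extChartAt I p').source) (w : TangentSpace I q) :
    fderiv ℝ (extChartAt I p ∘ (extChartAt I p').symm) (extChartAt I p' q)
      (mfderiv I 𝓘(ℝ, E) (extChartAt I p') q w) = mfderiv I 𝓘(ℝ, E) (extChartAt I p) q w := by
  have hd : MDifferentiableAt 𝓘(ℝ, E) 𝓘(ℝ, E) (extChartAt I p ∘ (extChartAt I p').symm)
      (extChartAt I p' q) := by
    refine (ContDiffAt.differentiableAt (contDiffAt_coord_change ?_)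
      (by norm_num)).mdifferentiableAt
    rw [PartialEquiv.trans_source, PartialEquiv.symm_source]
    refine ⟨(extChartAt I p').map_source h', ?_⟩
    rwa [mem_preimage, (extChartAt I p').left_inv h']
  have h'2 := h'
  rw [extChartAt_source] at h'2
  have h1 := mfderiv_comp q hd (mdifferentiableAt_extChartAt (I := I) h'2)
  have h2 : (extChartAt I p ∘ (extChartAt I p').symm) ∘ extChartAt I p' =ᶠ[𝓝 q] extChartAt I p := by
    filter_upwards [(isOpen_extChartAt_source p').mem_nhds h'] with z hz
    simp only [Function.comp_apply]
    rw [(extChartAt I p').left_inv hz]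
  rw [h2.mfderiv_eq, mfderiv_eq_fderiv] at h1
  exact (congrArg (fun A => A w) h1).symm

theorem surjective_mfderiv_extChartAt {E H P : Type*} [NormedAddCommGroup E]
    [NormedSpace ℝ E] [TopologicalSpace H] [TopologicalSpace P] [ChartedSpace H P]
    {I : ModelWithCorners ℝ E H} [I.Boundaryless] [IsManifold I ∞ P] {p q : P}
    (h : q ∈ (extChartAt I p).source) (y : E) :
    ∃ w : TangentSpace I q, (mfderiv I 𝓘(ℝ, E) (extChartAt I p) q w : E) = y := by
  have : IsManifold I 1 P := IsManifold.of_le (n := ∞) (by norm_num)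
  obtain ⟨e, he⟩ := isInvertible_mfderiv_extChartAt h
  exact ⟨e.symm y, by rw [← he]; exact e.apply_symm_apply y⟩

/-- Changes of canonical coordinates are symplectic. -/
theorem symp_mfderiv_extChartAt {l₀ l : CotBundle n M}
    (h : l ∈ (extChartAt (cotModel n) l₀).source) (a b : PhaseSpace n) :
    symp (mfderiv (cotModel n) 𝓘(ℝ, PhaseSpace n) (extChartAt (cotModel n) l₀) l a : PhaseSpace n)
      (mfderiv (cotModel n) 𝓘(ℝ, PhaseSpace n) (extChartAt (cotModel n) l₀) l b : PhaseSpace n) =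
      symp a b := by
  have hl1 := mem_extChartAt_cot_source.1 h
  have hK := (mdifferentiableAt_extChartAt_cot h).hasMFDerivAt.hasFDerivAt_symm
  have hR : ContDiffAt ℝ ∞ (extChartAt 𝓘(ℝ, Euc n) l₀.1 ∘ (extChartAt 𝓘(ℝ, Euc n) l.1).symm)
      (extChartAt (cotModel n) l l).1 := by
    rw [extChartAt_cot_fst]
    refine contDiffAt_coord_change ?_
    rw [PartialEquiv.trans_source, PartialEquiv.symm_source]
    refine ⟨mem_extChartAt_target l.1, ?_⟩
    rwa [mem_preimage, extChartAt_to_inv]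
  refine symp_relation_fderiv hK (contDiffAt_infty.1 hR 2) (S := fun _ => 0) contDiffAt_const ?_ a b
  have hU : (extChartAt (cotModel n) l).target ∩
      (extChartAt (cotModel n) l).symm ⁻¹' (extChartAt (cotModel n) l₀).source ∈
      𝓝 (extChartAt (cotModel n) l l) := by
    refine Filter.inter_mem (extChartAt_target_mem_nhds l) ?_
    refine (continuousAt_extChartAt_symm l).preimage_mem_nhds ?_
    rw [extChartAt_to_inv]
    exact (isOpen_extChartAt_source l₀).mem_nhds h
  filter_upwards [hU] with y hy
  have hyl := (extChartAt (cotModel n) l).map_target hy.1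
  have hy1 : y.1 ∈ (extChartAt 𝓘(ℝ, Euc n) l.1).target := by
    have := hy.1
    rw [extChartAt_cot_target] at this
    exact this.1
  have hb := extChartAt_symm_cot_fst l hy.1
  have hq := mem_extChartAt_cot_source.1 hy.2
  have hq' := mem_extChartAt_cot_source.1 hyl
  refine ⟨by rw [extChartAt_cot_fst, hb]; rfl, ?_⟩
  rw [fderiv_fun_const, Pi.zero_apply, sub_zero]
  ext w'
  obtain ⟨w, rfl⟩ := surjective_mfderiv_extChartAt hq' w'
  have e1 := extChartAt_cot_snd l _ hq' w
  have e2 := extChartAt_cot_snd l₀ _ hq w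
  have e3 := fderiv_coord_change_mfderiv hq hq' w
  have e4 : extChartAt 𝓘(ℝ, Euc n) l.1 ((extChartAt (cotModel n) l).symm y).1 = y.1 := by
    rw [hb, (extChartAt 𝓘(ℝ, Euc n) l.1).right_inv hy1]
  rw [(extChartAt (cotModel n) l).right_inv hy.1] at e1
  rw [e4] at e3
  refine Eq.trans ?_ (e2.trans e1.symm)
  exact congrArg (extChartAt (cotModel n) l₀ ((extChartAt (cotModel n) l).symm y)).2 e3

end CotangentCharts

/-! ### The systems defined by a control problem -/

section ControlProblems

variable {n k m : ℕ} {M N : Type*}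
  [TopologicalSpace M] [ChartedSpace (Euc n) M] [IsManifold 𝓘(ℝ, Euc n) ∞ M]
  [TopologicalSpace N] [ChartedSpace (Euc m) N] (P : ControlProblem n k m M N)

theorem contMDiffOn_prod_extChartAt_symm (p₀ : M) :
    ContMDiffOn 𝓘(ℝ, Euc k × Euc n) (𝓘(ℝ, Euc k).prod 𝓘(ℝ, Euc n)) ∞
      (fun z : Euc k × Euc n => (z.1, (extChartAt 𝓘(ℝ, Euc n) p₀).symm z.2))
      (univ ×ˢ (extChartAt 𝓘(ℝ, Euc n) p₀).target) := by
  refine ContMDiffOn.prodMk contDiff_fst.contMDiff.contMDiffOn ?_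
  exact (contMDiffOn_extChartAt_symm p₀).comp contDiff_snd.contMDiff.contMDiffOn (fun z hz => hz.2)

theorem ControlProblem.smoothSystem : SmoothSystem 𝓘(ℝ, Euc n) P.f P.L where
  field p₀ := by
    have h1 := P.smooth_f.comp_contMDiffOn (contMDiffOn_prod_extChartAt_symm (k := k) p₀)
    have h2 := ((trivializationAt (Euc n) (TangentSpace 𝓘(ℝ, Euc n)) p₀).contMDiffOn (n := ∞)
      (IB := 𝓘(ℝ, Euc n))).comp h1 (fun z hz => by
        have h3 := (extChartAt 𝓘(ℝ, Euc n) p₀).map_target hz.2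
        rw [extChartAt_source] at h3
        exact (Trivialization.mem_source
          (trivializationAt (Euc n) (TangentSpace 𝓘(ℝ, Euc n)) p₀)).2 h3)
    have h3 := (contMDiff_snd.comp_contMDiffOn h2).contDiffOn
    refine h3.congr fun z hz => ?_
    have h3 := (extChartAt 𝓘(ℝ, Euc n) p₀).map_target hz.2
    rw [extChartAt_source] at h3
    rw [chartField]
    have h4 := congrArg (fun A => A (P.f z.1 ((extChartAt 𝓘(ℝ, Euc n) p₀).symm z.2)))
      (TangentBundle.continuousLinearMapAt_trivializationAt (I := 𝓘(ℝ, Euc n)) h3)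
    refine Eq.trans h4.symm ?_
    exact Trivialization.continuousLinearMapAt_apply_of_mem _ _ h3 _
  cost p₀ := (P.smooth_L.comp_contMDiffOn (contMDiffOn_prod_extChartAt_symm p₀)).contDiffOn

/-- The functional in the chart at `q`. -/
def ControlProblem.chartCost (q : M) (z : Euc k × Euc n) : ℝ :=
  P.L z.1 ((extChartAt 𝓘(ℝ, Euc n) q).symm z.2)

/-- The dynamics in the chart at `q`. -/
def ControlProblem.chartDyn (q : M) (z : Euc k × Euc n) : Euc n :=
  chartField 𝓘(ℝ, Euc n) P.f q z

theorem ControlProblem.hasFDerivAt_chartDyn {q : M} {c : Euc k} {x : Euc n}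
    (hx : x ∈ (extChartAt 𝓘(ℝ, Euc n) q).target) :
    HasFDerivAt (fun x => P.chartDyn q (c, x))
      ((fderiv ℝ (P.chartDyn q) (c, x)).comp (ContinuousLinearMap.inr ℝ _ _)) x := by
  have h1 : ContDiffAt ℝ ∞ (P.chartDyn q) (c, x) := (P.smoothSystem.field q).contDiffAt
    ((isOpen_univ.prod (isOpen_extChartAt_target q)).mem_nhds ⟨trivial, hx⟩)
  exact (h1.differentiableAt (by norm_num)).hasFDerivAt.comp x (hasFDerivAt_prodMk_right c x)

theorem ControlProblem.hasFDerivAt_chartCost {q : M} {c : Euc k} {x : Euc n}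
    (hx : x ∈ (extChartAt 𝓘(ℝ, Euc n) q).target) :
    HasFDerivAt (fun x => P.chartCost q (c, x))
      ((fderiv ℝ (P.chartCost q) (c, x)).comp (ContinuousLinearMap.inr ℝ _ _)) x := by
  have h1 : ContDiffAt ℝ ∞ (P.chartCost q) (c, x) := (P.smoothSystem.cost q).contDiffAt
    ((isOpen_univ.prod (isOpen_extChartAt_target q)).mem_nhds ⟨trivial, hx⟩)
  exact (h1.differentiableAt (by norm_num)).hasFDerivAt.comp x (hasFDerivAt_prodMk_right c x)

theorem ControlProblem.hamiltonian_symm (ν : ℝ) (l₀ : CotBundle n M) (c : Euc k)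
    {y : PhaseSpace n} (hy : y ∈ (extChartAt (cotModel n) l₀).target) :
    P.hamiltonian ν c ((extChartAt (cotModel n) l₀).symm y) =
      y.2 (P.chartDyn l₀.1 (c, y.1)) - ν * P.chartCost l₀.1 (c, y.1) := by
  have h1 := mem_extChartAt_cot_source.1 ((extChartAt (cotModel n) l₀).map_target hy)
  have h2 := extChartAt_cot_snd l₀ _ h1 (P.f c ((extChartAt (cotModel n) l₀).symm y).1)
  rw [(extChartAt (cotModel n) l₀).right_inv hy] at h2
  have h3 := extChartAt_symm_cot_fst l₀ hy
  have h4 := chartField_apply (Y := P.f) h1 c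
  rw [hamiltonian, ← h2, chartCost, h3]
  refine congrArg₂ (fun a b : ℝ => a - b) ?_ rfl
  refine congrArg y.2 (h4.symm.trans ?_)
  rw [chartDyn, h3, (extChartAt 𝓘(ℝ, Euc n) l₀.1).right_inv]
  rw [extChartAt_cot_target] at hy
  exact hy.1

theorem eq_of_symp_eq {v : PhaseSpace n} {x : Euc n} {ξ : Euc n →L[ℝ] ℝ}
    (h : ∀ b : PhaseSpace n, symp b v = b.2 x - ξ b.1) : v = (x, ξ) := by
  refine Prod.ext ?_ ?_
  · ext i
    simpa [symp] using h (0, EuclideanSpace.proj i)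
  · ext b
    simpa [symp] using h (b, 0)

/-- The Hamiltonian vector field in canonical coordinates. -/
theorem ControlProblem.chartField_hamVec (ν : ℝ) (l₀ : CotBundle n M) (c : Euc k)
    {y : PhaseSpace n} (hy : y ∈ (extChartAt (cotModel n) l₀).target) :
    chartField (cotModel n) (fun c => hamVec (P.hamiltonian ν c)) l₀ (c, y) =
      (P.chartDyn l₀.1 (c, y.1),
        ν • (fderiv ℝ (P.chartCost l₀.1) (c, y.1)).comp (ContinuousLinearMap.inr ℝ _ _) -
        y.2.comp ((fderiv ℝ (P.chartDyn l₀.1) (c, y.1)).comp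
          (ContinuousLinearMap.inr ℝ _ _))) := by
  have hs := (extChartAt (cotModel n) l₀).map_target hy
  have hy1 : y.1 ∈ (extChartAt 𝓘(ℝ, Euc n) l₀.1).target := by
    rw [extChartAt_cot_target] at hy
    exact hy.1
  refine eq_of_symp_eq fun b => ?_
  obtain ⟨a, rfl⟩ := surjective_mfderiv_extChartAt hs b
  rw [chartField]
  refine (symp_mfderiv_extChartAt hs _ _).trans ((symp_hamVec _ _ _).trans ?_)
  let H : PhaseSpace n → ℝ := fun y =>
    y.2 (P.chartDyn l₀.1 (c, y.1)) - ν * P.chartCost l₀.1 (c, y.1)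
  have h1 : HasFDerivAt (fun y : PhaseSpace n => y.1) (ContinuousLinearMap.fst ℝ _ _) y :=
    hasFDerivAt_fst
  have h2 : HasFDerivAt (fun y : PhaseSpace n => y.2) (ContinuousLinearMap.snd ℝ _ _) y :=
    hasFDerivAt_snd
  have h3 := (h2.clm_apply ((P.hasFDerivAt_chartDyn hy1 (c := c)).comp y h1)).sub
      (((P.hasFDerivAt_chartCost hy1 (c := c)).comp y h1).const_mul ν)
  obtain ⟨H', hH', hH⟩ : ∃ H' : PhaseSpace n →L[ℝ] ℝ, (∀ b, H' b =
      b.2 (P.chartDyn l₀.1 (c, y.1)) - (ν • (fderiv ℝ (P.chartCost l₀.1) (c, y.1)).comp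
        (ContinuousLinearMap.inr ℝ _ _) - y.2.comp ((fderiv ℝ (P.chartDyn l₀.1) (c, y.1)).comp
          (ContinuousLinearMap.inr ℝ _ _))) b.1) ∧ HasFDerivAt H H' y := by
    refine ⟨_, fun b => ?_, h3⟩
    simp
    ring
  have e1 : P.hamiltonian ν c =ᶠ[𝓝 ((extChartAt (cotModel n) l₀).symm y)]
      H ∘ extChartAt (cotModel n) l₀ := by
    filter_upwards [(isOpen_extChartAt_source l₀).mem_nhds hs] with z hz
    have := P.hamiltonian_symm ν l₀ c ((extChartAt (cotModel n) l₀).map_source hz)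
    rwa [(extChartAt (cotModel n) l₀).left_inv hz] at this
  have hr := (extChartAt (cotModel n) l₀).right_inv hy
  rw [← hr] at hH
  have e2 := mfderiv_comp_apply ((extChartAt (cotModel n) l₀).symm y)
    hH.differentiableAt.mdifferentiableAt (mdifferentiableAt_extChartAt_cot hs) a
  rw [phaseDiff, e1.mfderiv_eq]
  refine e2.trans ?_
  rw [mfderiv_eq_fderiv, hH.fderiv]
  exact hH' _

theorem ControlProblem.smoothSystem_hamVec (ν : ℝ) :
    SmoothSystem (cotModel n) (fun c : Euc k => hamVec (P.hamiltonian ν c))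
      (fun _ _ => (0 : ℝ)) where
  cost _ := contDiffOn_const
  field l₀ := by
    have hsub : MapsTo (fun z : Euc k × PhaseSpace n => (z.1, z.2.1))
        (univ ×ˢ (extChartAt (cotModel n) l₀).target)
        (univ ×ˢ (extChartAt 𝓘(ℝ, Euc n) l₀.1).target) := by
      intro z hz
      rw [extChartAt_cot_target] at hz
      exact ⟨trivial, hz.2.1⟩
    have ho : IsOpen ((univ : Set (Euc k)) ×ˢ (extChartAt 𝓘(ℝ, Euc n) l₀.1).target) :=
      isOpen_univ.prod (isOpen_extChartAt_target l₀.1)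
    have hp : ContDiff ℝ ∞ (fun z : Euc k × PhaseSpace n => (z.1, z.2.1)) :=
      contDiff_fst.prodMk (contDiff_fst.comp contDiff_snd)
    have h1 := (P.smoothSystem.field l₀.1).comp hp.contDiffOn hsub
    have h2 := ((P.smoothSystem.field l₀.1).fderiv_of_isOpen ho (m := ∞) (by simp)).comp
      hp.contDiffOn hsub
    have h3 := ((P.smoothSystem.cost l₀.1).fderiv_of_isOpen ho (m := ∞) (by simp)).comp
      hp.contDiffOn hsub
    have h4 : ContDiff ℝ ∞ (fun z : Euc k × PhaseSpace n => z.2.2) :=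
      contDiff_snd.comp contDiff_snd
    have h5 := h1.prodMk (((h3.clm_comp (contDiffOn_const (c := ContinuousLinearMap.inr ℝ (Euc k)
      (Euc n)))).const_smul ν).sub (h4.contDiffOn.clm_comp (h2.clm_comp (contDiffOn_const
        (c := ContinuousLinearMap.inr ℝ (Euc k) (Euc n))))))
    exact h5.congr fun z hz => P.chartField_hamVec ν l₀ z.1 hz.2

theorem ControlProblem.hamVec_fst (ν : ℝ) (c : Euc k) (l : CotBundle n M) :
    (hamVec (P.hamiltonian ν c) l : PhaseSpace n).1 = P.f c l.1 := by
  have h1 := P.chartField_hamVec ν l c (mem_extChartAt_target l)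
  rw [chartField_apply (mem_extChartAt_source l), mfderiv_extChartAt_self] at h1
  have h2 := chartField_apply (I := 𝓘(ℝ, Euc n)) (Y := P.f) (mem_extChartAt_source l.1) c
  rw [mfderiv_extChartAt_self] at h2
  have h3 := congrArg Prod.fst h1
  rw [extChartAt_cot_fst, chartDyn] at h3
  exact h3.trans h2

/-- The projection of a trajectory of a Hamiltonian system. -/
theorem ControlProblem.isTrajOn_proj {ν : ℝ} {u : ℝ → Euc k} {a b : ℝ} {l : ℝ → CotBundle n M}
    (h : IsTrajOn (cotModel n) (P.hamField ν u) a b l) :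
    IsTrajOn 𝓘(ℝ, Euc n) (fun t q => P.f (u t) q) a b (fun t => (l t).1) where
  continuousOn := (FiberBundle.continuous_proj (Euc n →L[ℝ] ℝ)
    (fun x : M => TangentSpace 𝓘(ℝ, Euc n) x →L[ℝ] Bundle.Trivial M ℝ x)).comp_continuousOn
      h.continuousOn
  lipschitz t₀ ht₀ := by
    obtain ⟨K, s, hs, hK⟩ := h.lipschitz t₀ ht₀
    refine ⟨K, s, hs, ?_⟩
    have h1 := LipschitzWith.prod_fst.comp_lipschitzOnWith hK
    rw [one_mul] at h1
    intro x hx y hy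
    have := h1 hx hy
    simpa only [Function.comp_apply, extChartAt_cot_fst] using this
  ode := by
    filter_upwards [h.ode] with t ht
    have key : ∀ w : PhaseSpace n, HasFDerivAt (fun s => extChartAt (cotModel n) (l t) (l s))
        (ContinuousLinearMap.smulRight (1 : ℝ →L[ℝ] ℝ) w) t →
        HasFDerivAt (fun s => extChartAt 𝓘(ℝ, Euc n) (l t).1 (l s).1)
          (ContinuousLinearMap.smulRight (1 : ℝ →L[ℝ] ℝ) w.1) t := by
      intro w h1
      have h2 := (hasFDerivAt_fst (𝕜 := ℝ) (p := extChartAt (cotModel n) (l t) (l t))).comp t h1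
      refine (h2.congr_fderiv ?_).congr_of_eventuallyEq (.of_forall fun s => ?_)
      · ext
        simp
      · exact (extChartAt_cot_fst (l t) (l s)).symm
    refine ⟨(FiberBundle.continuous_proj (Euc n →L[ℝ] ℝ)
      (fun x : M => TangentSpace 𝓘(ℝ, Euc n) x →L[ℝ] Bundle.Trivial M ℝ x)).continuousAt.comp
        ht.1, ?_⟩
    have h3 : HasFDerivAt (fun s => extChartAt 𝓘(ℝ, Euc n) (l t).1 (l s).1)
        (ContinuousLinearMap.smulRight (1 : ℝ →L[ℝ] ℝ) (P.f (u t) (l t).1 : Euc n)) t := by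
      rw [← P.hamVec_fst ν (u t) (l t)]
      exact key _ ht.hasFDerivAt_coord
    exact h3.hasFDerivWithinAt

end ControlProblems

/-! ### Costates and the differential of the flow -/

section Costate

variable {k : ℕ} {E : Type} [NormedAddCommGroup E] [NormedSpace ℝ E]
  [FiniteDimensional ℝ E] [ProperSpace E] {a b : ℝ} {G : Euc k × E → E × ℝ}
  {hG : ContDiff ℝ ∞ G} {u : Lp (Euc k) ⊤ (resMeas a b)}
  {ψ : E × Perturb k → Lp E ⊤ (resMeas a b)} {y₀ : E}

theorem fderiv_solution (hψ : ContDiffAt ℝ ∞ ψ (y₀, 0))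
    (hev : ∀ᶠ z in 𝓝 (y₀, 0), ψ z = Lp.const ⊤ _ z.1 + stateOp E a b (flowRhs hG u ψ z))
    (w : E) : fderiv ℝ ψ (y₀, 0) (w, 0) = Lp.const ⊤ _ w +
      stateOp E a b (fderiv ℝ (flowRhs hG u ψ) (y₀, 0) (w, 0)) := by
  have h1 : HasFDerivAt (fun z : E × Perturb k => Lp.const ⊤ (resMeas a b) z.1)
      ((Lp.constL ⊤ (resMeas a b) ℝ).comp (ContinuousLinearMap.fst ℝ E (Perturb k))) (y₀, 0) :=
    ((Lp.constL ⊤ (resMeas a b) ℝ).comp (ContinuousLinearMap.fst ℝ E (Perturb k))).hasFDerivAt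
  have h2 := (stateOp E a b).hasFDerivAt.comp (y₀, (0 : Perturb k))
    ((contDiffAt_flowRhs (hG := hG) (u := u) hψ).differentiableAt (by simp)).hasFDerivAt
  have h3 := ((h1.add h2).congr_of_eventuallyEq hev).fderiv
  rw [h3]
  rfl

theorem coeFn_fderiv_flowRhs (hψ : ContDiffAt ℝ ∞ ψ (y₀, 0)) (w : E) :
    (fderiv ℝ (flowRhs hG u ψ) (y₀, 0) (w, 0) : Lp (E × ℝ) 1 (resMeas a b)) =ᵐ[resMeas a b]
      fun t => fderiv ℝ G (u t, ψ (y₀, 0) t) (0, fderiv ℝ ψ (y₀, 0) (w, 0) t) := by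
  have h0 : HasFDerivAt (fun y : E => ((y, 0) : E × Perturb k))
      (ContinuousLinearMap.inl ℝ E (Perturb k)) y₀ := hasFDerivAt_prodMk_left y₀ 0
  have h1 : HasFDerivAt (fun y : E => flowRhs hG u ψ (y, 0)) _ y₀ :=
    HasFDerivAt.comp (g := flowRhs hG u ψ) y₀
      ((contDiffAt_flowRhs (hG := hG) (u := u) hψ).differentiableAt (by simp)).hasFDerivAt h0
  have h2 : HasFDerivAt (fun y : E => ψ (y, 0)) _ y₀ :=
    HasFDerivAt.comp (g := ψ) y₀ (hψ.differentiableAt (by simp)).hasFDerivAt h0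
  have h3 : HasFDerivAt (fun y : E => rhsLp hG u (0, ψ (y, 0))) _ y₀ :=
    HasFDerivAt.comp (g := fun x => rhsLp hG u (0, x)) y₀
      (hasFDerivAt_rhsLp_zero hG u (ψ (y₀, 0))).differentiableAt.hasFDerivAt h2
  have h4 : (fun y : E => flowRhs hG u ψ (y, 0)) = fun y : E => rhsLp hG u (0, ψ (y, 0)) := by
    ext1 y
    rw [flowRhs, map_zero]
  rw [h4] at h1
  have h5 := congrArg (fun A => A w) (h1.unique h3)
  have h6 : fderiv ℝ (flowRhs hG u ψ) (y₀, 0) (w, 0) =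
    fderiv ℝ (fun y => rhsLp hG u (0, y)) (ψ (y₀, 0)) (fderiv ℝ ψ (y₀, 0) (w, 0)) := h5
  rw [h6]
  exact coeFn_fderiv_rhsLp_zero hG u (ψ (y₀, 0)) _

theorem fderiv_flowEnd (hψ : ContDiffAt ℝ ∞ ψ (y₀, 0)) (w : E) :
    fderiv ℝ (flowEnd hG u ψ) (y₀, 0) (w, 0) =
      (w, 0) + L1.integralCLM (fderiv ℝ (flowRhs hG u ψ) (y₀, 0) (w, 0)) := by
  have h1 : HasFDerivAt (fun z : E × Perturb k => ((z.1, 0) : E × ℝ))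
      ((ContinuousLinearMap.inl ℝ E ℝ).comp (ContinuousLinearMap.fst ℝ E (Perturb k))) (y₀, 0) :=
    ((ContinuousLinearMap.inl ℝ E ℝ).comp (ContinuousLinearMap.fst ℝ E (Perturb k))).hasFDerivAt
  have h2 := (L1.integralCLM (E := E × ℝ) (μ := resMeas a b)).hasFDerivAt.comp
    (y₀, (0 : Perturb k))
    ((contDiffAt_flowRhs (hG := hG) (u := u) hψ).differentiableAt (by simp)).hasFDerivAt
  exact congrArg (fun A => A (w, 0)) (h1.add h2).fderiv

theorem LipschitzOnWith.clm_apply {F F' : Type*} [NormedAddCommGroup F] [NormedSpace ℝ F]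
    [NormedAddCommGroup F'] [NormedSpace ℝ F'] {ξ : ℝ → F →L[ℝ] F'} {η : ℝ → F} {K K' : NNReal}
    (hξ : LipschitzOnWith K ξ (Icc a b)) (hη : LipschitzOnWith K' η (Icc a b)) :
    ∃ K'' : NNReal, LipschitzOnWith K'' (fun t => ξ t (η t)) (Icc a b) := by
  obtain ⟨C, hC⟩ := isCompact_Icc.bddAbove_image hξ.continuousOn.norm
  obtain ⟨C', hC'⟩ := isCompact_Icc.bddAbove_image hη.continuousOn.norm
  refine ⟨(max C 0 * K' + max C' 0 * K).toNNReal, LipschitzOnWith.of_dist_le' fun s hs t ht => ?_⟩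
  have h1 : ‖ξ s‖ ≤ max C 0 := (hC ⟨s, hs, rfl⟩).trans (le_max_left _ _)
  have h2 : ‖η t‖ ≤ max C' 0 := (hC' ⟨t, ht, rfl⟩).trans (le_max_left _ _)
  have h3 := hξ.dist_le_mul s hs t ht
  have h4 := hη.dist_le_mul s hs t ht
  rw [dist_eq_norm] at h3 h4
  have h5 : ξ s (η s) - ξ t (η t) = ξ s (η s - η t) + (ξ s - ξ t) (η t) := by
    simp
  rw [dist_eq_norm, h5]
  calc ‖ξ s (η s - η t) + (ξ s - ξ t) (η t)‖ ≤ ‖ξ s‖ * ‖η s - η t‖ + ‖ξ s - ξ t‖ * ‖η t‖ :=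
        (norm_add_le _ _).trans (add_le_add ((ξ s).le_opNorm _) ((ξ s - ξ t).le_opNorm _))
    _ ≤ max C 0 * (K' * dist s t) + (K * dist s t) * max C' 0 := by gcongr
    _ = _ := by ring

/-- The pairing of a solution of the costate equation with the differential of the flow. -/
theorem costate_flowEnd (hab : a ≤ b) (hψ : ContDiffAt ℝ ∞ ψ (y₀, 0))
    (hev : ∀ᶠ z in 𝓝 (y₀, 0), ψ z = Lp.const ⊤ _ z.1 + stateOp E a b (flowRhs hG u ψ z))
    {ν : ℝ} {ξ : ℝ → E →L[ℝ] ℝ} {K : NNReal} (hξ : LipschitzOnWith K ξ (Icc a b))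
    (hd : ∀ᵐ t ∂(resMeas a b), ∃ ξ', HasDerivAt ξ ξ' t ∧ ∀ y,
      ξ' y = ν * (fderiv ℝ G (u t, flowCurve hG u ψ (y₀, 0) t) (0, y)).2 -
        ξ t (fderiv ℝ G (u t, flowCurve hG u ψ (y₀, 0) t) (0, y)).1) (w : E) :
    ξ b (fderiv ℝ (flowEnd hG u ψ) (y₀, 0) (w, 0)).1 -
      ν * (fderiv ℝ (flowEnd hG u ψ) (y₀, 0) (w, 0)).2 = ξ a w := by
  have hg := coeFn_fderiv_flowRhs (hG := hG) (u := u) hψ w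
  have hh := fderiv_solution (hG := hG) (u := u) hψ hev w
  have hend := fderiv_flowEnd (hG := hG) (u := u) hψ w
  rw [integralCLM_eq_intervalIntegral hab] at hend
  generalize fderiv ℝ (flowRhs hG u ψ) (y₀, 0) (w, 0) = g at hg hh hend
  generalize fderiv ℝ ψ (y₀, 0) (w, 0) = h at hg hh
  have hx := coeFn_eq_flowCurve (hG := hG) (u := u) (z := (y₀, 0)) hev.self_of_nhds
  let η : ℝ → E := fun t => w + ∫ s in a..t, (g s).1
  have hη : h =ᵐ[resMeas a b] η := by
    rw [hh]
    filter_upwards [Lp.coeFn_add (Lp.const ⊤ (resMeas a b) w) (stateOp E a b g),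
      coeFn_stateOp g, Lp.coeFn_const ⊤ (resMeas a b) w] with t h1 h2 h3
    rw [h1, Pi.add_apply, h2, h3]
    rfl
  have hg' : ∀ᵐ t ∂(resMeas a b),
      g t = fderiv ℝ G (u t, flowCurve hG u ψ (y₀, 0) t) (0, η t) := by
    filter_upwards [hg, hη, hx] with t h1 h2 h3
    rw [h1, h2, h3]
  obtain ⟨C, hC0, hC⟩ := exists_bound_fderiv hG ‖u‖ 0 ‖ψ (y₀, 0)‖
  have hbd : ∀ᵐ t ∂(resMeas a b), ‖(g t).1‖ ≤ C * ‖h‖ := by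
    filter_upwards [hg, Lp.ae_norm_le_norm_top u, Lp.ae_norm_le_norm_top (ψ (y₀, 0)),
      Lp.ae_norm_le_norm_top h] with t h1 h2 h3 h4
    rw [h1]
    refine (norm_fst_le _).trans ((ContinuousLinearMap.le_opNorm _ _).trans ?_)
    refine mul_le_mul (hC _ h2 _ (by simpa using h3)) ?_ (norm_nonneg _) hC0
    simpa [Prod.norm_def] using h4
  have hgi := L1.integrable_coeFn g
  have hi1 : IntervalIntegrable (fun s => (g s).1) volume a b := by
    rw [intervalIntegrable_iff_integrableOn_Icc_of_le hab]
    exact hgi.fst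
  have hηL := lipschitz_primitive (by positivity) hi1 hbd w
  obtain ⟨K', hK'⟩ := hξ.clm_apply hηL
  have hder : ∀ᵐ t ∂(resMeas a b),
      HasDerivAt (fun t => ξ t (η t)) (ν * (g t).2) t := by
    filter_upwards [hd, hasDerivAt_primitive hab hi1 w, hg'] with t ⟨ξ', h1, h2⟩ h3 h4
    refine (h1.clm_apply h3).congr_deriv ?_
    rw [h2, h4]
    simp only [η]
    ring
  have hfin := (hK'.eq_primitive hder hab).2 b (right_mem_Icc.2 hab)
  rw [intervalIntegral.integral_const_mul] at hfin
  have hηa : η a = w := by simp [η]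
  rw [hend]
  simp only [Prod.mk_add_mk, zero_add]
  have hfin' : ξ b (w + ∫ s in a..b, (g s).1) = ξ a (η a) + ν * ∫ s in a..b, (g s).2 := hfin
  rw [hηa] at hfin'
  linarith

end Costate

/-! ### Hamiltonian trajectories and the differential of the flow -/

section CostateManifold

variable {n k m : ℕ} {M N : Type*}
  [TopologicalSpace M] [ChartedSpace (Euc n) M] [IsManifold 𝓘(ℝ, Euc n) ∞ M]
  [TopologicalSpace N] [ChartedSpace (Euc m) N] (P : ControlProblem n k m M N)

theorem IsFlow.contMDiffAt_fst {E : Type} {H P : Type*} [NormedAddCommGroup E] [NormedSpace ℝ E]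
    [FiniteDimensional ℝ E] [TopologicalSpace H] [TopologicalSpace P] [ChartedSpace H P]
    {I : ModelWithCorners ℝ E H} {Y : Euc k → (p : P) → TangentSpace I p} {L : Euc k → P → ℝ}
    {u : ℝ → Euc k} {γ : ℝ → P} {a b : ℝ} {Ψ : P × Perturb k → P × ℝ}
    (h : IsFlow I Y L u γ a b Ψ) : ContMDiffAt I I ∞ (fun q => (Ψ (q, 0)).1) (γ a) := by
  have h1 : ContMDiffAt I (I.prod 𝓘(ℝ, Perturb k)) ∞ (fun q : P => (q, (0 : Perturb k))) (γ a) :=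
    contMDiffAt_id.prodMk contMDiffAt_const
  exact ContMDiffAt.comp (γ a) _root_.contMDiffAt_fst (h.smooth.comp (γ a) h1)

theorem IsFlow.contMDiffAt_snd {E : Type} {H P : Type*} [NormedAddCommGroup E] [NormedSpace ℝ E]
    [FiniteDimensional ℝ E] [TopologicalSpace H] [TopologicalSpace P] [ChartedSpace H P]
    {I : ModelWithCorners ℝ E H} {Y : Euc k → (p : P) → TangentSpace I p} {L : Euc k → P → ℝ}
    {u : ℝ → Euc k} {γ : ℝ → P} {a b : ℝ} {Ψ : P × Perturb k → P × ℝ}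
    (h : IsFlow I Y L u γ a b Ψ) : ContMDiffAt I 𝓘(ℝ, ℝ) ∞ (fun q => (Ψ (q, 0)).2) (γ a) := by
  have h1 : ContMDiffAt I (I.prod 𝓘(ℝ, Perturb k)) ∞ (fun q : P => (q, (0 : Perturb k))) (γ a) :=
    contMDiffAt_id.prodMk contMDiffAt_const
  exact ContMDiffAt.comp (γ a) _root_.contMDiffAt_snd (h.smooth.comp (γ a) h1)

/-- The relation `p' ∘ R' - ν S' = p` between the initial value `p` and the final value `p'` of a
Hamiltonian trajectory, where `R'` and `S'` are the differentials of the flow and of the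
functional. -/
def CostateRelation (ν : ℝ) (p p' : Euc n →L[ℝ] ℝ) (R' : Euc n →L[ℝ] Euc n) (S' : Euc n →L[ℝ] ℝ) :
    Prop :=
  ∀ w, p' (R' w) - ν * S' w = p w

theorem ControlProblem.ae_costate {ν : ℝ} {u : ℝ → Euc k} {a b : ℝ} {l : ℝ → CotBundle n M}
    (h : IsTrajOn (cotModel n) (P.hamField ν u) a b l) (l₀ : CotBundle n M)
    (hmem : ∀ t ∈ Icc a b, (l t).1 ∈ (extChartAt 𝓘(ℝ, Euc n) l₀.1).source) :
    ∀ᵐ t ∂(resMeas a b), HasDerivAt (fun t => (extChartAt (cotModel n) l₀ (l t)).2)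
      (ν • (fderiv ℝ (P.chartCost l₀.1) (u t, extChartAt 𝓘(ℝ, Euc n) l₀.1 (l t).1)).comp
          (ContinuousLinearMap.inr ℝ _ _) -
        (extChartAt (cotModel n) l₀ (l t)).2.comp ((fderiv ℝ (P.chartDyn l₀.1)
          (u t, extChartAt 𝓘(ℝ, Euc n) l₀.1 (l t).1)).comp (ContinuousLinearMap.inr ℝ _ _))) t := by
  filter_upwards [h.ae_hasDerivAt_chart l₀, ae_restrict_mem measurableSet_Icc] with t ht hts
  have hs : l t ∈ (extChartAt (cotModel n) l₀).source :=
    mem_extChartAt_cot_source.2 (hmem t hts)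
  have h1 := ht hs
  have h2 := P.chartField_hamVec ν l₀ (u t) ((extChartAt (cotModel n) l₀).map_source hs)
  rw [chartField_apply hs] at h2
  have h3 : HasDerivAt (fun t => extChartAt (cotModel n) l₀ (l t)) _ t := h1.congr_deriv h2
  have h4 := (hasFDerivAt_snd (𝕜 := ℝ) (E := Euc n) (F := Euc n →L[ℝ] ℝ) (p := extChartAt (cotModel n) l₀ (l t))).comp_hasDerivAt t h3
  refine h4.congr_deriv ?_
  rw [extChartAt_cot_fst]
  rfl

theorem ControlProblem.exists_isFlow_costate {ν : ℝ} {u : ℝ → Euc k} {A B : ℝ} (hAB : A ≤ B)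
    (hu : MemLp u ⊤ (resMeas A B)) {l : ℝ → CotBundle n M}
    (hl : IsTrajOn (cotModel n) (P.hamField ν u) A B l) :
    ∃ Ψ, IsFlow 𝓘(ℝ, Euc n) P.f P.L u (fun t => (l t).1) A B Ψ ∧
      ∀ (R' : Euc n →L[ℝ] Euc n) (S' : Euc n →L[ℝ] ℝ),
        HasMFDerivAt 𝓘(ℝ, Euc n) 𝓘(ℝ, Euc n) (fun q => (Ψ (q, 0)).1) (l A).1 R' →
        HasMFDerivAt 𝓘(ℝ, Euc n) 𝓘(ℝ, ℝ) (fun q => (Ψ (q, 0)).2) (l A).1 S' →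
        CostateRelation ν (l A).2 (l B).2 R' S' := by
  refine interval_chain (R := fun a b => ∃ Ψ, IsFlow 𝓘(ℝ, Euc n) P.f P.L u (fun t => (l t).1) a b Ψ ∧
      ∀ (R' : Euc n →L[ℝ] Euc n) (S' : Euc n →L[ℝ] ℝ),
        HasMFDerivAt 𝓘(ℝ, Euc n) 𝓘(ℝ, Euc n) (fun q => (Ψ (q, 0)).1) (l a).1 R' →
        HasMFDerivAt 𝓘(ℝ, Euc n) 𝓘(ℝ, ℝ) (fun q => (Ψ (q, 0)).2) (l a).1 S' →
        CostateRelation ν (l a).2 (l b).2 R' S') hAB ?_ ?_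
  · rintro a b c - hab hbc - ⟨Ψ, h, hc⟩ ⟨Ψ', h', hc'⟩
    refine ⟨_, h.comp hab hbc h', fun R' S' hR hS => ?_⟩
    obtain ⟨R₁, hR₁⟩ : ∃ R₁ : Euc n →L[ℝ] Euc n, HasMFDerivAt 𝓘(ℝ, Euc n) 𝓘(ℝ, Euc n)
      (fun q => (Ψ (q, 0)).1) (l a).1 R₁ :=
      ⟨_, (h.contMDiffAt_fst.mdifferentiableAt (by simp)).hasMFDerivAt⟩
    obtain ⟨S₁, hS₁⟩ : ∃ S₁ : Euc n →L[ℝ] ℝ, HasMFDerivAt 𝓘(ℝ, Euc n) 𝓘(ℝ, ℝ)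
      (fun q => (Ψ (q, 0)).2) (l a).1 S₁ :=
      ⟨_, (h.contMDiffAt_snd.mdifferentiableAt (by simp)).hasMFDerivAt⟩
    obtain ⟨R₂, hR₂⟩ : ∃ R₂ : Euc n →L[ℝ] Euc n, HasMFDerivAt 𝓘(ℝ, Euc n) 𝓘(ℝ, Euc n)
      (fun q => (Ψ' (q, 0)).1) (l b).1 R₂ :=
      ⟨_, (h'.contMDiffAt_fst.mdifferentiableAt (by simp)).hasMFDerivAt⟩
    obtain ⟨S₂, hS₂⟩ : ∃ S₂ : Euc n →L[ℝ] ℝ, HasMFDerivAt 𝓘(ℝ, Euc n) 𝓘(ℝ, ℝ)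
      (fun q => (Ψ' (q, 0)).2) (l b).1 S₂ :=
      ⟨_, (h'.contMDiffAt_snd.mdifferentiableAt (by simp)).hasMFDerivAt⟩
    have h1 := hc R₁ S₁ hR₁ hS₁
    have h2 := hc' R₂ S₂ hR₂ hS₂
    have hb : (Ψ ((l a).1, 0)).1 = (l b).1 := h.apply_self
    rw [← hb] at hR₂ hS₂
    have e1 : R' = R₂.comp R₁ := hasMFDerivAt_unique hR (HasMFDerivAt.comp
      (g := fun q => (Ψ' (q, 0)).1) (f := fun q => (Ψ (q, 0)).1) (l a).1 hR₂ hR₁)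
    have e2 : S' = S₁ + S₂.comp R₁ :=
      hasMFDerivAt_unique hS (hS₁.add (HasMFDerivAt.comp
        (g := fun q => (Ψ' (q, 0)).2) (f := fun q => (Ψ (q, 0)).1) (l a).1 hS₂ hR₁))
    intro w
    have h3 := h1 w
    have h4 := h2 (R₁ w)
    rw [e1, e2]
    simp only [ContinuousLinearMap.comp_apply, add_apply]
    linarith
  · intro t₀ ht₀
    have hγ := P.isTrajOn_proj hl
    obtain ⟨G, hG, ρ, hρ, hρt, hGeq, δ, hδ, hflow⟩ := hγ.exists_chart_flow P.smoothSystem hu ht₀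
    obtain ⟨δ', hδ', K, hm', hK⟩ := hl.exists_chart_interval ht₀ one_pos
    refine ⟨min δ δ', lt_min hδ hδ', fun a b hab hsub ha hb => ?_⟩
    obtain ⟨hmem, uL, ψ, huL, hψ, hcurve, hev⟩ := hflow a b hab hsub (ha.trans_le (min_le_left _ _))
      (hb.trans_le (min_le_left _ _))
    refine ⟨_, IsFlow.of_chart hρt hGeq hab hmem huL hψ hcurve hev, fun R' S' hR hS => ?_⟩
    have hξ : LipschitzOnWith K (fun t => (extChartAt (cotModel n) (l t₀) (l t)).2) (Icc a b) := by
      have h1 := LipschitzWith.prod_snd.comp_lipschitzOnWith (hK.mono (s := Icc a b) fun t ht => ⟨hsub ht, ?_⟩)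
      rw [one_mul] at h1
      · exact h1
      · have ha' := abs_lt.1 (ha.trans_le (min_le_right _ _))
        have hb' := abs_lt.1 (hb.trans_le (min_le_right _ _))
        exact abs_lt.2 ⟨by linarith [ht.1], by linarith [ht.2]⟩
    have hcs := costate_flowEnd (ν := ν) hab hψ (hev.mono fun z hz => hz.1) hξ (by
      filter_upwards [P.ae_costate (hl.mono hsub) (l t₀) hmem, huL,
        ae_restrict_mem measurableSet_Icc] with t h1 h2 h3
      refine ⟨_, h1, fun y => ?_⟩
      have h4 := hev.self_of_nhds.2 t h3
      rw [hcurve t h3, h2]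
      rw [hcurve t h3] at h4
      have h5 : (fun y => G (u t, y)) =ᶠ[𝓝 (extChartAt 𝓘(ℝ, Euc n) (l t₀).1 (l t).1)]
          fun y => (P.chartDyn (l t₀).1 (u t, y), P.chartCost (l t₀).1 (u t, y)) := by
        filter_upwards [Metric.isOpen_ball.mem_nhds h4] with y hy
        exact hGeq _ _ (Metric.ball_subset_closedBall hy)
      have h6 := hρt (Metric.ball_subset_closedBall h4)
      have h7 := ((P.hasFDerivAt_chartDyn (c := u t) h6).prodMk
        (P.hasFDerivAt_chartCost (c := u t) h6)).congr_of_eventuallyEq h5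
      have h8 := ((hG.differentiable (by simp)) (u t, extChartAt 𝓘(ℝ, Euc n) (l t₀).1
        (l t).1)).hasFDerivAt.comp (extChartAt 𝓘(ℝ, Euc n) (l t₀).1 (l t).1)
          (hasFDerivAt_prodMk_right (u t) _)
      have h9 : fderiv ℝ G (u t, extChartAt 𝓘(ℝ, Euc n) (l t₀).1 (l t).1) (0, y) = _ :=
        congrArg (fun A => A y) (h8.unique h7)
      rw [h9]
      simp)
    have hla := hmem a (left_mem_Icc.2 hab)
    have hlb := hmem b (right_mem_Icc.2 hab)
    have hla' := hla
    have hlb' := hlb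
    rw [extChartAt_source] at hla' hlb'
    obtain ⟨A, hA, hA'⟩ : ∃ A : Euc n →L[ℝ] Euc n, HasMFDerivAt 𝓘(ℝ, Euc n) 𝓘(ℝ, Euc n)
      (extChartAt 𝓘(ℝ, Euc n) (l t₀).1) (l a).1 A ∧ ∀ w,
      (extChartAt (cotModel n) (l t₀) (l a)).2 (A w) = (l a).2 w :=
      ⟨_, (mdifferentiableAt_extChartAt hla').hasMFDerivAt, extChartAt_cot_snd _ _ hla⟩
    obtain ⟨C, hC, hC'⟩ : ∃ A : Euc n →L[ℝ] Euc n, HasMFDerivAt 𝓘(ℝ, Euc n) 𝓘(ℝ, Euc n)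
      (extChartAt 𝓘(ℝ, Euc n) (l t₀).1) (l b).1 A ∧ ∀ w,
      (extChartAt (cotModel n) (l t₀) (l b)).2 (A w) = (l b).2 w :=
      ⟨_, (mdifferentiableAt_extChartAt hlb').hasMFDerivAt, extChartAt_cot_snd _ _ hlb⟩
    let D := fderiv ℝ (flowEnd hG uL ψ) (extChartAt 𝓘(ℝ, Euc n) (l t₀).1 (l a).1, 0)
    have hD : HasFDerivAt (fun y : Euc n => flowEnd hG uL ψ (y, 0))
        (D.comp (ContinuousLinearMap.inl ℝ (Euc n) (Perturb k)))
        (extChartAt 𝓘(ℝ, Euc n) (l t₀).1 (l a).1) :=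
      HasFDerivAt.comp (g := flowEnd hG uL ψ) _
        ((contDiffAt_flowEnd (hG := hG) (u := uL) hψ).differentiableAt (by simp)).hasFDerivAt
        (hasFDerivAt_prodMk_left _ _)
    have hD1 : HasMFDerivAt 𝓘(ℝ, Euc n) 𝓘(ℝ, Euc n)
        (fun q => (flowEnd hG uL ψ (extChartAt 𝓘(ℝ, Euc n) (l t₀).1 q, 0)).1) (l a).1
        (((ContinuousLinearMap.fst ℝ _ _).comp
          (D.comp (ContinuousLinearMap.inl ℝ (Euc n) (Perturb k)))).comp A) :=
      HasMFDerivAt.comp (g := fun y : Euc n => (flowEnd hG uL ψ (y, 0)).1) (l a).1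
        (hasFDerivAt_fst.comp _ hD).hasMFDerivAt hA
    have hD2 : HasMFDerivAt 𝓘(ℝ, Euc n) 𝓘(ℝ, ℝ)
        (fun q => (flowEnd hG uL ψ (extChartAt 𝓘(ℝ, Euc n) (l t₀).1 q, 0)).2) (l a).1
        (((ContinuousLinearMap.snd ℝ _ _).comp
          (D.comp (ContinuousLinearMap.inl ℝ (Euc n) (Perturb k)))).comp A) :=
      HasMFDerivAt.comp (g := fun y : Euc n => (flowEnd hG uL ψ (y, 0)).2) (l a).1
        (hasFDerivAt_snd.comp _ hD).hasMFDerivAt hA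
    have eS := hasMFDerivAt_unique hS hD2
    have hb1 : (l b).1 = (extChartAt 𝓘(ℝ, Euc n) (l t₀).1).symm
        (flowEnd hG uL ψ (extChartAt 𝓘(ℝ, Euc n) (l t₀).1 (l a).1, 0)).1 := by
      rw [flowEnd_eq hab]
      simp only
      rw [hcurve b (right_mem_Icc.2 hab), (extChartAt 𝓘(ℝ, Euc n) (l t₀).1).left_inv hlb]
    rw [hb1] at hC
    have hD3 := HasMFDerivAt.comp (l a).1 hC hR
    have hc : ContinuousAt (fun q => (extChartAt 𝓘(ℝ, Euc n) (l t₀).1 q, (0 : Perturb k)))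
        (l a).1 := (continuousAt_extChartAt' hla).prodMk continuousAt_const
    have hev' := hc.eventually hev
    have eR := hasMFDerivAt_unique hD3 (hD1.congr_of_eventuallyEq (by
      filter_upwards [hev'] with q hq
      have h1 := hρt (Metric.ball_subset_closedBall (hq.2 b (right_mem_Icc.2 hab)))
      have h2 : (flowEnd hG uL ψ (extChartAt 𝓘(ℝ, Euc n) (l t₀).1 q, 0)).1 =
          flowCurve hG uL ψ (extChartAt 𝓘(ℝ, Euc n) (l t₀).1 q, 0) b := by rw [flowEnd_eq hab]
      rw [← h2] at h1
      exact (extChartAt 𝓘(ℝ, Euc n) (l t₀).1).right_inv h1))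
    intro w
    have g1 := hcs (A w)
    have g2 : C (R' w) = (D (A w, 0)).1 := congrArg (fun A => A w) eR
    have g3 : S' w = (D (A w, 0)).2 := congrArg (fun A => A w) eS
    rw [hA'] at g1
    refine (congrArg (· - ν * S' w) (hC' (R' w)).symm).trans ?_
    rw [g2, g3]
    exact g1

end CostateManifold

/-! ### Lagrangian subspaces defined by a linear map and a quadratic form -/

section Lag

variable {X : Type*} [AddCommGroup X] [Module ℝ X] {n : ℕ}

/-- The vectors `(A v, ξ)` with `v ∈ W` and `ξ ∘ A + Q(v, ·) = 0` on `W`. -/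
def lag (A : X →ₗ[ℝ] Euc n) (Q : X →ₗ[ℝ] X →ₗ[ℝ] ℝ) (W : Submodule ℝ X) :
    Submodule ℝ (PhaseSpace n) where
  carrier := {η | ∃ v ∈ W, A v = η.1 ∧ ∀ w ∈ W, η.2 (A w) + Q v w = 0}
  zero_mem' := ⟨0, W.zero_mem, by simp, fun w _ => by simp⟩
  add_mem' := by
    rintro a b ⟨v, hv, hv1, hv2⟩ ⟨v', hw, hw1, hw2⟩
    refine ⟨v + v', W.add_mem hv hw, by simp [hv1, hw1], fun w h => ?_⟩
    have h1 := hv2 w h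
    have h2 := hw2 w h
    simp only [Prod.snd_add, map_add, _root_.add_apply, LinearMap.add_apply] at h1 h2 ⊢
    linarith
  smul_mem' := by
    rintro c a ⟨v, hv, hv1, hv2⟩
    refine ⟨c • v, W.smul_mem c hv, by simp [hv1], fun w h => ?_⟩
    have h1 := hv2 w h
    simp only [Prod.smul_snd, map_smul, _root_.smul_apply, LinearMap.smul_apply, smul_eq_mul] at h1 ⊢
    linear_combination c * h1

variable {A : X →ₗ[ℝ] Euc n} {Q : X →ₗ[ℝ] X →ₗ[ℝ] ℝ}

theorem mem_lag {W : Submodule ℝ X} {η : PhaseSpace n} :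
    η ∈ lag A Q W ↔ ∃ v ∈ W, A v = η.1 ∧ ∀ w ∈ W, η.2 (A w) + Q v w = 0 := Iff.rfl

theorem symp_lag (hQ : ∀ v w, Q v w = Q w v) {W : Submodule ℝ X} {a b : PhaseSpace n}
    (ha : a ∈ lag A Q W) (hb : b ∈ lag A Q W) : symp a b = 0 := by
  obtain ⟨v, hv, hv1, hv2⟩ := ha
  obtain ⟨w, hw, hw1, hw2⟩ := hb
  have h1 := hv2 w hw
  have h2 := hw2 v hv
  rw [symp, ← hv1, ← hw1]
  rw [hQ v w] at h1
  linarith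

/-- A symmetric bilinear form on a finite-dimensional space represents the functionals that vanish
on its kernel. -/
theorem exists_repr_of_vanish_on_ker {U : Type*} [AddCommGroup U] [Module ℝ U]
    [FiniteDimensional ℝ U] (B : U →ₗ[ℝ] U →ₗ[ℝ] ℝ) (hB : ∀ v w, B v w = B w v)
    (φ : U →ₗ[ℝ] ℝ) (hφ : ∀ v, B v = 0 → φ v = 0) : ∃ v, B v = φ := by
  have h1 : LinearMap.range B ≤ (LinearMap.ker B).dualAnnihilator := by
    rintro _ ⟨v, rfl⟩
    rw [Submodule.mem_dualAnnihilator]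
    intro w hw
    rw [hB, LinearMap.mem_ker.1 hw, LinearMap.zero_apply]
  have h2 : Module.finrank ℝ (LinearMap.range B) =
      Module.finrank ℝ (LinearMap.ker B).dualAnnihilator := by
    have e1 := LinearMap.finrank_range_add_finrank_ker B
    have e2 := Subspace.finrank_add_finrank_dualAnnihilator_eq (LinearMap.ker B)
    omega
  have h3 := Submodule.eq_of_le_of_finrank_eq h1 h2
  have h4 : φ ∈ (LinearMap.ker B).dualAnnihilator := by
    rw [Submodule.mem_dualAnnihilator]
    exact fun w hw => hφ w hw
  rw [← h3] at h4
  exact h4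

/-- The value `2 ξ(A v) - Q(v, v) - |A v|²`. -/
def lagVal (A : X →ₗ[ℝ] Euc n) (Q : X →ₗ[ℝ] X →ₗ[ℝ] ℝ) (ξ : Euc n →L[ℝ] ℝ) (v : X) : ℝ :=
  2 * ξ (A v) - (Q v v + ‖A v‖ ^ 2)

/-- The supremum over `U` of the values `2 ξ(A v) - Q(v, v) - |A v|²`. -/
def lagSup (A : X →ₗ[ℝ] Euc n) (Q : X →ₗ[ℝ] X →ₗ[ℝ] ℝ) (U : Submodule ℝ X)
    (ξ : Euc n →L[ℝ] ℝ) : ℝ :=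
  ⨆ v : U, lagVal A Q ξ v

theorem lagVal_le {ξ : Euc n →L[ℝ] ℝ} {v : X} (hv : 0 ≤ Q v v) : lagVal A Q ξ v ≤ ‖ξ‖ ^ 2 := by
  have h1 : ξ (A v) ≤ ‖ξ‖ * ‖A v‖ := (le_abs_self _).trans (ξ.le_opNorm _)
  rw [lagVal]
  nlinarith [sq_nonneg (‖ξ‖ - ‖A v‖)]

theorem bddAbove_lagVal {U : Submodule ℝ X} (hU : ∀ v ∈ U, 0 ≤ Q v v) (ξ : Euc n →L[ℝ] ℝ) :
    BddAbove (range fun v : U => lagVal A Q ξ v) :=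
  ⟨‖ξ‖ ^ 2, by rintro _ ⟨v, rfl⟩; exact lagVal_le (hU v v.2)⟩

theorem tendsto_lagSup {ι : Type*} {l : Filter ι} {U : Submodule ℝ X} {V : ι → Submodule ℝ X}
    (hU : ∀ v ∈ U, 0 ≤ Q v v) (hV : ∀ᶠ i in l, V i ≤ U) {ξ : Euc n →L[ℝ] ℝ}
    (happ : ∀ v ∈ U, ∃ w : ι → X, (∀ᶠ i in l, w i ∈ V i) ∧
      Filter.Tendsto (fun i => lagVal A Q ξ (w i)) l (𝓝 (lagVal A Q ξ v))) :
    Filter.Tendsto (fun i => lagSup A Q (V i) ξ) l (𝓝 (lagSup A Q U ξ)) := by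
  rw [tendsto_order]
  constructor
  · intro c hc
    obtain ⟨v, hv⟩ := exists_lt_of_lt_ciSup hc
    obtain ⟨w, hw, hlim⟩ := happ v v.2
    filter_upwards [hw, hV, hlim.eventually (lt_mem_nhds hv)] with i h1 h2 h3
    exact h3.trans_le (le_ciSup (bddAbove_lagVal (fun x hx => hU x (h2 hx)) ξ) ⟨w i, h1⟩)
  · intro c hc
    filter_upwards [hV] with i hi
    refine lt_of_le_of_lt (ciSup_le fun v => ?_) hc
    exact le_ciSup (bddAbove_lagVal hU ξ) (⟨v, hi v.2⟩ : U)

/-- The coordinates of the solutions `v` of `ξ ∘ A + Q(v, ·) + ⟨A v, A ·⟩ = 0` on `U`, expressed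
through `lagSup`. -/
def lagBase (A : X →ₗ[ℝ] Euc n) (Q : X →ₗ[ℝ] X →ₗ[ℝ] ℝ) (U : Submodule ℝ X) (i : Fin n) : Euc n :=
  WithLp.toLp 2 fun j => -((lagSup A Q U (EuclideanSpace.proj i + EuclideanSpace.proj j) -
    lagSup A Q U (EuclideanSpace.proj i - EuclideanSpace.proj j)) / 4)

theorem lagSup_eq (hQ : ∀ v w, Q v w = Q w v) {U : Submodule ℝ X} (hU : ∀ v ∈ U, 0 ≤ Q v v)
    {ξ : Euc n →L[ℝ] ℝ} {v : X} (hv : v ∈ U)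
    (h : ∀ w ∈ U, ξ (A w) + (Q v w + inner ℝ (A v) (A w)) = 0) :
    lagSup A Q U ξ = Q v v + inner ℝ (A v) (A v) := by
  refine le_antisymm (ciSup_le fun w => ?_) ?_
  · have h1 := h w w.2
    have h2 := hU _ (U.add_mem hv w.2)
    have h3 := real_inner_self_nonneg (x := A v + A w)
    rw [inner_add_left, inner_add_right, inner_add_right, real_inner_comm (A v) (A w)] at h3
    simp only [map_add, LinearMap.add_apply, hQ (w : X) v] at h2
    rw [lagVal, ← real_inner_self_eq_norm_sq]
    linarith
  · have h1 := h v hv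
    have h2 := le_ciSup (bddAbove_lagVal (A := A) hU ξ) (⟨-v, U.neg_mem hv⟩ : U)
    refine le_trans (le_of_eq ?_) h2
    rw [lagVal, ← real_inner_self_eq_norm_sq]
    simp only [map_neg, LinearMap.neg_apply, inner_neg_neg]
    linarith

/-- The solutions for the coordinate covectors. -/
theorem exists_lagBase (hQ : ∀ v w, Q v w = Q w v) {U : Submodule ℝ X} [FiniteDimensional ℝ U]
    (hU : ∀ v ∈ U, 0 ≤ Q v v) : ∃ v : Fin n → X, ∀ i, v i ∈ U ∧ A (v i) = lagBase A Q U i ∧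
      ∀ w ∈ U, (EuclideanSpace.proj i : Euc n →L[ℝ] ℝ) (A w) +
        (Q (v i) w + inner ℝ (A (v i)) (A w)) = 0 := by
  let B : U →ₗ[ℝ] U →ₗ[ℝ] ℝ := (Q + (innerₗ (Euc n)).compl₁₂ A A).domRestrict₁₂ U U
  have hB : ∀ v w : U, B v w = Q v w + inner ℝ (A v) (A w) := fun v w => rfl
  have key : ∀ ξ : Euc n →L[ℝ] ℝ, ∃ v ∈ U, ∀ w ∈ U,
      ξ (A w) + (Q v w + inner ℝ (A v) (A w)) = 0 := by
    intro ξ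
    obtain ⟨v, hv⟩ := exists_repr_of_vanish_on_ker B
      (fun v w => by rw [hB, hB, hQ, real_inner_comm])
      (-(ξ.toLinearMap ∘ₗ A ∘ₗ U.subtype)) (fun v hv => by
        have h1 : B v v = 0 := by rw [hv]; rfl
        rw [hB] at h1
        have h2 := hU v v.2
        have h3 := real_inner_self_nonneg (x := A (v : X))
        have h4 : A (v : X) = 0 := inner_self_eq_zero.1 (by linarith : inner ℝ (A (v : X)) (A v) = 0)
        simp [h4])
    refine ⟨v, v.2, fun w hw => ?_⟩
    have h1 := congrArg (fun φ => φ ⟨w, hw⟩) hv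
    simp only [hB] at h1
    rw [h1]
    simp
  choose v hv hvw using fun i : Fin n => key (EuclideanSpace.proj i)
  refine ⟨v, fun i => ⟨hv i, ?_, hvw i⟩⟩
  ext j
  have h1 := lagSup_eq (A := A) (ξ := EuclideanSpace.proj i + EuclideanSpace.proj j) (v := v i + v j) hQ hU
    (U.add_mem (hv i) (hv j)) (fun w hw => by
      have h1 := hvw i w hw
      have h2 := hvw j w hw
      simp only [map_add, _root_.add_apply, LinearMap.add_apply, inner_add_left] at h1 h2 ⊢
      linarith)
  have h2 := lagSup_eq (A := A) (ξ := EuclideanSpace.proj i - EuclideanSpace.proj j) (v := v i - v j) hQ hU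
    (U.sub_mem (hv i) (hv j)) (fun w hw => by
      have h1 := hvw i w hw
      have h2 := hvw j w hw
      simp only [map_sub, _root_.sub_apply, LinearMap.sub_apply, inner_sub_left] at h1 h2 ⊢
      linarith)
  have h3 := hvw j (v i) (hv i)
  simp only [lagBase, h1, h2]
  simp only [map_add, map_sub, LinearMap.add_apply, LinearMap.sub_apply, inner_add_left,
    inner_sub_left, inner_add_right, inner_sub_right, hQ (v j) (v i),
    real_inner_comm (A (v i)) (A (v j))]
  have h4 : (EuclideanSpace.proj j : Euc n →L[ℝ] ℝ) (A (v i)) = A (v i) j := rfl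
  rw [h4, hQ (v j), real_inner_comm (A (v i))] at h3
  linarith

end Lag

/-! ### Limit frames -/

section LimitFrames

variable {X : Type*} [AddCommGroup X] [Module ℝ X] {n : ℕ}

/-- `V₀` is finite-dimensional and `Q` is negative definite on it. -/
structure IsNegDef (Q : X →ₗ[ℝ] X →ₗ[ℝ] ℝ) (V₀ : Submodule ℝ X) : Prop where
  finite : FiniteDimensional ℝ V₀
  neg : ∀ v ∈ V₀, v ≠ 0 → Q v v < 0

/-- The orthogonal complement of `V₀` with respect to `Q`. -/
def qPerp (Q : X →ₗ[ℝ] X →ₗ[ℝ] ℝ) (V₀ : Submodule ℝ X) : Submodule ℝ X where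
  carrier := {v | ∀ w ∈ V₀, Q v w = 0}
  zero_mem' := fun w _ => by simp
  add_mem' := fun ha hb w hw => by rw [map_add, LinearMap.add_apply, ha w hw, hb w hw, add_zero]
  smul_mem' := fun c a ha w hw => by rw [map_smul, LinearMap.smul_apply, ha w hw, smul_zero]

/-- Dual families in `V₀`. -/
structure IsDualFamily (Q : X →ₗ[ℝ] X →ₗ[ℝ] ℝ) (V₀ : Submodule ℝ X) {r : ℕ} (β β' : Fin r → X) :
    Prop where
  mem : ∀ i, β i ∈ V₀
  mem' : ∀ i, β' i ∈ V₀
  repr : ∀ φ : X →ₗ[ℝ] ℝ, ∀ w ∈ V₀, Q (∑ i, φ (β i) • β' i) w = φ w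

variable {A : X →ₗ[ℝ] Euc n} {Q : X →ₗ[ℝ] X →ₗ[ℝ] ℝ} {V₀ : Submodule ℝ X}

theorem IsNegDef.exists_dualFamily (h : IsNegDef Q V₀) :
    ∃ (r : ℕ) (β β' : Fin r → X), IsDualFamily Q V₀ β β' := by
  have := h.finite
  let B : V₀ →ₗ[ℝ] Module.Dual ℝ V₀ := Q.domRestrict₁₂ V₀ V₀
  have hB : Function.Injective B := by
    rw [← LinearMap.ker_eq_bot, LinearMap.ker_eq_bot']
    intro v hv
    by_contra hne
    have h1 := h.neg v v.2 (fun h0 => hne (Subtype.ext h0))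
    have h2 : B v v = 0 := by rw [hv]; rfl
    exact h1.ne h2
  let e := LinearEquiv.ofInjectiveOfFinrankEq B hB Subspace.dual_finrank_eq.symm
  let b := Module.finBasis ℝ V₀
  refine ⟨_, fun i => b i, fun i => e.symm (b.coord i), fun i => (b i).2,
    fun i => (e.symm (b.coord i)).2, fun φ w hw => ?_⟩
  have h1 : φ.domRestrict V₀ = ∑ i, φ (b i) • b.coord i := by
    refine b.ext fun j => ?_
    simp [LinearMap.sum_apply, Finsupp.single_apply]
  have h2 : e (∑ i, φ (b i) • e.symm (b.coord i)) = φ.domRestrict V₀ := by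
    simp [map_sum, h1]
  have h3 := congrArg (fun ψ => ψ ⟨w, hw⟩) h2
  have h4 : ((∑ i, φ (b i) • e.symm (b.coord i) : V₀) : X) =
    ∑ i, φ (b i) • (e.symm (b.coord i) : X) := by simp
  rw [← h4]
  exact h3

variable {r : ℕ} {β β' : Fin r → X}

/-- The linear change of coordinates `(x, η) ↦ (x + D(η + x), η + x)`,
`D ξ = - ∑ ξ(A βᵢ) A β'ᵢ`. -/
def lagShear (A : X →ₗ[ℝ] Euc n) (β β' : Fin r → X) : PhaseSpace n →ₗ[ℝ] PhaseSpace n where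
  toFun a := (a.1 - ∑ i, (a.2 + innerSL ℝ a.1) (A (β i)) • A (β' i), a.2 + innerSL ℝ a.1)
  map_add' a b := by
    refine Prod.ext ?_ ?_
    · simp only [Prod.fst_add, Prod.snd_add, map_add, _root_.add_apply, add_smul,
        Finset.sum_add_distrib]
      abel
    · simp only [Prod.fst_add, Prod.snd_add, map_add]
      abel
  map_smul' c a := by
    refine Prod.ext ?_ ?_
    · simp only [Prod.smul_fst, Prod.smul_snd, map_smul, _root_.add_apply, _root_.smul_apply,
        RingHom.id_apply, smul_sub, Finset.smul_sum, smul_smul, smul_eq_mul, mul_add]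
    · simp only [Prod.smul_fst, Prod.smul_snd, map_smul, RingHom.id_apply, smul_add]

theorem lagShear_apply (a : PhaseSpace n) : lagShear A β β' a =
    (a.1 - ∑ i, (a.2 + innerSL ℝ a.1) (A (β i)) • A (β' i), a.2 + innerSL ℝ a.1) := rfl

theorem ker_lagShear : LinearMap.ker (lagShear A β β') = ⊥ := by
  rw [LinearMap.ker_eq_bot']
  intro a ha
  rw [lagShear_apply, Prod.mk_eq_zero] at ha
  have h1 : a.1 = 0 := by simpa [ha.2] using ha.1
  have h2 := ha.2
  rw [h1, map_zero, add_zero] at h2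
  exact Prod.ext h1 h2

/-- A frame of `lag A Q W` for `U = W ∩ V₀^⊥`. -/
def lagFrame (A : X →ₗ[ℝ] Euc n) (Q : X →ₗ[ℝ] X →ₗ[ℝ] ℝ) (β β' : Fin r → X) (U : Submodule ℝ X)
    (i : Fin n) : PhaseSpace n :=
  lagShear A β β' (lagBase A Q U i, EuclideanSpace.proj i)

theorem eq_sum_proj (ξ : Euc n →L[ℝ] ℝ) :
    ξ = ∑ i, ξ (EuclideanSpace.single i 1) • (EuclideanSpace.proj i : Euc n →L[ℝ] ℝ) := by
  ext y
  conv_lhs => rw [← (EuclideanSpace.basisFun (Fin n) ℝ).sum_repr y]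
  simp [mul_comm]

theorem linearIndependent_lagFrame (U : Submodule ℝ X) :
    LinearIndependent ℝ (lagFrame A Q β β' U) := by
  have h1 : LinearIndependent ℝ (fun i : Fin n => (EuclideanSpace.proj i : Euc n →L[ℝ] ℝ)) := by
    rw [Fintype.linearIndependent_iff]
    intro g hg i
    have := congrArg (fun ξ => ξ (EuclideanSpace.single i 1)) hg
    simpa [Finset.sum_apply, Pi.single_apply] using this
  have h2 : LinearIndependent ℝ (fun i : Fin n =>
      ((lagBase A Q U i, EuclideanSpace.proj i) : PhaseSpace n)) :=
    LinearIndependent.of_comp (LinearMap.snd ℝ _ _) h1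
  exact h2.map' _ ker_lagShear

theorem lag_eq_span (hQ : ∀ v w, Q v w = Q w v) (hβ : IsDualFamily Q V₀ β β') {W : Submodule ℝ X}
    [FiniteDimensional ℝ W] (hVW : V₀ ≤ W) (hW : ∀ v ∈ W ⊓ qPerp Q V₀, 0 ≤ Q v v) :
    lag A Q W = Submodule.span ℝ (range (lagFrame A Q β β' (W ⊓ qPerp Q V₀))) := by
  have : FiniteDimensional ℝ (W ⊓ qPerp Q V₀ : Submodule ℝ X) :=
    Submodule.finiteDimensional_of_le inf_le_left
  obtain ⟨v, hv⟩ := exists_lagBase (A := A) hQ hW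
  have hd : ∀ ξ : Euc n →L[ℝ] ℝ, (∑ i, ξ (A (β i)) • β' i ∈ V₀) ∧
      ∀ w ∈ V₀, Q (∑ i, ξ (A (β i)) • β' i) w = ξ (A w) := fun ξ =>
    ⟨V₀.sum_mem fun i _ => V₀.smul_mem _ (hβ.mem' i), fun w hw =>
      hβ.repr (ξ.toLinearMap ∘ₗ A) w hw⟩
  apply le_antisymm
  · rintro ⟨x, ξ⟩ ⟨z, hz, hz1, hz2⟩
    simp only at hz1 hz2
    obtain ⟨d1, d2⟩ := hd ξ
    set d := ∑ i, ξ (A (β i)) • β' i with hdd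
    have hU : z + d ∈ W ⊓ qPerp Q V₀ := by
      refine ⟨W.add_mem hz (hVW d1), fun w hw => ?_⟩
      have h1 := hz2 w (hVW hw)
      rw [map_add, LinearMap.add_apply, d2 w hw]
      linarith
    set η : Euc n →L[ℝ] ℝ := ξ - innerSL ℝ (A (z + d)) with hη
    set y := ∑ i, η (EuclideanSpace.single i 1) • v i with hy
    have hyU : y ∈ W ⊓ qPerp Q V₀ :=
      Submodule.sum_mem _ fun i _ => Submodule.smul_mem _ _ (hv i).1
    have hyη : ∀ w ∈ W ⊓ qPerp Q V₀, η (A w) + (Q y w + inner ℝ (A y) (A w)) = 0 := by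
      intro w hw
      conv_lhs => rw [eq_sum_proj η]
      rw [hy]
      simp only [map_sum, map_smul, LinearMap.sum_apply, LinearMap.smul_apply, sum_inner,
        inner_smul_left, _root_.sum_apply, _root_.smul_apply, smul_eq_mul, RCLike.conj_to_real]
      rw [← Finset.sum_add_distrib, ← Finset.sum_add_distrib]
      refine Finset.sum_eq_zero fun i _ => ?_
      have := (hv i).2.2 w hw
      linear_combination (η (EuclideanSpace.single i 1)) * this
    have hzη : ∀ w ∈ W ⊓ qPerp Q V₀,
        η (A w) + (Q (z + d) w + inner ℝ (A (z + d)) (A w)) = 0 := by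
      intro w hw
      have h1 := hz2 w hw.1
      have h2 : Q d w = 0 := by rw [hQ]; exact hw.2 d d1
      rw [hη, map_add Q z d, LinearMap.add_apply, h2]
      simp only [_root_.sub_apply, innerSL_apply_apply]
      linarith
    have hdiff := (W ⊓ qPerp Q V₀).sub_mem hU hyU
    have h0 : A (z + d) = A y := by
      have h1 := hyη _ hdiff
      have h2 := hzη _ hdiff
      have h3 := hW _ hdiff
      have h4 : inner ℝ (A (z + d - y)) (A (z + d - y)) + Q (z + d - y) (z + d - y) = 0 := by
        have e1 : Q (z + d - y) (z + d - y) = Q (z + d) (z + d - y) - Q y (z + d - y) := by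
          rw [Q.map_sub, LinearMap.sub_apply]
        have e2 : inner ℝ (A (z + d - y)) (A (z + d - y)) =
            inner ℝ (A (z + d)) (A (z + d - y)) - inner ℝ (A y) (A (z + d - y)) := by
          rw [← inner_sub_left, ← A.map_sub]
        rw [e1, e2]
        linarith
      have h5 := real_inner_self_nonneg (x := A (z + d - y))
      have h6 : A (z + d - y) = 0 := inner_self_eq_zero.1
        (by linarith : inner ℝ (A (z + d - y)) (A (z + d - y)) = 0)
      rwa [map_sub, sub_eq_zero] at h6
    have hfin : ((x, ξ) : PhaseSpace n) = ∑ i, η (EuclideanSpace.single i 1) •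
        lagFrame A Q β β' (W ⊓ qPerp Q V₀) i := by
      have h1 : ((A (z + d), η) : PhaseSpace n) = ∑ i, η (EuclideanSpace.single i 1) •
          ((lagBase A Q (W ⊓ qPerp Q V₀) i, EuclideanSpace.proj i) : PhaseSpace n) := by
        refine Prod.ext ?_ ?_
        · rw [Prod.fst_sum, h0, hy, map_sum]
          dsimp only
          refine Finset.sum_congr rfl fun i _ => ?_
          rw [map_smul, (hv i).2.1]
          rfl
        · rw [Prod.snd_sum]
          exact eq_sum_proj η
      have h2 := congrArg (lagShear A β β') h1
      rw [map_sum] at h2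
      simp only [map_smul] at h2
      refine Eq.trans ?_ h2
      rw [lagShear_apply]
      simp only [hη, sub_add_cancel]
      refine Prod.ext ?_ rfl
      simp only
      rw [← hz1, map_add, hdd, map_sum]
      simp only [map_smul]
      abel
    rw [hfin]
    exact Submodule.sum_mem _ fun i _ => Submodule.smul_mem _ _ (Submodule.subset_span ⟨i, rfl⟩)
  · rw [Submodule.span_le]
    rintro _ ⟨i, rfl⟩
    obtain ⟨h1, h2, h3⟩ := hv i
    set ξ : Euc n →L[ℝ] ℝ := EuclideanSpace.proj i + innerSL ℝ (A (v i)) with hξ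
    obtain ⟨d1, d2⟩ := hd ξ
    refine ⟨v i - ∑ j, ξ (A (β j)) • β' j, W.sub_mem h1.1 (hVW d1), ?_, fun w hw => ?_⟩
    · rw [lagFrame, lagShear_apply, ← h2, map_sub, map_sum]
      simp only [map_smul]
      rfl
    · have e1 : (lagFrame A Q β β' (W ⊓ qPerp Q V₀) i).2 = ξ := by
        rw [lagFrame, lagShear_apply, ← h2]
      rw [e1]
      set w₀ := ∑ j, Q w (β j) • β' j with hw₀
      have hw₀V : w₀ ∈ V₀ := V₀.sum_mem fun i _ => V₀.smul_mem _ (hβ.mem' i)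
      have hwU : w - w₀ ∈ W ⊓ qPerp Q V₀ := by
        refine ⟨W.sub_mem hw (hVW hw₀V), fun w' hw' => ?_⟩
        rw [map_sub, LinearMap.sub_apply, hβ.repr (Q w) w' hw', sub_self]
      set d := ∑ j, ξ (A (β j)) • β' j with hdd
      have f1 := h3 _ hwU
      have f2 : Q d (w - w₀) = 0 := by rw [hQ]; exact hwU.2 d d1
      have f3 := d2 w₀ hw₀V
      have f4 : Q (v i) w₀ = 0 := h1.2 w₀ hw₀V
      have f5 : ξ (A (w - w₀)) = (EuclideanSpace.proj i : Euc n →L[ℝ] ℝ) (A (w - w₀)) +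
        inner ℝ (A (v i)) (A (w - w₀)) := rfl
      rw [map_sub (Q (v i))] at f1
      rw [map_sub (Q d)] at f2
      have f6 : ξ (A (w - w₀)) = ξ (A w) - ξ (A w₀) := by rw [map_sub, map_sub]
      rw [Q.map_sub, LinearMap.sub_apply]
      linarith

end LimitFrames

/-! ### Existence and left continuity of limit frames -/

section LimitFrameExistence

open Filter

variable {X : Type*} [AddCommGroup X] [Module ℝ X] {n : ℕ}

/-- The finite-dimensional subspaces of `Y`. -/
abbrev FinSub (Y : Submodule ℝ X) := {W : Submodule ℝ X // FiniteDimensional ℝ W ∧ W ≤ Y}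

instance (Y : Submodule ℝ X) : Nonempty (FinSub Y) := ⟨⟨⊥, inferInstance, bot_le⟩⟩

instance (Y : Submodule ℝ X) : IsDirectedOrder (FinSub Y) where
  directed a b := by
    have := a.2.1
    have := b.2.1
    exact ⟨⟨a.1 ⊔ b.1, inferInstance, sup_le a.2.2 b.2.2⟩, le_sup_left (a := a.1),
      le_sup_right (a := a.1)⟩

/-- The subspace spanned by `b` is the generalized limit of the subspaces `lag A Q W` over the
finite-dimensional subspaces `W` of `Y`. -/
structure IsLimitFrame (A : X →ₗ[ℝ] Euc n) (Q : X →ₗ[ℝ] X →ₗ[ℝ] ℝ) (Y : Submodule ℝ X)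
    (b : Fin n → PhaseSpace n) : Prop where
  linearIndependent : LinearIndependent ℝ b
  symp : ∀ i j, symp (b i) (b j) = 0
  limit : ∃ c : FinSub Y → Fin n → PhaseSpace n, Tendsto c atTop (𝓝 b) ∧
    ∀ᶠ W in atTop, LinearIndependent ℝ (c W) ∧ lag A Q W.1 = Submodule.span ℝ (range (c W))

/-- The reflection `(x, ξ) ↦ (x, -ξ)`. -/
def phaseFlip (n : ℕ) : PhaseSpace n →ₗ[ℝ] PhaseSpace n :=
  LinearMap.prodMap LinearMap.id (-LinearMap.id)

theorem phaseFlip_apply (a : PhaseSpace n) : phaseFlip n a = (a.1, -a.2) := rfl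

theorem phaseFlip_phaseFlip (a : PhaseSpace n) : phaseFlip n (phaseFlip n a) = a := by
  simp [phaseFlip_apply]

theorem ker_phaseFlip : LinearMap.ker (phaseFlip n) = ⊥ := by
  rw [LinearMap.ker_eq_bot']
  intro a ha
  rw [← phaseFlip_phaseFlip a, ha, map_zero]

variable {A : X →ₗ[ℝ] Euc n} {Q : X →ₗ[ℝ] X →ₗ[ℝ] ℝ} {Y : Submodule ℝ X}

theorem lag_neg (W : Submodule ℝ X) : lag A Q W = (lag A (-Q) W).map (phaseFlip n) := by
  ext a
  rw [Submodule.mem_map]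
  constructor
  · rintro ⟨v, hv, h1, h2⟩
    refine ⟨phaseFlip n a, ⟨v, hv, h1, fun w hw => ?_⟩, phaseFlip_phaseFlip a⟩
    have := h2 w hw
    simp only [phaseFlip_apply, _root_.neg_apply, LinearMap.neg_apply]
    linarith
  · rintro ⟨_, ⟨v, hv, h1, h2⟩, rfl⟩
    refine ⟨v, hv, h1, fun w hw => ?_⟩
    have := h2 w hw
    simp only [phaseFlip_apply, _root_.neg_apply, LinearMap.neg_apply] at this ⊢
    linarith

theorem IsLimitFrame.flip {b : Fin n → PhaseSpace n} (h : IsLimitFrame A (-Q) Y b) :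
    IsLimitFrame A Q Y (fun i => phaseFlip n (b i)) := by
  obtain ⟨h1, h2, c, hc, hc'⟩ := h
  refine ⟨h1.map' _ ker_phaseFlip, fun i j => ?_, fun W i => phaseFlip n (c W i), ?_, ?_⟩
  · have := h2 i j
    simp only [_root_.symp, phaseFlip_apply, _root_.neg_apply] at this ⊢
    linarith
  · rw [tendsto_pi_nhds] at hc ⊢
    exact fun i => ((phaseFlip n).continuous_of_finiteDimensional.tendsto _).comp (hc i)
  · filter_upwards [hc'] with W hW
    refine ⟨hW.1.map' _ ker_phaseFlip, ?_⟩
    rw [lag_neg, hW.2, Submodule.map_span, ← range_comp]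
    rfl

variable {V₀ : Submodule ℝ X} {r : ℕ} {β β' : Fin r → X}

theorem tendsto_lagFrame {ι : Type*} {l : Filter ι} {U : ι → Submodule ℝ X} {U₀ : Submodule ℝ X}
    (h : ∀ ξ, Tendsto (fun i => lagSup A Q (U i) ξ) l (𝓝 (lagSup A Q U₀ ξ))) :
    Tendsto (fun i => lagFrame A Q β β' (U i)) l (𝓝 (lagFrame A Q β β' U₀)) := by
  rw [tendsto_pi_nhds]
  intro i
  refine ((lagShear A β β').continuous_of_finiteDimensional.tendsto _).comp ?_
  refine Tendsto.prodMk_nhds ?_ tendsto_const_nhds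
  refine ((PiLp.continuous_toLp 2 _).tendsto _).comp (tendsto_pi_nhds.2 fun j => ?_)
  exact (((h _).sub (h _)).div_const 4).neg

theorem isLimitFrame_lagFrame (hQ : ∀ v w, Q v w = Q w v) (hfin : FiniteDimensional ℝ V₀)
    (hβ : IsDualFamily Q V₀ β β') (hVY : V₀ ≤ Y) (hY : ∀ v ∈ Y ⊓ qPerp Q V₀, 0 ≤ Q v v) :
    IsLimitFrame A Q Y (lagFrame A Q β β' (Y ⊓ qPerp Q V₀)) := by
  have hlim : Tendsto (fun W : FinSub Y => lagFrame A Q β β' (W.1 ⊓ qPerp Q V₀)) atTop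
      (𝓝 (lagFrame A Q β β' (Y ⊓ qPerp Q V₀))) := by
    refine tendsto_lagFrame fun ξ => tendsto_lagSup hY
      (.of_forall fun W => inf_le_inf_right _ W.2.2) fun v hv => ⟨fun _ => v, ?_, tendsto_const_nhds⟩
    let W₀ : FinSub Y := ⟨Submodule.span ℝ {v}, inferInstance,
      (Submodule.span_singleton_le_iff_mem v Y).2 hv.1⟩
    filter_upwards [eventually_ge_atTop W₀] with W hW
    exact ⟨hW (Submodule.mem_span_singleton_self v), hv.2⟩
  have hev : ∀ᶠ W : FinSub Y in atTop, lag A Q W.1 =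
      Submodule.span ℝ (range (lagFrame A Q β β' (W.1 ⊓ qPerp Q V₀))) := by
    filter_upwards [eventually_ge_atTop (⟨V₀, hfin, hVY⟩ : FinSub Y)] with W hW
    have := W.2.1
    exact lag_eq_span hQ hβ hW fun v hv => hY v ⟨W.2.2 hv.1, hv.2⟩
  refine ⟨linearIndependent_lagFrame _, fun i j => ?_, _, hlim,
    hev.mono fun W hW => ⟨linearIndependent_lagFrame _, hW⟩⟩
  have hs : Continuous (fun p : PhaseSpace n × PhaseSpace n => _root_.symp p.1 p.2) := by
    unfold _root_.symp
    fun_prop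
  have h1 := (hs.tendsto _).comp ((tendsto_pi_nhds.1 hlim i).prodMk_nhds (tendsto_pi_nhds.1 hlim j))
  refine tendsto_nhds_unique h1 (tendsto_const_nhds.congr' ?_)
  filter_upwards [hev] with W hW
  refine (symp_lag (A := A) hQ (W := W.1) ?_ ?_).symm
  · rw [hW]; exact Submodule.subset_span ⟨i, rfl⟩
  · rw [hW]; exact Submodule.subset_span ⟨j, rfl⟩

/-- If `V₀` has maximal dimension among the negative definite subspaces of `Y` then `Q` is
nonnegative on its orthogonal complement. -/
theorem IsNegDef.nonneg_qPerp (hQ : ∀ v w, Q v w = Q w v) (hV : IsNegDef Q V₀) (hVY : V₀ ≤ Y)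
    (hmax : ∀ V, IsNegDef Q V → V ≤ Y → Module.finrank ℝ V ≤ Module.finrank ℝ V₀) :
    ∀ v ∈ Y ⊓ qPerp Q V₀, 0 ≤ Q v v := by
  rintro v ⟨hvY, hv⟩
  by_contra! hneg
  have := hV.finite
  have hvV : v ∉ V₀ := fun h => hneg.ne (hv v h)
  have h1 : IsNegDef Q (V₀ ⊔ Submodule.span ℝ {v}) := by
    refine ⟨inferInstance, fun z hz hz0 => ?_⟩
    obtain ⟨w, hw, y, hy, rfl⟩ := Submodule.mem_sup.1 hz
    obtain ⟨c, rfl⟩ := Submodule.mem_span_singleton.1 hy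
    have e1 : Q v w = 0 := hv w hw
    have e2 : Q (w + c • v) (w + c • v) = Q w w + c ^ 2 * Q v v := by
      simp only [map_add, map_smul, LinearMap.add_apply, LinearMap.smul_apply, smul_eq_mul,
        hQ w v, e1]
      ring
    rw [e2]
    by_cases hw0 : w = 0
    · have hc : c ≠ 0 := by
        rintro rfl
        exact hz0 (by simp [hw0])
      have : 0 < c ^ 2 := by positivity
      rw [hw0]
      simp only [map_zero, zero_add]
      nlinarith
    · have := hV.neg w hw hw0
      nlinarith [sq_nonneg c]
  have h2 := hmax _ h1 (sup_le hVY ((Submodule.span_singleton_le_iff_mem v Y).2 hvY))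
  have h3 : V₀ < V₀ ⊔ Submodule.span ℝ {v} := by
    refine lt_of_le_of_ne le_sup_left fun h => hvV ?_
    rw [h]
    exact Submodule.mem_sup_right (Submodule.mem_span_singleton_self v)
  have := h1.finite
  exact absurd (Submodule.finrank_lt_finrank_of_lt h3) (not_lt.2 h2)

theorem exists_maximal_finrank {p : Submodule ℝ X → Prop} {V : Submodule ℝ X} (hV : p V) {d : ℕ}
    (hd : ∀ V, p V → Module.finrank ℝ V ≤ d) :
    ∃ V₀, p V₀ ∧ ∀ V, p V → Module.finrank ℝ V ≤ Module.finrank ℝ V₀ := by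
  have h1 : {m | ∃ V, p V ∧ Module.finrank ℝ V = m}.Nonempty := ⟨_, V, hV, rfl⟩
  have h2 : BddAbove {m | ∃ V, p V ∧ Module.finrank ℝ V = m} :=
    ⟨d, by rintro _ ⟨V, h, rfl⟩; exact hd V h⟩
  obtain ⟨V₀, h3, h4⟩ := Nat.sSup_mem h1 h2
  exact ⟨V₀, h3, fun V h => by rw [h4]; exact le_csSup h2 ⟨V, h, rfl⟩⟩

theorem isNegDef_bot : IsNegDef Q ⊥ :=
  ⟨inferInstance, fun _ hv hv0 => absurd ((Submodule.mem_bot ℝ).1 hv) hv0⟩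

/-- Existence of the limit for a form of finite negative index. -/
theorem exists_isLimitFrame (hQ : ∀ v w, Q v w = Q w v) {d : ℕ}
    (hd : ∀ V, IsNegDef Q V → V ≤ Y → Module.finrank ℝ V ≤ d) : ∃ b, IsLimitFrame A Q Y b := by
  obtain ⟨V₀, ⟨h1, h2⟩, h3⟩ := exists_maximal_finrank (p := fun V => IsNegDef Q V ∧ V ≤ Y)
    ⟨isNegDef_bot, bot_le⟩ (fun V h => hd V h.1 h.2)
  obtain ⟨r, β, β', hβ⟩ := h1.exists_dualFamily
  exact ⟨_, isLimitFrame_lagFrame hQ h1.finite hβ h2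
    (h1.nonneg_qPerp hQ h2 fun V hV hVY => h3 V ⟨hV, hVY⟩)⟩

/-- Left continuity of the limit for a form of finite negative index. -/
theorem exists_isLimitFrame_tendsto (hQ : ∀ v w, Q v w = Q w v) {Y : ℝ → Submodule ℝ X} {t : ℝ}
    (ht : 0 < t) (hmono : ∀ s s', 0 < s → s ≤ s' → s' ≤ t → Y s ≤ Y s') {d : ℕ}
    (hd : ∀ V, IsNegDef Q V → V ≤ Y t → Module.finrank ℝ V ≤ d)
    (happ : ∀ v ∈ Y t, ∃ w : ℝ → X, (∀ s ∈ Ioo 0 t, w s ∈ Y s) ∧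
      Tendsto (fun s => A (w s)) (𝓝[<] t) (𝓝 (A v)) ∧
      Tendsto (fun s => Q (w s) (w s)) (𝓝[<] t) (𝓝 (Q v v)) ∧
      ∀ z ∈ Y t, Tendsto (fun s => Q (w s) z) (𝓝[<] t) (𝓝 (Q v z))) :
    ∃ (b : ℝ → Fin n → PhaseSpace n) (b₀ : Fin n → PhaseSpace n),
      (∀ᶠ s in 𝓝[<] t, IsLimitFrame A Q (Y s) (b s)) ∧ IsLimitFrame A Q (Y t) b₀ ∧
      Tendsto b (𝓝[<] t) (𝓝 b₀) := by
  have hsub : ∀ s ∈ Ioo 0 t, Y s ≤ Y t := fun s hs => hmono s t hs.1 hs.2.le le_rfl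
  obtain ⟨V₀, ⟨h1, s₀, hs₀, h2⟩, h3⟩ := exists_maximal_finrank
    (p := fun V => IsNegDef Q V ∧ ∃ s ∈ Ioo 0 t, V ≤ Y s) (V := ⊥)
    ⟨isNegDef_bot, t / 2, ⟨by linarith, by linarith⟩, bot_le⟩
    (fun V h => by
      obtain ⟨h1, s, hs, h2⟩ := h
      exact hd V h1 (h2.trans (hsub s hs)))
  obtain ⟨r, β, β', hβ⟩ := h1.exists_dualFamily
  have hIoo : ∀ᶠ s in 𝓝[<] t, s ∈ Ioo s₀ t := Ioo_mem_nhdsLT hs₀.2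
  have hVs : ∀ s ∈ Ioo s₀ t, V₀ ≤ Y s := fun s hs => h2.trans (hmono s₀ s hs₀.1 hs.1.le hs.2.le)
  have hpos : ∀ s ∈ Ioo s₀ t, ∀ v ∈ Y s ⊓ qPerp Q V₀, 0 ≤ Q v v := fun s hs =>
    h1.nonneg_qPerp hQ (hVs s hs) fun V hV hVY => h3 V ⟨hV, s, ⟨hs₀.1.trans hs.1, hs.2⟩, hVY⟩
  have hVt : V₀ ≤ Y t := h2.trans (hsub s₀ hs₀)
  have key : ∀ v ∈ Y t ⊓ qPerp Q V₀, ∃ w : ℝ → X, (∀ᶠ s in 𝓝[<] t, w s ∈ Y s ⊓ qPerp Q V₀) ∧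
      Tendsto (fun s => A (w s)) (𝓝[<] t) (𝓝 (A v)) ∧
      Tendsto (fun s => Q (w s) (w s)) (𝓝[<] t) (𝓝 (Q v v)) := by
    rintro v ⟨hv, hv'⟩
    obtain ⟨w, hw, w1, w2, w3⟩ := happ v hv
    have hP : ∀ s, ∑ i, Q (w s) (β i) • β' i ∈ V₀ := fun s =>
      V₀.sum_mem fun i _ => V₀.smul_mem _ (hβ.mem' i)
    have hPQ : ∀ s, ∀ z ∈ V₀, Q (∑ i, Q (w s) (β i) • β' i) z = Q (w s) z := fun s z hz =>
      hβ.repr (Q (w s)) z hz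
    have hz : ∀ i, Tendsto (fun s => Q (w s) (β i)) (𝓝[<] t) (𝓝 0) := fun i => by
      have := w3 (β i) (hVt (hβ.mem i))
      rwa [hv' (β i) (hβ.mem i)] at this
    refine ⟨fun s => w s - ∑ i, Q (w s) (β i) • β' i, ?_, ?_, ?_⟩
    · filter_upwards [hIoo] with s hs
      refine ⟨(Y s).sub_mem (hw s ⟨hs₀.1.trans hs.1, hs.2⟩) (hVs s hs (hP s)), fun z hz => ?_⟩
      rw [Q.map_sub, LinearMap.sub_apply, hPQ s z hz, sub_self]
    · have h4 : Tendsto (fun s => A (w s) - ∑ i, Q (w s) (β i) • A (β' i)) (𝓝[<] t)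
          (𝓝 (A v - ∑ i, (0 : ℝ) • A (β' i))) :=
        w1.sub (tendsto_finsetSum _ fun i _ => (hz i).smul_const _)
      simpa using h4
    · have h4 : Tendsto (fun s => Q (w s) (w s) - ∑ i, Q (w s) (β i) * Q (w s) (β' i)) (𝓝[<] t)
          (𝓝 (Q v v - ∑ i, (0 : ℝ) * Q v (β' i))) :=
        w2.sub (tendsto_finsetSum _ fun i _ => (hz i).mul (w3 _ (hVt (hβ.mem' i))))
      simp only [zero_mul, Finset.sum_const_zero, sub_zero] at h4
      refine h4.congr fun s => ?_
      have e1 := hPQ s _ (hP s)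
      have e2 : Q (w s) (∑ i, Q (w s) (β i) • β' i) = ∑ i, Q (w s) (β i) * Q (w s) (β' i) := by
        rw [map_sum]
        simp only [map_smul, smul_eq_mul]
      have e3 := hQ (∑ i, Q (w s) (β i) • β' i) (w s)
      rw [Q.map_sub, LinearMap.sub_apply, map_sub (Q (w s)), map_sub (Q (∑ i, _)), e1, e3, e2]
      ring
  have hpos' : ∀ v ∈ Y t ⊓ qPerp Q V₀, 0 ≤ Q v v := by
    intro v hv
    obtain ⟨w, hw, -, h4⟩ := key v hv
    refine ge_of_tendsto h4 ?_
    filter_upwards [hw, hIoo] with s h5 h6 using hpos s h6 _ h5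
  refine ⟨fun s => lagFrame A Q β β' (Y s ⊓ qPerp Q V₀), _, ?_,
    isLimitFrame_lagFrame hQ h1.finite hβ hVt hpos', tendsto_lagFrame fun ξ =>
      tendsto_lagSup hpos' ?_ fun v hv => ?_⟩
  · filter_upwards [hIoo] with s hs
    exact isLimitFrame_lagFrame hQ h1.finite hβ (hVs s hs) (hpos s hs)
  · filter_upwards [hIoo] with s hs
    exact inf_le_inf_right _ (hsub s ⟨hs₀.1.trans hs.1, hs.2⟩)
  · obtain ⟨w, hw, h4, h5⟩ := key v hv
    refine ⟨w, hw, ?_⟩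
    exact (((ξ.continuous.tendsto _).comp h4).const_mul 2).sub (h5.add (h4.norm.pow 2))

end LimitFrameExistence

/-! ### Convergence in the Grassmannian -/

section Grassmannian

open Filter

variable {n : ℕ}

theorem isOpen_submodule_iff {O : Set (Submodule ℝ (PhaseSpace n))} :
    IsOpen O ↔ ∀ r : ℕ, IsOpen {b : {b : Fin r → PhaseSpace n // LinearIndependent ℝ b} |
      Submodule.span ℝ (range b.1) ∈ O} := by
  rw [isOpen_coinduced, isOpen_sigma_iff]
  rfl

theorem tendsto_span {ι : Type*} {l : Filter ι} {r : ℕ} {c : ι → Fin r → PhaseSpace n}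
    {b : Fin r → PhaseSpace n} (hb : LinearIndependent ℝ b) (hc : Tendsto c l (𝓝 b)) :
    Tendsto (fun i => Submodule.span ℝ (range (c i))) l (𝓝 (Submodule.span ℝ (range b))) := by
  rw [tendsto_nhds]
  intro O hO hbO
  obtain ⟨U, hU, hUO⟩ := isOpen_induced_iff.1 (isOpen_submodule_iff.1 hO r)
  have hbU : b ∈ U := by
    have : (⟨b, hb⟩ : {b : Fin r → PhaseSpace n // LinearIndependent ℝ b}) ∈ Subtype.val ⁻¹' U := by
      rw [hUO]; exact hbO
    exact this
  filter_upwards [hc.eventually (hU.mem_nhds hbU),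
    hc.eventually (isOpen_setOfPred_linearIndependent.mem_nhds hb)] with i h1 h2
  have : (⟨c i, h2⟩ : {b : Fin r → PhaseSpace n // LinearIndependent ℝ b}) ∈ Subtype.val ⁻¹' U := h1
  rw [hUO] at this
  exact this

theorem isOpen_disjoint {K : Set (PhaseSpace n)} (hK : IsCompact K) :
    IsOpen {Λ : Submodule ℝ (PhaseSpace n) | Disjoint (Λ : Set (PhaseSpace n)) K} := by
  rw [isOpen_submodule_iff]
  intro r
  rw [Metric.isOpen_iff]
  rintro ⟨b, hb⟩ hbK
  have hbK : Disjoint (Submodule.span ℝ (range b) : Set (PhaseSpace n)) K := hbK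
  obtain ⟨ε, hε, hsep⟩ := Metric.exists_pos_forall_lt_edist hK
    (Submodule.span ℝ (range b)).closed_of_finiteDimensional hbK.symm
  have hker : LinearMap.ker (Fintype.linearCombination ℝ b) = ⊥ :=
    LinearMap.ker_eq_bot.2 (linearIndependent_iff_injective_fintypeLinearCombination.1 hb)
  obtain ⟨δ, hδ, hanti⟩ := LinearMap.exists_antilipschitzWith _ hker
  obtain ⟨C, hC⟩ := hK.isBounded.exists_norm_le
  have hC0 : 0 ≤ max C 0 := le_max_right _ _
  set η : ℝ := min (1 / (2 * (δ * (r + 1)))) (ε / (2 * δ * (r + 1) * (max C 0 + 1))) with hη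
  have hηpos : 0 < η := lt_min (by positivity) (by positivity)
  refine ⟨η, hηpos, ?_⟩
  rintro ⟨c, hc⟩ hcb
  have hcb' : ‖c - b‖ < η := by
    rw [← dist_eq_norm]; exact hcb
  change Disjoint (Submodule.span ℝ (range c) : Set (PhaseSpace n)) K
  rw [Set.disjoint_left]
  intro k hk hkK
  obtain ⟨a, rfl⟩ := (Submodule.mem_span_range_iff_exists_fun ℝ).1 hk
  have h1 : ‖a‖ ≤ δ * ‖∑ i, a i • b i‖ := by
    have := hanti.le_mul_norm (map_zero _) a
    simpa [Fintype.linearCombination_apply] using this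
  have h2 : ‖∑ i, a i • c i - ∑ i, a i • b i‖ ≤ r * (‖a‖ * η) := by
    rw [← Finset.sum_sub_distrib]
    refine (norm_sum_le _ _).trans ((Finset.sum_le_sum (g := fun _ => ‖a‖ * η) fun i _ => ?_).trans
      (by simp))
    have hs : a i • c i - a i • b i = a i • (c i - b i) := (smul_sub _ _ _).symm
    rw [hs, norm_smul]
    exact mul_le_mul (norm_le_pi_norm a i) ((norm_le_pi_norm (c - b) i).trans hcb'.le)
      (norm_nonneg _) (norm_nonneg _)
  have h3 : ‖∑ i, a i • c i‖ ≤ max C 0 := (hC _ hkK).trans (le_max_left _ _)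
  have hb' : ∑ i, a i • b i ∈ Submodule.span ℝ (range b) :=
    Submodule.sum_mem _ fun i _ => Submodule.smul_mem _ _ (Submodule.subset_span ⟨i, rfl⟩)
  have h4 : (ε : ℝ) < ‖∑ i, a i • c i - ∑ i, a i • b i‖ := by
    have := hsep _ hkK _ hb'
    rw [edist_dist, dist_eq_norm, ← ENNReal.ofReal_coe_nnreal] at this
    exact (ENNReal.ofReal_lt_ofReal_iff_of_nonneg ε.2).1 this
  have h5 : ‖∑ i, a i • b i‖ ≤ max C 0 + r * (‖a‖ * η) := by
    have := norm_sub_norm_le (∑ i, a i • b i) (∑ i, a i • c i)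
    rw [norm_sub_rev] at this
    linarith
  have hδ' : (0 : ℝ) < δ := hδ
  have hε' : (0 : ℝ) < ε := hε
  have h6 : δ * (r * (‖a‖ * η)) ≤ ‖a‖ / 2 := by
    have e1 : η ≤ 1 / (2 * (δ * (r + 1))) := min_le_left _ _
    rw [le_div_iff₀ (by positivity)] at e1
    have e2 : δ * (r * η) ≤ 1 / 2 := by nlinarith [mul_pos hδ' hηpos]
    nlinarith [norm_nonneg a]
  have h7 : ‖a‖ ≤ 2 * δ * max C 0 := by
    have := h1.trans (mul_le_mul_of_nonneg_left h5 hδ'.le)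
    linarith
  have h8 : r * (‖a‖ * η) ≤ ε := by
    have e1 : η ≤ ε / (2 * δ * (r + 1) * (max C 0 + 1)) := min_le_right _ _
    rw [le_div_iff₀ (by positivity)] at e1
    have e2 : (r : ℝ) * (‖a‖ * η) ≤ r * ((2 * δ * max C 0) * η) := by gcongr
    have e3 : (r : ℝ) * ((2 * δ * max C 0) * η) ≤ η * (2 * δ * (r + 1) * (max C 0 + 1)) := by
      have : 0 ≤ 2 * δ * η := by positivity
      nlinarith [mul_nonneg this hC0, mul_nonneg this (Nat.cast_nonneg (α := ℝ) r)]
    linarith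
  linarith

/-- Limits of spans of frames are unique. -/
theorem eq_span_of_eventually {ι : Type*} {l : Filter ι} [l.NeBot] {r : ℕ}
    {c : ι → Fin r → PhaseSpace n} {b : Fin r → PhaseSpace n} (hb : LinearIndependent ℝ b)
    (hc : Tendsto c l (𝓝 b)) {Γ : Submodule ℝ (PhaseSpace n)}
    (h : ∀ O : Set (Submodule ℝ (PhaseSpace n)), IsOpen O → Γ ∈ O →
      ∃ᶠ i in l, Submodule.span ℝ (range (c i)) ∈ O) : Γ = Submodule.span ℝ (range b) := by
  have hli := hc.eventually (isOpen_setOfPred_linearIndependent.mem_nhds hb)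
  have hfin : Module.finrank ℝ Γ = r := by
    by_contra hne
    have hO : IsOpen {Λ : Submodule ℝ (PhaseSpace n) | Module.finrank ℝ Λ ≠ r} := by
      rw [isOpen_submodule_iff]
      intro r'
      have : {b : {b : Fin r' → PhaseSpace n // LinearIndependent ℝ b} |
          Submodule.span ℝ (range b.1) ∈ {Λ : Submodule ℝ (PhaseSpace n) |
            Module.finrank ℝ Λ ≠ r}} = {_b | r' ≠ r} := by
        ext b
        simp [finrank_span_eq_card b.2]
      rw [this]
      exact isOpen_const
    obtain ⟨i, h1, h2⟩ := ((h _ hO hne).and_eventually hli).exists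
    exact h1 (by rw [finrank_span_eq_card h2, Fintype.card_fin])
  have hle : Submodule.span ℝ (range b) ≤ Γ := by
    rw [Submodule.span_le]
    rintro _ ⟨j, rfl⟩
    by_contra hj
    have hopen : (Γ : Set (PhaseSpace n))ᶜ ∈ 𝓝 (b j) :=
      Γ.closed_of_finiteDimensional.isOpen_compl.mem_nhds hj
    obtain ⟨ρ, hρ, hsub⟩ := Metric.nhds_basis_closedBall.mem_iff.1 hopen
    have hΓ : Disjoint (Γ : Set (PhaseSpace n)) (Metric.closedBall (b j) ρ) :=
      Set.disjoint_left.2 fun x hx hx' => hsub hx' hx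
    have hcj := (tendsto_pi_nhds.1 hc j).eventually (Metric.closedBall_mem_nhds (b j) hρ)
    obtain ⟨i, h1, h2⟩ :=
      ((h _ (isOpen_disjoint (isCompact_closedBall (b j) ρ)) hΓ).and_eventually hcj).exists
    exact Set.disjoint_left.1 h1 (Submodule.subset_span ⟨j, rfl⟩) h2
  refine (Submodule.eq_of_le_of_finrank_eq hle ?_).symm
  rw [finrank_span_eq_card hb, hfin, Fintype.card_fin]

variable {X Z : Type*} [NormedAddCommGroup X] [NormedSpace ℝ X] [AddCommGroup Z] [Module ℝ Z]
  {A : Z →ₗ[ℝ] Euc n} {Q : Z →ₗ[ℝ] Z →ₗ[ℝ] ℝ} {F : X → Euc n} {J : X → ℝ} {ν : ℝ}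
  {p : Euc n →L[ℝ] ℝ} {e : X →ₗ[ℝ] Z} {Θ : PhaseSpace n →ₗ[ℝ] PhaseSpace n}
  {b : Fin n → PhaseSpace n}

theorem IsLimitFrame.isLDerivative_iff (hb : IsLimitFrame A Q (LinearMap.range e) b)
    (he : LinearMap.ker e = ⊥) (hΘ : LinearMap.ker Θ = ⊥)
    (hlag : ∀ W : Submodule ℝ X, FiniteDimensional ℝ W →
      lDerivative F J ν p W = (lag A Q (W.map e)).map Θ) {Γ : Submodule ℝ (PhaseSpace n)} :
    IsLDerivative F J ν p Γ ↔ Γ = (Submodule.span ℝ (range b)).map Θ := by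
  obtain ⟨h1, -, c, hc, hc'⟩ := hb
  have hb' : LinearIndependent ℝ (fun i => Θ (b i)) := h1.map' _ hΘ
  have hcΘ : Tendsto (fun W i => Θ (c W i)) atTop (𝓝 fun i => Θ (b i)) := by
    rw [tendsto_pi_nhds] at hc ⊢
    exact fun i => (Θ.continuous_of_finiteDimensional.tendsto _).comp (hc i)
  have hmap : ∀ b : Fin n → PhaseSpace n, (Submodule.span ℝ (range b)).map Θ =
      Submodule.span ℝ (range fun i => Θ (b i)) := fun b => by
    rw [Submodule.map_span, ← range_comp]; rfl
  have hcomap : ∀ W : FinSub (LinearMap.range e), FiniteDimensional ℝ (W.1.comap e) ∧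
      (W.1.comap e).map e = W.1 := fun W => by
    have := W.2.1
    refine ⟨?_, ?_⟩
    · exact Module.Finite.of_injective (e.restrict (p := W.1.comap e) (q := W.1) fun x hx => hx)
        (fun x y hxy => Subtype.ext (LinearMap.ker_eq_bot.1 he (congrArg Subtype.val hxy)))
    · rw [Submodule.map_comap_eq, inf_eq_right]
      exact W.2.2
  rw [hmap]
  constructor
  · intro hΓ
    refine eq_span_of_eventually (l := atTop) hb' hcΘ fun O hO hΓO => ?_
    obtain ⟨V, hV, hVO⟩ := hΓ O hO hΓO
    have : FiniteDimensional ℝ (V.map e) := inferInstance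
    refine Eventually.frequently ?_
    filter_upwards [hc', eventually_ge_atTop
      (⟨V.map e, this, LinearMap.map_le_range⟩ : FinSub (LinearMap.range e))] with W hW hVW
    have h2 := hVO (W.1.comap e) (hcomap W).1 (Submodule.map_le_iff_le_comap.1 hVW)
    rwa [hlag _ (hcomap W).1, (hcomap W).2, hW.2, hmap] at h2
  · rintro rfl O hO hbO
    have h2 := (tendsto_span hb' hcΘ).eventually (hO.mem_nhds hbO)
    obtain ⟨W₀, hW₀⟩ := eventually_atTop.1 (h2.and hc')
    refine ⟨W₀.1.comap e, (hcomap W₀).1, fun W hW hVW => ?_⟩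
    have : FiniteDimensional ℝ (W.map e) := inferInstance
    have h3 := hW₀ ⟨W.map e, this, LinearMap.map_le_range⟩ (by
      change W₀.1 ≤ W.map e
      rw [← (hcomap W₀).2]
      exact Submodule.map_mono hVW)
    rw [hlag W hW, h3.2.2, hmap]
    exact h3.1

theorem IsLimitFrame.isLagrangianSubspace {Y : Submodule ℝ Z} (hb : IsLimitFrame A Q Y b) :
    IsLagrangianSubspace (Submodule.span ℝ (range b)) := by
  refine ⟨fun x hx y hy => ?_, by rw [finrank_span_eq_card hb.linearIndependent, Fintype.card_fin]⟩
  obtain ⟨s, rfl⟩ := (Submodule.mem_span_range_iff_exists_fun ℝ).1 hx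
  obtain ⟨s', rfl⟩ := (Submodule.mem_span_range_iff_exists_fun ℝ).1 hy
  have h1 := hb.symp
  simp only [_root_.symp] at h1 ⊢
  simp only [Prod.fst_sum, Prod.snd_sum, Prod.smul_fst, Prod.smul_snd, map_sum, map_smul,
    _root_.sum_apply, _root_.smul_apply, smul_eq_mul, Finset.mul_sum]
  rw [Finset.sum_comm, ← Finset.sum_sub_distrib]
  refine Finset.sum_eq_zero fun i _ => ?_
  rw [← Finset.sum_sub_distrib]
  refine Finset.sum_eq_zero fun j _ => ?_
  linear_combination (s i * s' j) * h1 i j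

end Grassmannian

/-! ### Second differentials -/

section SecondDifferentials

variable {X Y G : Type*} [NormedAddCommGroup X] [NormedSpace ℝ X] [NormedAddCommGroup Y]
  [NormedSpace ℝ Y] [NormedAddCommGroup G] [NormedSpace ℝ G]

theorem ContDiffAt.eventually_differentiableAt {f : X → Y} {x : X} (hf : ContDiffAt ℝ 2 f x) :
    ∀ᶠ y in 𝓝 x, DifferentiableAt ℝ f y :=
  (hf.eventually (by norm_num)).mono fun _ hy => hy.differentiableAt (by norm_num)

theorem ContDiffAt.differentiableAt_fderiv {f : X → Y} {x : X} (hf : ContDiffAt ℝ 2 f x) :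
    DifferentiableAt ℝ (fderiv ℝ f) x :=
  (hf.fderiv_right (m := 1) (by norm_num)).differentiableAt (by norm_num)

/-- The chain rule for second differentials. -/
theorem fderiv_fderiv_comp {g : Y → G} {f : X → Y} {x : X} (hg : ContDiffAt ℝ 2 g (f x))
    (hf : ContDiffAt ℝ 2 f x) (v w : X) :
    fderiv ℝ (fderiv ℝ (fun y => g (f y))) x v w =
      fderiv ℝ (fderiv ℝ g) (f x) (fderiv ℝ f x v) (fderiv ℝ f x w) +
        fderiv ℝ g (f x) (fderiv ℝ (fderiv ℝ f) x v w) := by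
  have h1 : fderiv ℝ (fun y => g (f y)) =ᶠ[𝓝 x] fun y => (fderiv ℝ g (f y)).comp (fderiv ℝ f y) := by
    filter_upwards [hf.eventually_differentiableAt,
      hf.continuousAt.eventually hg.eventually_differentiableAt] with y h2 h3
    exact fderiv_comp y h3 h2
  have h2 : HasFDerivAt (fun y => fderiv ℝ g (f y)) _ x :=
    hg.differentiableAt_fderiv.hasFDerivAt.comp x (hf.differentiableAt (by norm_num)).hasFDerivAt
  have h3 := h2.clm_comp hf.differentiableAt_fderiv.hasFDerivAt
  rw [h1.fderiv_eq, h3.fderiv]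
  simp [add_comm]

theorem fderiv_fderiv_comp_clm {g : Y → G} (e : X →L[ℝ] Y) {x : X} (hg : ContDiffAt ℝ 2 g (e x))
    (v w : X) : fderiv ℝ (fderiv ℝ (fun y => g (e y))) x v w =
      fderiv ℝ (fderiv ℝ g) (e x) (e v) (e w) := by
  rw [fderiv_fderiv_comp hg e.contDiff.contDiffAt, e.fderiv]
  have : fderiv ℝ e = fun _ => e := by
    ext1 y
    exact e.fderiv
  rw [this]
  simp

theorem fderiv_comp_clm {g : Y → G} (e : X →L[ℝ] Y) {x : X} (hg : DifferentiableAt ℝ g (e x))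
    (v : X) : fderiv ℝ (fun y => g (e y)) x v = fderiv ℝ g (e x) (e v) := by
  have := (hg.hasFDerivAt.comp x e.hasFDerivAt).fderiv
  exact congrArg (fun A => A v) this

theorem diff1_apply {F : X → Y} (hF : ContDiffAt ℝ 2 F 0) (W : Submodule ℝ X) (w : W) :
    diff1 F W w = fderiv ℝ F 0 w :=
  fderiv_comp_clm W.subtypeL (x := 0) (hF.differentiableAt (by norm_num)) w

theorem diff2_apply {F : X → Y} (hF : ContDiffAt ℝ 2 F 0) (W : Submodule ℝ X) (v w : W) :
    diff2 F W v w = fderiv ℝ (fderiv ℝ F) 0 v w :=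
  fderiv_fderiv_comp_clm W.subtypeL (x := 0) hF v w

variable {n : ℕ}

/-- The form `⟨p, d²F⟩ - ν d²J` at `x`. -/
def hessForm (p : Euc n →L[ℝ] ℝ) (ν : ℝ) (F : X → Euc n) (J : X → ℝ) (x : X) :
    X →ₗ[ℝ] X →ₗ[ℝ] ℝ :=
  LinearMap.mk₂ ℝ (fun v w => p (fderiv ℝ (fderiv ℝ F) x v w) - ν * fderiv ℝ (fderiv ℝ J) x v w)
    (fun v v' w => by simp only [map_add, _root_.add_apply]; ring)
    (fun c v w => by simp only [map_smul, _root_.smul_apply, smul_eq_mul]; ring)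
    (fun v w w' => by simp only [map_add]; ring)
    (fun c v w => by simp only [map_smul, smul_eq_mul]; ring)

variable {p p₁ p₂ : Euc n →L[ℝ] ℝ} {ν : ℝ} {F F₁ F₂ : X → Euc n} {J J₁ J₂ : X → ℝ} {x : X}

theorem hessForm_apply (v w : X) : hessForm p ν F J x v w =
    p (fderiv ℝ (fderiv ℝ F) x v w) - ν * fderiv ℝ (fderiv ℝ J) x v w := rfl

theorem hessForm_symm (hF : ContDiffAt ℝ 2 F x) (hJ : ContDiffAt ℝ 2 J x) (v w : X) :
    hessForm p ν F J x v w = hessForm p ν F J x w v := by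
  rw [hessForm_apply, hessForm_apply, hF.isSymmSndFDerivAt (by simp) v w,
    hJ.isSymmSndFDerivAt (by simp) v w]

theorem hessForm_congr (hF : F₁ =ᶠ[𝓝 x] F₂) (hJ : J₁ =ᶠ[𝓝 x] J₂) :
    hessForm p ν F₁ J₁ x = hessForm p ν F₂ J₂ x := by
  ext v w
  rw [hessForm_apply, hessForm_apply, hF.fderiv.fderiv_eq, hJ.fderiv.fderiv_eq]

theorem hessForm_comp_clm {F : Y → Euc n} {J : Y → ℝ} (e : X →L[ℝ] Y)
    (hF : ContDiffAt ℝ 2 F (e x)) (hJ : ContDiffAt ℝ 2 J (e x)) (v w : X) :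
    hessForm p ν (fun y => F (e y)) (fun y => J (e y)) x v w =
      hessForm p ν F J (e x) (e v) (e w) := by
  rw [hessForm_apply, hessForm_apply, fderiv_fderiv_comp_clm e hF, fderiv_fderiv_comp_clm e hJ]

/-- The transformation rule of the second differentials when the end-point map and the functional
are continued by a flow. -/
theorem hessForm_transport {R : Euc n → Euc n} {S : Euc n → ℝ} (hF₁ : ContDiffAt ℝ 2 F₁ x)
    (hJ₁ : ContDiffAt ℝ 2 J₁ x) (hR : ContDiffAt ℝ 2 R (F₁ x)) (hS : ContDiffAt ℝ 2 S (F₁ x))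
    (hF₂ : F₂ =ᶠ[𝓝 x] fun y => R (F₁ y)) (hJ₂ : J₂ =ᶠ[𝓝 x] fun y => J₁ y + S (F₁ y))
    (hp : CostateRelation ν p₁ p₂ (fderiv ℝ R (F₁ x)) (fderiv ℝ S (F₁ x))) (v w : X) :
    hessForm p₂ ν F₂ J₂ x v w = hessForm p₁ ν F₁ J₁ x v w +
      hessForm p₂ ν R S (F₁ x) (fderiv ℝ F₁ x v) (fderiv ℝ F₁ x w) := by
  have hSF : ContDiffAt ℝ 2 (fun y => S (F₁ y)) x := hS.comp x hF₁
  have h1 : fderiv ℝ (fderiv ℝ fun y => J₁ y + S (F₁ y)) x =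
      fderiv ℝ (fderiv ℝ J₁) x + fderiv ℝ (fderiv ℝ fun y => S (F₁ y)) x := by
    rw [← fderiv_add hJ₁.differentiableAt_fderiv hSF.differentiableAt_fderiv]
    refine Filter.EventuallyEq.fderiv_eq ?_
    filter_upwards [hJ₁.eventually_differentiableAt, hSF.eventually_differentiableAt] with y h2 h3
    exact fderiv_add h2 h3
  have h2 := hp (fderiv ℝ (fderiv ℝ F₁) x v w)
  rw [hessForm_congr hF₂ hJ₂, hessForm_apply, hessForm_apply, hessForm_apply, h1,
    fderiv_fderiv_comp hR hF₁]
  simp only [_root_.add_apply, fderiv_fderiv_comp hS hF₁, map_add]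
  linarith

theorem fderiv_transport {R : Euc n → Euc n} (hF₁ : ContDiffAt ℝ 2 F₁ x)
    (hR : ContDiffAt ℝ 2 R (F₁ x)) (hF₂ : F₂ =ᶠ[𝓝 x] fun y => R (F₁ y)) (v : X) :
    fderiv ℝ F₂ x v = fderiv ℝ R (F₁ x) (fderiv ℝ F₁ x v) := by
  rw [hF₂.fderiv_eq]
  exact congrArg (fun A => A v) (fderiv_comp x (hR.differentiableAt (by norm_num))
    (hF₁.differentiableAt (by norm_num)))

theorem formQ_apply (hF : ContDiffAt ℝ 2 F 0) (hJ : ContDiffAt ℝ 2 J 0) (W : Submodule ℝ X)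
    (v w : W) : formQ F J ν p W v w = hessForm p ν F J 0 v w := by
  rw [formQ, diff2_apply hF, diff2_apply hJ, hessForm_apply]

/-- The `𝓛`-derivative in the coordinates at the initial point. -/
theorem lDerivative_eq_map_lag {Z : Type*} [AddCommGroup Z] [Module ℝ Z] {A : Z →ₗ[ℝ] Euc n}
    {Q : Z →ₗ[ℝ] Z →ₗ[ℝ] ℝ} {e : X →ₗ[ℝ] Z} (hF : ContDiffAt ℝ 2 F 0) (hJ : ContDiffAt ℝ 2 J 0)
    {R' : Euc n →L[ℝ] Euc n} (hR' : Function.Injective R') {B : Euc n → Euc n → ℝ}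
    {Θ : PhaseSpace n →ₗ[ℝ] PhaseSpace n} (hΘs : Function.Surjective Θ)
    (hΘ1 : ∀ a, (Θ a).1 = R' a.1)
    (hΘ2 : ∀ a w, (Θ a).2 (R' w) + B a.1 w = a.2 w)
    (hA : ∀ v, fderiv ℝ F 0 v = R' (A (e v)))
    (hQ : ∀ v w, hessForm p ν F J 0 v w = Q (e v) (e w) + B (A (e v)) (A (e w)))
    (W : Submodule ℝ X) : lDerivative F J ν p W = (lag A Q (W.map e)).map Θ := by
  have key : ∀ a, Θ a ∈ lDerivative F J ν p W ↔ a ∈ lag A Q (W.map e) := by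
    intro a
    have h1 : Θ a ∈ lDerivative F J ν p W ↔ ∃ v : W, diff1 F W v = (Θ a).1 ∧
      ∀ w : W, (Θ a).2 (diff1 F W w) + formQ F J ν p W v w = 0 := Iff.rfl
    rw [h1, mem_lag]
    simp only [diff1_apply hF, formQ_apply hF hJ, hA, hΘ1, hQ, hR'.eq_iff]
    constructor
    · rintro ⟨v, hv, hvw⟩
      refine ⟨e v, ⟨v, v.2, rfl⟩, hv, ?_⟩
      rintro _ ⟨w, hw, rfl⟩
      have h2 := hvw ⟨w, hw⟩
      have h3 := hΘ2 a (A (e w))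
      simp only [hv] at h2
      linarith
    · rintro ⟨_, ⟨v, hv, rfl⟩, hv1, hvw⟩
      refine ⟨⟨v, hv⟩, hv1, fun w => ?_⟩
      have h2 := hvw (e w) ⟨w, w.2, rfl⟩
      have h3 := hΘ2 a (A (e w))
      simp only [hv1]
      linarith
  ext a
  obtain ⟨a, rfl⟩ := hΘs a
  rw [key, Submodule.mem_map]
  refine ⟨fun h => ⟨a, h, rfl⟩, ?_⟩
  rintro ⟨a', h, ha'⟩
  rw [← key, ← ha', key]
  exact h

end SecondDifferentials

/-! ### Uniqueness of flows -/

section FlowUniqueness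

variable {k : ℕ} {E : Type} {H P : Type*} [NormedAddCommGroup E] [NormedSpace ℝ E]
  [FiniteDimensional ℝ E] [TopologicalSpace H] [TopologicalSpace P] [ChartedSpace H P]
  {I : ModelWithCorners ℝ E H} [I.Boundaryless] [IsManifold I ∞ P]
  {Y : Euc k → (p : P) → TangentSpace I p} {L : Euc k → P → ℝ}
  {u : ℝ → Euc k} {γ : ℝ → P} {a b c : ℝ} {Ψ Ψ' Ψ'' : P × Perturb k → P × ℝ}

theorem IsPerturbation.memLp {v : Perturb k} {w : ℝ → Euc k} (hu : MemLp u ⊤ (resMeas a b))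
    (hw : IsPerturbation u v a b w) : MemLp w ⊤ (resMeas a b) := by
  obtain ⟨R, hR⟩ := MemLp.exists_ae_bound hu
  have h2 : AEStronglyMeasurable (fun t => u t + (1 - v.1 t) • v.2 t) (resMeas a b) :=
    hu.aestronglyMeasurable.add (((aestronglyMeasurable_const).sub
      ((Lp.aestronglyMeasurable v.1).mono_measure Measure.restrict_le_self)).smul
      ((Lp.aestronglyMeasurable v.2).mono_measure Measure.restrict_le_self))
  have h3 : AEStronglyMeasurable w (resMeas a b) := by
    refine h2.congr ?_
    filter_upwards [hw] with t ht using ht.2.symm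
  refine memLp_top_of_bound h3 (R + ‖v.2‖) ?_
  filter_upwards [hw, hR, ae_restrict_of_ae (Lp.ae_norm_le_norm_top v.2)] with t h3 h4 h5
  rw [h3.2]
  refine (norm_add_le _ _).trans (add_le_add h4 ?_)
  rcases h3.1 with h | h <;> rw [h] <;> simp [h5]

theorem isPerturbation_zero (u : ℝ → Euc k) (a b : ℝ) : IsPerturbation u 0 a b u := by
  filter_upwards [ae_restrict_of_ae (Lp.coeFn_zero ℝ 1 volume),
    ae_restrict_of_ae (Lp.coeFn_zero (Euc k) ⊤ volume)] with t h1 h2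
  have e1 : (0 : Perturb k).1 t = 0 := h1
  have e2 : (0 : Perturb k).2 t = 0 := h2
  rw [e1, e2]
  simp

theorem IsFlow.eventually_eq_of_isTrajOn [T2Space P] (hS : SmoothSystem I Y L) (hab : a ≤ b)
    (hu : MemLp u ⊤ (resMeas a b)) (h : IsFlow I Y L u γ a b Ψ) :
    ∀ᶠ z in 𝓝 (γ a, 0), ∀ w, IsPerturbation u z.2 a b w → ∀ η : ℝ → P,
      IsTrajOn I (fun t => Y (w t)) a b η → η a = z.1 →
      (η b, ∫ t in a..b, L (w t) (η t)) = Ψ z ∧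
        IntervalIntegrable (fun t => L (w t) (η t)) volume a b := by
  filter_upwards [h.traj] with z hz w hw η hη h0
  obtain ⟨η', h1, h2, h3, h4, h5⟩ := hz w hw
  have h6 := hη.eqOn hS (hw.memLp hu) h1 (h0.trans h2.symm)
  have h7 : EqOn (fun t => L (w t) (η' t)) (fun t => L (w t) (η t)) (uIcc a b) := fun t ht => by
    rw [uIcc_of_le hab] at ht
    simp only [h6 ht]
  refine ⟨Prod.ext ((h6 (right_mem_Icc.2 hab)).trans h3) ?_,
    h4.congr fun t ht => h7 (uIoc_subset_uIcc ht)⟩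
  exact (intervalIntegral.integral_congr h7.symm).trans h5

/-- Flows at equal perturbed controls agree. -/
theorem IsFlow.exists_nhds_eq [T2Space P] (hS : SmoothSystem I Y L) (hab : a ≤ b)
    (hu : MemLp u ⊤ (resMeas a b)) (h : IsFlow I Y L u γ a b Ψ) (h' : IsFlow I Y L u γ a b Ψ') :
    ∃ U ∈ 𝓝 (γ a, 0), ∀ z ∈ U, ∀ z' ∈ U, z.1 = z'.1 →
      (∃ w, IsPerturbation u z.2 a b w ∧ IsPerturbation u z'.2 a b w) → Ψ z = Ψ' z' := by
  refine ⟨_, Filter.inter_mem h.traj (h'.eventually_eq_of_isTrajOn hS hab hu), ?_⟩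
  rintro z ⟨hz, -⟩ z' ⟨-, hz'⟩ he ⟨w, hw, hw'⟩
  obtain ⟨η, h1, h2, h3, -, h5⟩ := hz w hw
  rw [← (hz' w hw' η h1 (h2.trans he)).1]
  exact Prod.ext h3.symm h5.symm

/-- The flow over a longer interval with a control that is perturbed on the initial interval
only. -/
theorem IsFlow.eventually_eq_comp [T2Space P] (hS : SmoothSystem I Y L) (hab : a ≤ b) (hbc : b ≤ c)
    (hu : MemLp u ⊤ (resMeas a c)) (h : IsFlow I Y L u γ a b Ψ) (h' : IsFlow I Y L u γ b c Ψ')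
    (h'' : IsFlow I Y L u γ a c Ψ'') :
    ∀ᶠ z in 𝓝 (γ a, 0), (∃ w, IsPerturbation u z.2 a c w ∧ IsPerturbation u 0 b c w) →
      Ψ'' z = ((Ψ' ((Ψ z).1, 0)).1, (Ψ z).2 + (Ψ' ((Ψ z).1, 0)).2) := by
  have h1 : Filter.Tendsto (fun z => ((Ψ z).1, (0 : Perturb k))) (𝓝 (γ a, 0)) (𝓝 (γ b, 0)) := by
    have h2 : ContinuousAt (fun z => ((Ψ z).1, (0 : Perturb k))) (γ a, 0) :=
      (continuousAt_fst.comp h.smooth.continuousAt).prodMk continuousAt_const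
    rw [ContinuousAt, h.apply_self] at h2
    exact h2
  filter_upwards [h''.traj, h.eventually_eq_of_isTrajOn hS hab
    (MemLp.resMeas_mono (Icc_subset_Icc_right hbc) hu),
    h1.eventually (h'.eventually_eq_of_isTrajOn hS hbc
      (MemLp.resMeas_mono (Icc_subset_Icc_left hab) hu))] with z e1 e2 e3
  rintro ⟨w, hw, hw0⟩
  obtain ⟨η, f1, f2, f3, -, f5⟩ := e1 w hw
  obtain ⟨g1, g2⟩ := e2 w (hw.mono (Icc_subset_Icc_right hbc)) η
    (f1.mono (Icc_subset_Icc_right hbc)) f2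
  obtain ⟨k1, k2⟩ := e3 w hw0 η (f1.mono (Icc_subset_Icc_left hab)) (congrArg Prod.fst g1)
  rw [← k1, ← g1]
  refine Prod.ext f3.symm ?_
  rw [← f5]
  exact (intervalIntegral.integral_add_adjacent_intervals g2 k2).symm

end FlowUniqueness

section HamiltonianFlow

variable {n k m : ℕ} {M N : Type*}
  [TopologicalSpace M] [ChartedSpace (Euc n) M] [IsManifold 𝓘(ℝ, Euc n) ∞ M] [T2Space M]
  [TopologicalSpace N] [ChartedSpace (Euc m) N] (P : ControlProblem n k m M N)
  {ν : ℝ} {u : ℝ → Euc k} {t : ℝ} {l : ℝ → CotBundle n M} {Ψ : M × Perturb k → M × ℝ}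

theorem isTrajOn_trajectory {E H P : Type*} [NormedAddCommGroup E] [NormedSpace ℝ E]
    [TopologicalSpace H] [TopologicalSpace P] [ChartedSpace H P] {I : ModelWithCorners ℝ E H}
    {X : ℝ → (p : P) → TangentSpace I p} {T : ℝ} {η : ℝ → P} (h : IsTrajOn I X 0 T η) :
    IsTrajOn I X 0 T (trajectory I X T (η 0)) ∧ trajectory I X T (η 0) 0 = η 0 := by
  have h1 : ∃ γ : ℝ → P, IsTrajectory I X T γ ∧ γ 0 = η 0 := ⟨η, isTrajOn_zero_iff.1 h, rfl⟩
  rw [trajectory, dif_pos h1]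
  exact ⟨isTrajOn_zero_iff.2 h1.choose_spec.1, h1.choose_spec.2⟩

/-- The Hamiltonian flow covers the flow of the control and transports covectors by its
differential. -/
theorem ControlProblem.eventually_hamFlow (ht : 0 ≤ t) (hu : MemLp u ⊤ (resMeas 0 t))
    (hl : IsTrajOn (cotModel n) (P.hamField ν u) 0 t l)
    (hΨ : IsFlow 𝓘(ℝ, Euc n) P.f P.L u (fun s => (l s).1) 0 t Ψ) :
    ∀ᶠ l' in 𝓝 (l 0), (P.hamFlow ν u t l').1 = (Ψ (l'.1, 0)).1 ∧
      ∀ (R' : Euc n →L[ℝ] Euc n) (S' : Euc n →L[ℝ] ℝ),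
        HasMFDerivAt 𝓘(ℝ, Euc n) 𝓘(ℝ, Euc n) (fun q => (Ψ (q, 0)).1) l'.1 R' →
        HasMFDerivAt 𝓘(ℝ, Euc n) 𝓘(ℝ, ℝ) (fun q => (Ψ (q, 0)).2) l'.1 S' →
        CostateRelation ν l'.2 (P.hamFlow ν u t l').2 R' S' := by
  obtain ⟨Φ, hΦ⟩ := IsTrajOn.exists_isFlow (P.smoothSystem_hamVec ν) ht hu hl
  have h1 : Filter.Tendsto (fun l' : CotBundle n M => (l', (0 : Perturb k))) (𝓝 (l 0))
    (𝓝 (l 0, 0)) := Continuous.tendsto (by fun_prop) _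
  have hproj : Continuous (fun l' : CotBundle n M => l'.1) :=
    FiberBundle.continuous_proj (Euc n →L[ℝ] ℝ) _
  have h2 : Filter.Tendsto (fun l' : CotBundle n M => (l'.1, (0 : Perturb k))) (𝓝 (l 0))
    (𝓝 ((l 0).1, 0)) := Continuous.tendsto (by fun_prop) _
  have h3 := (hΨ.eventually_eq_of_isTrajOn P.smoothSystem ht hu)
  filter_upwards [h1.eventually hΦ.traj, h2.eventually h3,
    h2.eventually h3.eventually_nhds] with l' e1 e2 e3
  obtain ⟨η, f1, f2, -⟩ := e1 u (isPerturbation_zero u 0 t)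
  obtain ⟨g1, g2⟩ := isTrajOn_trajectory (X := P.hamField ν u) f1
  rw [f2] at g1 g2
  obtain ⟨Ψ', hΨ', hc⟩ := P.exists_isFlow_costate ht hu g1
  have k1 := (e2 u (isPerturbation_zero u 0 t) _ (P.isTrajOn_proj g1) (congrArg TotalSpace.proj g2)).1
  refine ⟨congrArg Prod.fst k1, fun R' S' hR hS => ?_⟩
  have hb : ((trajectory (cotModel n) (P.hamField ν u) t l' 0).1, (0 : Perturb k)) = (l'.1, 0) := by
    rw [g2]
  have h5 := hΨ'.traj
  rw [hb] at h5
  have h4 : ∀ᶠ q in 𝓝 l'.1, Ψ' (q, 0) = Ψ (q, 0) := by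
    have h6 : Filter.Tendsto (fun q : M => (q, (0 : Perturb k))) (𝓝 l'.1) (𝓝 (l'.1, 0)) :=
      Continuous.tendsto (by fun_prop) _
    filter_upwards [h6.eventually e3, h6.eventually h5] with q h7 h8
    obtain ⟨η', j1, j2, j3, -, j5⟩ := h8 u (isPerturbation_zero u 0 t)
    rw [← (h7 u (isPerturbation_zero u 0 t) η' j1 j2).1]
    exact Prod.ext j3.symm j5.symm
  have h6 := hc R' S'
  rw [g2] at h6
  exact h6 (hR.congr_of_eventuallyEq (h4.mono fun q hq => congrArg Prod.fst hq))
    (hS.congr_of_eventuallyEq (h4.mono fun q hq => congrArg Prod.snd hq))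

theorem ControlProblem.contMDiffAt_hamFlow (ht : 0 ≤ t) (hu : MemLp u ⊤ (resMeas 0 t))
    (hl : IsTrajOn (cotModel n) (P.hamField ν u) 0 t l) :
    ContMDiffAt (cotModel n) (cotModel n) ∞ (P.hamFlow ν u t) (l 0) ∧
      P.hamFlow ν u t (l 0) = l t := by
  obtain ⟨Φ, hΦ⟩ := IsTrajOn.exists_isFlow (P.smoothSystem_hamVec ν) ht hu hl
  have h1 : Filter.Tendsto (fun l' : CotBundle n M => (l', (0 : Perturb k))) (𝓝 (l 0))
    (𝓝 (l 0, 0)) := Continuous.tendsto (by fun_prop) _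
  have h2 : P.hamFlow ν u t =ᶠ[𝓝 (l 0)] fun l' => (Φ (l', 0)).1 := by
    filter_upwards [h1.eventually hΦ.traj, h1.eventually
      (hΦ.eventually_eq_of_isTrajOn (P.smoothSystem_hamVec ν) ht hu)] with l' e1 e2
    obtain ⟨η, f1, f2, -⟩ := e1 u (isPerturbation_zero u 0 t)
    obtain ⟨g1, g2⟩ := isTrajOn_trajectory f1
    rw [f2] at g1 g2
    exact congrArg Prod.fst (e2 u (isPerturbation_zero u 0 t) _ g1 g2).1
  exact ⟨hΦ.contMDiffAt_fst.congr_of_eventuallyEq h2, h2.self_of_nhds.trans hΦ.apply_self⟩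

end HamiltonianFlow

/-! ### Flows in charts -/

section ChartedFlow

variable {n k m : ℕ} {M N : Type*}
  [TopologicalSpace M] [ChartedSpace (Euc n) M] [IsManifold 𝓘(ℝ, Euc n) ∞ M]
  [TopologicalSpace N] [ChartedSpace (Euc m) N] (P : ControlProblem n k m M N)

/-- The end point of the flow `Ψ` in the preferred charts at `q` and `r`. -/
def chartedEnd (Ψ : M × Perturb k → M × ℝ) (q r : M) (x : Euc n) : Euc n :=
  extChartAt 𝓘(ℝ, Euc n) r (Ψ ((extChartAt 𝓘(ℝ, Euc n) q).symm x, 0)).1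

/-- The functional along the flow `Ψ` in the preferred chart at `q`. -/
def chartedCost (Ψ : M × Perturb k → M × ℝ) (q : M) (x : Euc n) : ℝ :=
  (Ψ ((extChartAt 𝓘(ℝ, Euc n) q).symm x, 0)).2

variable {ν : ℝ} {u : ℝ → Euc k} {γ : ℝ → M} {a b t : ℝ} {l : ℝ → CotBundle n M}
  {Ψ : M × Perturb k → M × ℝ} {Y : Euc k → (p : M) → TangentSpace 𝓘(ℝ, Euc n) p}
  {L : Euc k → M → ℝ}

theorem IsFlow.chartedEnd_apply_self (h : IsFlow 𝓘(ℝ, Euc n) Y L u γ a b Ψ) :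
    chartedEnd Ψ (γ a) (γ b) (extChartAt 𝓘(ℝ, Euc n) (γ a) (γ a)) =
      extChartAt 𝓘(ℝ, Euc n) (γ b) (γ b) := by
  rw [chartedEnd, extChartAt_to_inv, h.apply_self]

theorem contMDiffAt_extChartAt_symm_self (q : M) :
    ContMDiffAt 𝓘(ℝ, Euc n) 𝓘(ℝ, Euc n) ∞ (extChartAt 𝓘(ℝ, Euc n) q).symm
      (extChartAt 𝓘(ℝ, Euc n) q q) :=
  (contMDiffOn_extChartAt_symm q).contMDiffAt (extChartAt_target_mem_nhds q)

theorem IsFlow.contDiffAt_chartedEnd (h : IsFlow 𝓘(ℝ, Euc n) Y L u γ a b Ψ) :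
    ContDiffAt ℝ ∞ (chartedEnd Ψ (γ a) (γ b)) (extChartAt 𝓘(ℝ, Euc n) (γ a) (γ a)) := by
  have h1 := h.contMDiffAt_fst
  rw [← extChartAt_to_inv (I := 𝓘(ℝ, Euc n)) (γ a)] at h1
  have h2 := h1.comp _ (contMDiffAt_extChartAt_symm_self (γ a))
  have h3 : ContMDiffAt 𝓘(ℝ, Euc n) 𝓘(ℝ, Euc n) ∞ (extChartAt 𝓘(ℝ, Euc n) (γ b))
      (Ψ ((extChartAt 𝓘(ℝ, Euc n) (γ a)).symm (extChartAt 𝓘(ℝ, Euc n) (γ a) (γ a)), 0)).1 := by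
    rw [extChartAt_to_inv, h.apply_self]
    exact contMDiffAt_extChartAt
  exact (ContMDiffAt.comp (extChartAt 𝓘(ℝ, Euc n) (γ a) (γ a)) h3 h2).contDiffAt

theorem IsFlow.contDiffAt_chartedCost (h : IsFlow 𝓘(ℝ, Euc n) Y L u γ a b Ψ) :
    ContDiffAt ℝ ∞ (chartedCost Ψ (γ a)) (extChartAt 𝓘(ℝ, Euc n) (γ a) (γ a)) := by
  have h1 := h.contMDiffAt_snd
  rw [← extChartAt_to_inv (I := 𝓘(ℝ, Euc n)) (γ a)] at h1
  exact (h1.comp _ (contMDiffAt_extChartAt_symm_self (γ a))).contDiffAt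

theorem fderiv_chartedEnd {q r p : M} (hp : p ∈ (extChartAt 𝓘(ℝ, Euc n) q).source)
    (hd : DifferentiableAt ℝ (chartedEnd Ψ q r) (extChartAt 𝓘(ℝ, Euc n) q p))
    {R' A C : Euc n →L[ℝ] Euc n}
    (hR : HasMFDerivAt 𝓘(ℝ, Euc n) 𝓘(ℝ, Euc n) (fun q => (Ψ (q, 0)).1) p R')
    (hA : HasMFDerivAt 𝓘(ℝ, Euc n) 𝓘(ℝ, Euc n) (extChartAt 𝓘(ℝ, Euc n) q) p A)
    (hC : HasMFDerivAt 𝓘(ℝ, Euc n) 𝓘(ℝ, Euc n) (extChartAt 𝓘(ℝ, Euc n) r) (Ψ (p, 0)).1 C)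
    (w : Euc n) : fderiv ℝ (chartedEnd Ψ q r) (extChartAt 𝓘(ℝ, Euc n) q p) (A w) = C (R' w) := by
  have h1 := HasMFDerivAt.comp (f := fun q => (Ψ (q, 0)).1) p hC hR
  have h2 := HasMFDerivAt.comp p hd.hasFDerivAt.hasMFDerivAt hA
  have h3 := hasMFDerivAt_unique h2 (h1.congr_of_eventuallyEq (by
    filter_upwards [(isOpen_extChartAt_source q).mem_nhds hp] with z hz
    simp only [Function.comp_apply, chartedEnd]
    rw [(extChartAt 𝓘(ℝ, Euc n) q).left_inv hz]))
  exact congrArg (fun A => A w) h3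

theorem fderiv_chartedCost {q p : M} (hp : p ∈ (extChartAt 𝓘(ℝ, Euc n) q).source)
    (hd : DifferentiableAt ℝ (chartedCost Ψ q) (extChartAt 𝓘(ℝ, Euc n) q p))
    {S' : Euc n →L[ℝ] ℝ} {A : Euc n →L[ℝ] Euc n}
    (hS : HasMFDerivAt 𝓘(ℝ, Euc n) 𝓘(ℝ, ℝ) (fun q => (Ψ (q, 0)).2) p S')
    (hA : HasMFDerivAt 𝓘(ℝ, Euc n) 𝓘(ℝ, Euc n) (extChartAt 𝓘(ℝ, Euc n) q) p A)
    (w : Euc n) : fderiv ℝ (chartedCost Ψ q) (extChartAt 𝓘(ℝ, Euc n) q p) (A w) = S' w := by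
  have h2 := HasMFDerivAt.comp p hd.hasFDerivAt.hasMFDerivAt hA
  have h3 := hasMFDerivAt_unique h2 (hS.congr_of_eventuallyEq (by
    filter_upwards [(isOpen_extChartAt_source q).mem_nhds hp] with z hz
    simp only [Function.comp_apply, chartedCost]
    rw [(extChartAt 𝓘(ℝ, Euc n) q).left_inv hz]))
  exact congrArg (fun A => A w) h3

/-- The costate relation in charts. -/
theorem IsFlow.costateRelation_charted (h : IsFlow 𝓘(ℝ, Euc n) Y L u γ a b Ψ)
    {p p' : Euc n →L[ℝ] ℝ}
    (hc : ∀ (R' : Euc n →L[ℝ] Euc n) (S' : Euc n →L[ℝ] ℝ),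
        HasMFDerivAt 𝓘(ℝ, Euc n) 𝓘(ℝ, Euc n) (fun q => (Ψ (q, 0)).1) (γ a) R' →
        HasMFDerivAt 𝓘(ℝ, Euc n) 𝓘(ℝ, ℝ) (fun q => (Ψ (q, 0)).2) (γ a) S' →
        CostateRelation ν p p' R' S') :
    CostateRelation ν p p'
      (fderiv ℝ (chartedEnd Ψ (γ a) (γ b)) (extChartAt 𝓘(ℝ, Euc n) (γ a) (γ a)))
      (fderiv ℝ (chartedCost Ψ (γ a)) (extChartAt 𝓘(ℝ, Euc n) (γ a) (γ a))) := by
  obtain ⟨R₁, hR₁⟩ : ∃ R₁ : Euc n →L[ℝ] Euc n, HasMFDerivAt 𝓘(ℝ, Euc n) 𝓘(ℝ, Euc n)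
    (fun q => (Ψ (q, 0)).1) (γ a) R₁ :=
    ⟨_, (h.contMDiffAt_fst.mdifferentiableAt (by simp)).hasMFDerivAt⟩
  obtain ⟨S₁, hS₁⟩ : ∃ S₁ : Euc n →L[ℝ] ℝ, HasMFDerivAt 𝓘(ℝ, Euc n) 𝓘(ℝ, ℝ)
    (fun q => (Ψ (q, 0)).2) (γ a) S₁ :=
    ⟨_, (h.contMDiffAt_snd.mdifferentiableAt (by simp)).hasMFDerivAt⟩
  have e1 := hR₁.hasFDerivAt_coord
  simp only [h.apply_self] at e1
  have e2 := hS₁.hasFDerivAt_symm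
  have := hc R₁ S₁ hR₁ hS₁
  rw [← e1.fderiv, ← e2.fderiv] at this
  exact this

variable [T2Space M]

theorem ControlProblem.eventually_hamFlow_charted (ht : 0 ≤ t) (hu : MemLp u ⊤ (resMeas 0 t))
    (hl : IsTrajOn (cotModel n) (P.hamField ν u) 0 t l)
    (hΨ : IsFlow 𝓘(ℝ, Euc n) P.f P.L u (fun s => (l s).1) 0 t Ψ) :
    ∀ᶠ y in 𝓝 (extChartAt (cotModel n) (l 0) (l 0)),
      (extChartAt (cotModel n) (l t) (P.hamFlow ν u t
        ((extChartAt (cotModel n) (l 0)).symm y))).1 = chartedEnd Ψ (l 0).1 (l t).1 y.1 ∧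
      (extChartAt (cotModel n) (l t) (P.hamFlow ν u t
        ((extChartAt (cotModel n) (l 0)).symm y))).2.comp
          (fderiv ℝ (chartedEnd Ψ (l 0).1 (l t).1) y.1) -
        fderiv ℝ (fun x => ν • chartedCost Ψ (l 0).1 x) y.1 = y.2 := by
  obtain ⟨hΦ1, hΦ2⟩ := P.contMDiffAt_hamFlow ht hu hl
  have c1 : Filter.Tendsto (extChartAt (cotModel n) (l 0)).symm
      (𝓝 (extChartAt (cotModel n) (l 0) (l 0))) (𝓝 (l 0)) := by
    have := continuousAt_extChartAt_symm (I := cotModel n) (l 0)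
    rwa [ContinuousAt, extChartAt_to_inv] at this
  have hproj : Continuous (fun l' : CotBundle n M => l'.1) :=
    FiberBundle.continuous_proj (Euc n →L[ℝ] ℝ) _
  have e1 := c1.eventually (P.eventually_hamFlow ht hu hl hΨ)
  have e2 : ∀ᶠ l' in 𝓝 (l 0), P.hamFlow ν u t l' ∈ (extChartAt (cotModel n) (l t)).source := by
    refine hΦ1.continuousAt.eventually ?_
    rw [hΦ2]
    exact extChartAt_source_mem_nhds (l t)
  have c3 : Filter.Tendsto (fun y : PhaseSpace n => y.1)
      (𝓝 (extChartAt (cotModel n) (l 0) (l 0))) (𝓝 (extChartAt 𝓘(ℝ, Euc n) (l 0).1 (l 0).1)) := by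
    rw [← extChartAt_cot_fst]
    exact continuous_fst.tendsto _
  have e3 := c3.eventually (contDiffAt_infty.1 hΨ.contDiffAt_chartedEnd 2).eventually_differentiableAt
  have e4 := c3.eventually (contDiffAt_infty.1 hΨ.contDiffAt_chartedCost 2).eventually_differentiableAt
  have c5 : Filter.Tendsto (fun l' : CotBundle n M => l'.1) (𝓝 (l 0)) (𝓝 (l 0).1) :=
    hproj.tendsto _
  have hM : IsManifold 𝓘(ℝ, Euc n) 1 M := IsManifold.of_le (n := ∞) (by norm_num)
  have e5 : ∀ᶠ q in 𝓝 (l 0).1,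
      ContMDiffAt 𝓘(ℝ, Euc n) 𝓘(ℝ, Euc n) 1 (fun q => (Ψ (q, 0)).1) q :=
    (contMDiffAt_iff_contMDiffAt_nhds (by simp)).1 (hΨ.contMDiffAt_fst.of_le (by norm_num))
  have e6 : ∀ᶠ q in 𝓝 (l 0).1,
      ContMDiffAt 𝓘(ℝ, Euc n) 𝓘(ℝ, ℝ) 1 (fun q => (Ψ (q, 0)).2) q :=
    (contMDiffAt_iff_contMDiffAt_nhds (by simp)).1 (hΨ.contMDiffAt_snd.of_le (by norm_num))
  filter_upwards [e1, c1.eventually e2, e3, e4, (c5.comp c1).eventually e5,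
    (c5.comp c1).eventually e6, extChartAt_target_mem_nhds (I := cotModel n) (l 0)]
    with y h1 h2 h3 h4 h5 h6 hy
  obtain ⟨l', hl', hyl⟩ : ∃ l', l' ∈ (extChartAt (cotModel n) (l 0)).source ∧
      y = extChartAt (cotModel n) (l 0) l' :=
    ⟨_, (extChartAt (cotModel n) (l 0)).map_target hy,
      ((extChartAt (cotModel n) (l 0)).right_inv hy).symm⟩
  simp only [Function.comp_apply] at h5 h6
  rw [hyl, extChartAt_cot_fst] at h3 h4
  rw [hyl, (extChartAt (cotModel n) (l 0)).left_inv hl'] at h1 h2 h5 h6 ⊢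
  have hp := mem_extChartAt_cot_source.1 hl'
  have hr := mem_extChartAt_cot_source.1 h2
  have hp' := hp
  have hr' := hr
  rw [extChartAt_source] at hp' hr'
  rw [extChartAt_cot_fst, extChartAt_cot_fst]
  refine ⟨by rw [chartedEnd, (extChartAt 𝓘(ℝ, Euc n) (l 0).1).left_inv hp, h1.1], ?_⟩
  obtain ⟨R₁, hR₁⟩ : ∃ R₁ : Euc n →L[ℝ] Euc n, HasMFDerivAt 𝓘(ℝ, Euc n) 𝓘(ℝ, Euc n)
    (fun q => (Ψ (q, 0)).1) l'.1 R₁ := ⟨_, (h5.mdifferentiableAt (by simp)).hasMFDerivAt⟩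
  obtain ⟨S₁, hS₁⟩ : ∃ S₁ : Euc n →L[ℝ] ℝ, HasMFDerivAt 𝓘(ℝ, Euc n) 𝓘(ℝ, ℝ)
    (fun q => (Ψ (q, 0)).2) l'.1 S₁ := ⟨_, (h6.mdifferentiableAt (by simp)).hasMFDerivAt⟩
  obtain ⟨A, hA, hA', hAs⟩ : ∃ A : Euc n →L[ℝ] Euc n, HasMFDerivAt 𝓘(ℝ, Euc n) 𝓘(ℝ, Euc n)
    (extChartAt 𝓘(ℝ, Euc n) (l 0).1) l'.1 A ∧ (∀ w,
    (extChartAt (cotModel n) (l 0) l').2 (A w) = l'.2 w) ∧ ∀ y, ∃ w, A w = y :=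
    ⟨_, (mdifferentiableAt_extChartAt hp').hasMFDerivAt, extChartAt_cot_snd _ _ hp,
      surjective_mfderiv_extChartAt hp⟩
  obtain ⟨C, hC, hC'⟩ : ∃ A : Euc n →L[ℝ] Euc n, HasMFDerivAt 𝓘(ℝ, Euc n) 𝓘(ℝ, Euc n)
    (extChartAt 𝓘(ℝ, Euc n) (l t).1) (P.hamFlow ν u t l').1 A ∧ ∀ w,
    (extChartAt (cotModel n) (l t) (P.hamFlow ν u t l')).2 (A w) = (P.hamFlow ν u t l').2 w :=
    ⟨_, (mdifferentiableAt_extChartAt hr').hasMFDerivAt, extChartAt_cot_snd _ _ hr⟩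
  rw [h1.1] at hC
  ext w'
  obtain ⟨w, rfl⟩ := hAs w'
  have g1 := fderiv_chartedEnd hp h3 hR₁ hA hC w
  have g2 := fderiv_chartedCost hp h4 hS₁ hA w
  have g3 := h1.2 R₁ S₁ hR₁ hS₁ w
  have g4 : fderiv ℝ (fun x => ν • chartedCost Ψ (l 0).1 x)
      (extChartAt 𝓘(ℝ, Euc n) (l 0).1 l'.1) = ν • fderiv ℝ (chartedCost Ψ (l 0).1)
      (extChartAt 𝓘(ℝ, Euc n) (l 0).1 l'.1) := fderiv_const_smul h4 ν
  rw [g4, hA', _root_.sub_apply, ContinuousLinearMap.comp_apply, _root_.smul_apply, g1, g2]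
  exact (congrArg (· - ν * S₁ w) (hC' (R₁ w))).trans g3

/-- The differential of the Hamiltonian flow in terms of the flow of the control. -/
theorem ControlProblem.hamFlowDeriv_relation (ht : 0 ≤ t) (hu : MemLp u ⊤ (resMeas 0 t))
    (hl : IsTrajOn (cotModel n) (P.hamField ν u) 0 t l)
    (hΨ : IsFlow 𝓘(ℝ, Euc n) P.f P.L u (fun s => (l s).1) 0 t Ψ) (a : PhaseSpace n) :
    (P.hamFlowDeriv ν u t (l 0) a).1 = fderiv ℝ (chartedEnd Ψ (l 0).1 (l t).1)
      (extChartAt 𝓘(ℝ, Euc n) (l 0).1 (l 0).1) a.1 ∧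
    ∀ w, (P.hamFlowDeriv ν u t (l 0) a).2 (fderiv ℝ (chartedEnd Ψ (l 0).1 (l t).1)
      (extChartAt 𝓘(ℝ, Euc n) (l 0).1 (l 0).1) w) +
      hessForm (l t).2 ν (chartedEnd Ψ (l 0).1 (l t).1) (chartedCost Ψ (l 0).1)
        (extChartAt 𝓘(ℝ, Euc n) (l 0).1 (l 0).1) a.1 w = a.2 w := by
  obtain ⟨hΦ1, hΦ2⟩ := P.contMDiffAt_hamFlow ht hu hl
  have h1 : HasMFDerivAt (cotModel n) (cotModel n) (P.hamFlow ν u t) (l 0)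
    (P.hamFlowDeriv ν u t (l 0)) := (hΦ1.mdifferentiableAt (by simp)).hasMFDerivAt
  have h2 := h1.hasFDerivAt_coord
  rw [hΦ2] at h2
  have hR := contDiffAt_infty.1 hΨ.contDiffAt_chartedEnd 2
  have hS := contDiffAt_infty.1 hΨ.contDiffAt_chartedCost 2
  have e0 := extChartAt_cot_fst (l 0) (l 0)
  have h3 := relation_fderiv h2 (by rwa [e0]) (S := fun x => ν • chartedCost Ψ (l 0).1 x)
    (by rw [e0]; exact hS.const_smul ν) (P.eventually_hamFlow_charted ht hu hl hΨ) a
  rw [e0, extChartAt_to_inv, hΦ2] at h3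
  refine ⟨h3.1, fun w => ?_⟩
  have h4 := h3.2 w
  have h5 : (extChartAt (cotModel n) (l t) (l t)).2 = (l t).2 := by
    ext w
    have := extChartAt_cot_snd (l t) (l t) (mem_extChartAt_source _) w
    rw [mfderiv_extChartAt_self] at this
    exact this
  have h6 : fderiv ℝ (fderiv ℝ (fun x => ν • chartedCost Ψ (l 0).1 x))
      (extChartAt 𝓘(ℝ, Euc n) (l 0).1 (l 0).1) = ν • fderiv ℝ (fderiv ℝ (chartedCost Ψ (l 0).1))
      (extChartAt 𝓘(ℝ, Euc n) (l 0).1 (l 0).1) := by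
    rw [← fderiv_const_smul hS.differentiableAt_fderiv]
    refine Filter.EventuallyEq.fderiv_eq ?_
    filter_upwards [hS.eventually_differentiableAt] with x hx
    exact fderiv_const_smul hx ν
  rw [h5, h6] at h4
  exact (add_sub_assoc _ _ _).symm.trans h4

theorem ControlProblem.injective_fderiv_chartedEnd (ht : 0 ≤ t) (hu : MemLp u ⊤ (resMeas 0 t))
    (hl : IsTrajOn (cotModel n) (P.hamField ν u) 0 t l)
    (hΨ : IsFlow 𝓘(ℝ, Euc n) P.f P.L u (fun s => (l s).1) 0 t Ψ) :
    Function.Injective (fderiv ℝ (chartedEnd Ψ (l 0).1 (l t).1)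
      (extChartAt 𝓘(ℝ, Euc n) (l 0).1 (l 0).1)) := by
  refine (injective_iff_map_eq_zero _).2 fun w hw => ?_
  ext i
  have h1 := (P.hamFlowDeriv_relation ht hu hl hΨ (0, EuclideanSpace.proj i)).2 w
  rw [hw] at h1
  simpa using h1.symm

theorem ControlProblem.ker_hamFlowDeriv (ht : 0 ≤ t) (hu : MemLp u ⊤ (resMeas 0 t))
    (hl : IsTrajOn (cotModel n) (P.hamField ν u) 0 t l)
    (hΨ : IsFlow 𝓘(ℝ, Euc n) P.f P.L u (fun s => (l s).1) 0 t Ψ) :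
    LinearMap.ker (P.hamFlowDeriv ν u t (l 0)).toLinearMap = ⊥ := by
  refine LinearMap.ker_eq_bot'.2 fun a ha => ?_
  have ha' : P.hamFlowDeriv ν u t (l 0) a = 0 := ha
  obtain ⟨h1, h2⟩ := P.hamFlowDeriv_relation ht hu hl hΨ a
  rw [ha'] at h1 h2
  have h3 : a.1 = 0 := P.injective_fderiv_chartedEnd ht hu hl hΨ
    (by rw [← h1, map_zero]; rfl)
  refine Prod.ext h3 ?_
  ext w
  rw [← h2 w, h3]
  simp

end ChartedFlow

/-! ### Truncation of variations -/

section Truncation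

open Filter

/-- If `𝔽(z, ϑ) = F(z - m_ϑ z)`, then the first and second differentials of `F` vanish on
`m_ϑ z` in the limit `ϑ → 0`. -/
theorem tendsto_fderiv_of_truncation {Z Θ G ι : Type*} [NormedAddCommGroup Z] [NormedSpace ℝ Z]
    [NormedAddCommGroup Θ] [NormedSpace ℝ Θ] [NormedAddCommGroup G] [NormedSpace ℝ G]
    {𝔽 : Z × Θ → G} (h𝔽 : ContDiffAt ℝ ∞ 𝔽 (0, 0)) {F : Z → G} (hF : ContDiffAt ℝ 2 F 0)
    {𝓁 : Filter ι} {ϑ : ι → Θ} (hϑ : Tendsto ϑ 𝓁 (𝓝 0)) {μ : ι → Z →L[ℝ] Z}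
    (hμ : ∀ s z, ‖μ s z‖ ≤ ‖z‖) (hμμ : ∀ s z, μ s (μ s z) = μ s z)
    (h : ∀ᶠ s in 𝓁, ∀ᶠ z in 𝓝 0, 𝔽 (z, ϑ s) = F (z - μ s z))
    (h0 : ∀ᶠ z in 𝓝 0, 𝔽 (z, 0) = F z) (z : Z) {w : ι → Z} {C : ℝ} (hw : ∀ s, ‖w s‖ ≤ C) :
    Tendsto (fun s => fderiv ℝ F 0 (μ s z)) 𝓁 (𝓝 0) ∧
    Tendsto (fun s => fderiv ℝ (fderiv ℝ F) 0 (μ s z) (w s)) 𝓁 (𝓝 0) := by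
  let inl := ContinuousLinearMap.inl ℝ Z Θ
  have hpt : Tendsto (fun s => ((0 : Z), ϑ s)) 𝓁 (𝓝 (0, 0)) := tendsto_const_nhds.prodMk_nhds hϑ
  have h2 := contDiffAt_infty.1 h𝔽 2
  have hC2 : ∀ᶠ p in 𝓝 ((0 : Z), (0 : Θ)), ContDiffAt ℝ 2 𝔽 p := h2.eventually (by norm_num)
  have key : ∀ θ : Θ, ContDiffAt ℝ 2 𝔽 (0, θ) → (∀ v, fderiv ℝ (fun z => 𝔽 (z, θ)) 0 v =
      fderiv ℝ 𝔽 (0, θ) (v, 0)) ∧ ∀ v w, fderiv ℝ (fderiv ℝ fun z => 𝔽 (z, θ)) 0 v w =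
      fderiv ℝ (fderiv ℝ 𝔽) (0, θ) (v, 0) (w, 0) := by
    intro θ hθ
    have i1 : ∀ z, HasFDerivAt (fun z : Z => (z, θ)) inl z := fun z => hasFDerivAt_prodMk_left z θ
    have i2 : fderiv ℝ (fun z : Z => (z, θ)) = fun _ => inl := funext fun z => (i1 z).fderiv
    have i3 : ContDiffAt ℝ 2 (fun z : Z => (z, θ)) 0 := contDiffAt_id.prodMk contDiffAt_const
    refine ⟨fun v => ?_, fun v w => ?_⟩
    · exact congrArg (fun A => A v)
        (HasFDerivAt.comp (0 : Z) (hθ.differentiableAt (by norm_num)).hasFDerivAt (i1 0)).fderiv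
    · rw [fderiv_fderiv_comp (f := fun z : Z => (z, θ)) hθ i3, i2]
      simp [inl]
  have key' : ∀ s, ContDiffAt ℝ 2 𝔽 (0, ϑ s) → (∀ᶠ z in 𝓝 0, 𝔽 (z, ϑ s) = F (z - μ s z)) →
      (∀ v, fderiv ℝ 𝔽 (0, ϑ s) (v, 0) = fderiv ℝ F 0 (v - μ s v)) ∧ ∀ v w,
      fderiv ℝ (fderiv ℝ 𝔽) (0, ϑ s) (v, 0) (w, 0) =
        fderiv ℝ (fderiv ℝ F) 0 (v - μ s v) (w - μ s w) := by
    intro s hs hs'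
    let e : Z →L[ℝ] Z := ContinuousLinearMap.id ℝ Z - μ s
    have hs2 : (fun z => 𝔽 (z, ϑ s)) =ᶠ[𝓝 0] fun z => F (e z) := hs'
    have he : e 0 = 0 := map_zero e
    obtain ⟨k1, k2⟩ := key _ hs
    refine ⟨fun v => ?_, fun v w => ?_⟩
    · rw [← k1, hs2.fderiv_eq, fderiv_comp_clm e (by rw [he]; exact hF.differentiableAt (by norm_num)), he]
      rfl
    · rw [← k2, hs2.fderiv.fderiv_eq, fderiv_fderiv_comp_clm e (by rwa [he]), he]
      rfl
  have key0 : (∀ v, fderiv ℝ F 0 v = fderiv ℝ 𝔽 (0, 0) (v, 0)) ∧ ∀ v w,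
      fderiv ℝ (fderiv ℝ F) 0 v w = fderiv ℝ (fderiv ℝ 𝔽) (0, 0) (v, 0) (w, 0) := by
    obtain ⟨k1, k2⟩ := key 0 h2
    have h0' : (fun z => 𝔽 (z, 0)) =ᶠ[𝓝 0] F := h0
    exact ⟨fun v => by rw [← k1, h0'.fderiv_eq], fun v w => by rw [← k2, h0'.fderiv.fderiv_eq]⟩
  have hD1 : Tendsto (fun s => ‖fderiv ℝ 𝔽 (0, ϑ s) - fderiv ℝ 𝔽 (0, 0)‖ * ‖z‖) 𝓁 (𝓝 0) := by
    have := ((h2.fderiv_right (m := 1) (by norm_num)).continuousAt.tendsto.comp hpt).sub_const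
      (fderiv ℝ 𝔽 (0, 0))
    rw [sub_self] at this
    simpa using this.norm.mul_const ‖z‖
  have hD2 : Tendsto (fun s => ‖fderiv ℝ (fderiv ℝ 𝔽) (0, ϑ s) - fderiv ℝ (fderiv ℝ 𝔽) (0, 0)‖ *
      ‖z‖ * C) 𝓁 (𝓝 0) := by
    have h3 := contDiffAt_infty.1 h𝔽 3
    have := ((((h3.fderiv_right (m := 2) (by norm_num)).fderiv_right (m := 1)
      (by norm_num)).continuousAt.tendsto.comp hpt).sub_const (fderiv ℝ (fderiv ℝ 𝔽) (0, 0)))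
    rw [sub_self] at this
    simpa using (this.norm.mul_const ‖z‖).mul_const C
  have hpair : ∀ z : Z, ‖((z, 0) : Z × Θ)‖ = ‖z‖ := fun z => by simp [Prod.norm_def]
  constructor
  · refine squeeze_zero_norm' ?_ hD1
    filter_upwards [h, hpt.eventually hC2] with s hs hs2
    have e1 := (key' s hs2 hs).1 (μ s z)
    rw [hμμ, sub_self, map_zero] at e1
    have e2 : fderiv ℝ F 0 (μ s z) =
        -((fderiv ℝ 𝔽 (0, ϑ s) - fderiv ℝ 𝔽 (0, 0)) (μ s z, 0)) := by
      rw [_root_.sub_apply, e1, key0.1]; simp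
    rw [e2, norm_neg]
    refine (ContinuousLinearMap.le_opNorm _ _).trans ?_
    rw [hpair]
    exact mul_le_mul_of_nonneg_left (hμ s z) (norm_nonneg _)
  · refine squeeze_zero_norm' ?_ hD2
    filter_upwards [h, hpt.eventually hC2] with s hs hs2
    have e1 := (key' s hs2 hs).2 (μ s z) (w s)
    rw [hμμ, sub_self, map_zero] at e1
    have e2 : fderiv ℝ (fderiv ℝ F) 0 (μ s z) (w s) =
        -((fderiv ℝ (fderiv ℝ 𝔽) (0, ϑ s) - fderiv ℝ (fderiv ℝ 𝔽) (0, 0)) (μ s z, 0) (w s, 0)) := by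
      rw [_root_.sub_apply, _root_.sub_apply, e1, key0.2]; simp
    rw [e2, norm_neg]
    refine (ContinuousLinearMap.le_opNorm₂ _ _ _).trans ?_
    rw [hpair, hpair]
    gcongr
    · exact hμ s z
    · exact hw s

end Truncation

section ExtendTop

variable {α : Type*} [MeasurableSpace α] {μ : Measure α} {k : ℕ}

/-- Extension by zero of essentially bounded functions, as a linear map. -/
def extendTopLinear (μ : Measure α) (k : ℕ) {S : Set α} (hS : MeasurableSet S) :
    Lp (Euc k) ⊤ (μ.restrict S) →ₗ[ℝ] Lp (Euc k) ⊤ μ where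
  toFun v := ((memLp_indicator_iff_restrict hS).2 (Lp.memLp v)).toLp (S.indicator v)
  map_add' v w := by
    rw [← MemLp.toLp_add]
    refine MemLp.toLp_congr _ _ ?_
    rw [← indicator_add']
    exact (ae_eq_restrict_iff_indicator_ae_eq hS).1 (Lp.coeFn_add v w)
  map_smul' c v := by
    rw [RingHom.id_apply, ← MemLp.toLp_const_smul]
    refine MemLp.toLp_congr _ _ ?_
    refine ((ae_eq_restrict_iff_indicator_ae_eq hS).1 (Lp.coeFn_smul c v)).trans (.of_eq ?_)
    exact indicator_const_smul S c v

theorem coeFn_extendTopLinear {S : Set α} (hS : MeasurableSet S)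
    (v : Lp (Euc k) ⊤ (μ.restrict S)) : extendTopLinear μ k hS v =ᵐ[μ] S.indicator v :=
  ((memLp_indicator_iff_restrict hS).2 (Lp.memLp v)).coeFn_toLp

theorem norm_extendTopLinear {S : Set α} (hS : MeasurableSet S)
    (v : Lp (Euc k) ⊤ (μ.restrict S)) : ‖extendTopLinear μ k hS v‖ = ‖v‖ := by
  rw [Lp.norm_def, Lp.norm_def, eLpNorm_congr_ae (coeFn_extendTopLinear hS v),
    eLpNorm_indicator_eq_eLpNorm_restrict hS]

/-- Extension by zero of essentially bounded functions. -/
def extendTop (μ : Measure α) (k : ℕ) {S : Set α} (hS : MeasurableSet S) :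
    Lp (Euc k) ⊤ (μ.restrict S) →L[ℝ] Lp (Euc k) ⊤ μ :=
  (extendTopLinear μ k hS).mkContinuous 1 fun v => by rw [norm_extendTopLinear, one_mul]

theorem coeFn_extendTop {S : Set α} (hS : MeasurableSet S) (v : Lp (Euc k) ⊤ (μ.restrict S)) :
    extendTop μ k hS v =ᵐ[μ] S.indicator v :=
  coeFn_extendTopLinear hS v

/-- Multiplication of essentially bounded functions by an indicator function. -/
def truncTop (μ : Measure α) (k : ℕ) {S : Set α} (hS : MeasurableSet S) :
    Lp (Euc k) ⊤ μ →L[ℝ] Lp (Euc k) ⊤ μ :=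
  (extendTop μ k hS).comp (LpToLpRestrictCLM α (Euc k) ℝ μ ⊤ S)

theorem coeFn_truncTop {S : Set α} (hS : MeasurableSet S) (v : Lp (Euc k) ⊤ μ) :
    truncTop μ k hS v =ᵐ[μ] S.indicator v :=
  (coeFn_extendTop hS _).trans ((ae_eq_restrict_iff_indicator_ae_eq hS).1
    (LpToLpRestrictCLM_coeFn ℝ S v))

theorem truncTop_truncTop {S : Set α} (hS : MeasurableSet S) (v : Lp (Euc k) ⊤ μ) :
    truncTop μ k hS (truncTop μ k hS v) = truncTop μ k hS v := by
  refine Lp.ext ?_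
  filter_upwards [coeFn_truncTop hS (truncTop μ k hS v), coeFn_truncTop hS v] with x h1 h2
  rw [h1]
  by_cases hx : x ∈ S
  · rw [indicator_of_mem hx]
  · rw [indicator_of_notMem hx, h2, indicator_of_notMem hx]

theorem norm_truncTop_le {S : Set α} (hS : MeasurableSet S) (v : Lp (Euc k) ⊤ μ) :
    ‖truncTop μ k hS v‖ ≤ ‖v‖ := by
  refine Lp.norm_le_norm_of_ae_le ?_
  filter_upwards [coeFn_truncTop hS v] with x h1
  rw [h1]
  exact norm_indicator_le_norm_self _ _

end ExtendTop

/-! ### End-point maps and flows -/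

section EndPointMaps

open Filter

variable {n k m : ℕ} {M N : Type*}
  [TopologicalSpace M] [ChartedSpace (Euc n) M] [IsManifold 𝓘(ℝ, Euc n) ∞ M]
  [TopologicalSpace N] [ChartedSpace (Euc m) N] (P : ControlProblem n k m M N)

/-- Variations of the initial point and of the control on the whole time axis. -/
abbrev ControlVar (k m : ℕ) := Euc m × Lp (Euc k) ⊤ (volume : Measure ℝ)

/-- Extension by zero of the variations on `[0, t]`. -/
def extendVar (k m : ℕ) (t : ℝ) : ControlProblem.Variations k m t →L[ℝ] ControlVar k m :=
  (ContinuousLinearMap.id ℝ (Euc m)).prodMap (extendTop volume k measurableSet_Icc)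

theorem coeFn_extendVar {t : ℝ} (v : ControlProblem.Variations k m t) :
    (extendVar k m t v).2 =ᵐ[volume] (Icc 0 t).indicator v.2 :=
  coeFn_extendTop measurableSet_Icc v.2

/-- The perturbed initial data: `(1 - ϑ) v` is the variation of the control. -/
def ControlProblem.perturbedPoint (x₀ : N) (z : ControlVar k m × Lp ℝ 1 (volume : Measure ℝ)) :
    M × Perturb k :=
  (P.initialPoint x₀ z.1.1, (z.2, z.1.2))

variable {ν : ℝ} {u : ℝ → Euc k} {γ : ℝ → M} {a b c t T : ℝ} {Ψ Ψ' Ψ'' : M × Perturb k → M × ℝ}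
  {Y : Euc k → (p : M) → TangentSpace 𝓘(ℝ, Euc n) p} {L : Euc k → M → ℝ} {x₀ : N}

theorem ControlProblem.initialPoint_zero : P.initialPoint x₀ 0 = P.ι x₀ := by
  rw [initialPoint, add_zero, extChartAt_to_inv]

variable [IsManifold 𝓘(ℝ, Euc m) ∞ N]

theorem ControlProblem.contMDiffAt_initialPoint :
    ContMDiffAt 𝓘(ℝ, Euc m) 𝓘(ℝ, Euc n) ∞ (P.initialPoint x₀) 0 := by
  have h1 : ContMDiffAt 𝓘(ℝ, Euc m) 𝓘(ℝ, Euc m) ∞ (extChartAt 𝓘(ℝ, Euc m) x₀).symm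
      (extChartAt 𝓘(ℝ, Euc m) x₀ x₀ + 0) := by
    rw [add_zero]
    exact (contMDiffOn_extChartAt_symm x₀).contMDiffAt (extChartAt_target_mem_nhds x₀)
  have h2 : ContMDiffAt 𝓘(ℝ, Euc m) 𝓘(ℝ, Euc m) ∞
      (fun ζ : Euc m => extChartAt 𝓘(ℝ, Euc m) x₀ x₀ + ζ) 0 :=
    (contDiffAt_const.add contDiffAt_id).contMDiffAt
  exact P.embedding_ι.contMDiff.contMDiffAt.comp (0 : Euc m) (ContMDiffAt.comp (0 : Euc m) h1 h2)

theorem ControlProblem.contMDiffAt_perturbedPoint :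
    ContMDiffAt 𝓘(ℝ, ControlVar k m × Lp ℝ 1 (volume : Measure ℝ))
      (𝓘(ℝ, Euc n).prod 𝓘(ℝ, Perturb k)) ∞ (P.perturbedPoint x₀) 0 := by
  refine ContMDiffAt.prodMk ?_ ?_
  · exact ContMDiffAt.comp (0 : ControlVar k m × Lp ℝ 1 (volume : Measure ℝ))
      (g := P.initialPoint x₀) P.contMDiffAt_initialPoint
      (contDiff_fst.comp contDiff_fst).contDiffAt.contMDiffAt
  · exact (contDiff_snd.prodMk (contDiff_snd.comp contDiff_fst)).contDiffAt.contMDiffAt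

theorem ControlProblem.perturbedPoint_zero : P.perturbedPoint x₀ 0 = (P.ι x₀, 0) :=
  Prod.ext P.initialPoint_zero rfl

theorem ControlProblem.tendsto_perturbedPoint (hx₀ : P.ι x₀ = γ a) :
    Tendsto (P.perturbedPoint x₀) (𝓝 0) (𝓝 (γ a, 0)) := by
  have := (P.contMDiffAt_perturbedPoint (x₀ := x₀)).continuousAt
  rwa [ContinuousAt, P.perturbedPoint_zero, hx₀] at this

/-- The end-point map of a flow in the coordinates of the perturbed initial data. -/
def ControlProblem.flowEndMap (Ψ : M × Perturb k → M × ℝ) (x₀ : N) (r : M)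
    (z : ControlVar k m × Lp ℝ 1 (volume : Measure ℝ)) : Euc n :=
  extChartAt 𝓘(ℝ, Euc n) r (Ψ (P.perturbedPoint x₀ z)).1

/-- The functional along a flow in the coordinates of the perturbed initial data. -/
def ControlProblem.flowCostMap (Ψ : M × Perturb k → M × ℝ) (x₀ : N)
    (z : ControlVar k m × Lp ℝ 1 (volume : Measure ℝ)) : ℝ :=
  (Ψ (P.perturbedPoint x₀ z)).2

theorem ControlProblem.contDiffAt_flowEndMap (h : IsFlow 𝓘(ℝ, Euc n) Y L u γ a b Ψ)
    (hx₀ : P.ι x₀ = γ a) : ContDiffAt ℝ ∞ (P.flowEndMap Ψ x₀ (γ b)) 0 := by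
  have h1 := h.smooth
  rw [← hx₀, ← P.perturbedPoint_zero] at h1
  have h2 := h1.comp _ P.contMDiffAt_perturbedPoint
  have h3 : ContMDiffAt 𝓘(ℝ, Euc n) 𝓘(ℝ, Euc n) ∞ (extChartAt 𝓘(ℝ, Euc n) (γ b))
      (Ψ (P.perturbedPoint x₀ 0)).1 := by
    rw [P.perturbedPoint_zero, hx₀, h.apply_self]
    exact contMDiffAt_extChartAt
  exact (ContMDiffAt.comp (0 : ControlVar k m × Lp ℝ 1 (volume : Measure ℝ)) h3
    (_root_.contMDiffAt_fst.comp (0 : ControlVar k m × Lp ℝ 1 (volume : Measure ℝ)) h2)).contDiffAt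

theorem ControlProblem.contDiffAt_flowCostMap (h : IsFlow 𝓘(ℝ, Euc n) Y L u γ a b Ψ)
    (hx₀ : P.ι x₀ = γ a) : ContDiffAt ℝ ∞ (P.flowCostMap Ψ x₀) 0 := by
  have h1 := h.smooth
  rw [← hx₀, ← P.perturbedPoint_zero] at h1
  have h2 := h1.comp _ P.contMDiffAt_perturbedPoint
  exact (_root_.contMDiffAt_snd.comp
    (0 : ControlVar k m × Lp ℝ 1 (volume : Measure ℝ)) h2).contDiffAt

theorem tendsto_extendVar_prod (k m : ℕ) (t : ℝ) :
    Tendsto (fun v : ControlProblem.Variations k m t =>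
      (extendVar k m t v, (0 : Lp ℝ 1 (volume : Measure ℝ)))) (𝓝 0) (𝓝 0) := by
  have : Continuous (fun v : ControlProblem.Variations k m t =>
      (extendVar k m t v, (0 : Lp ℝ 1 (volume : Measure ℝ)))) :=
    (extendVar k m t).continuous.prodMk continuous_const
  exact this.tendsto' 0 0 (by simp)

theorem ControlProblem.isPerturbation_extendVar (v : ControlProblem.Variations k m t) :
    IsPerturbation u (P.perturbedPoint x₀ (extendVar k m t v, 0)).2 a b
      (fun τ => u τ + (Icc 0 t).indicator v.2 τ) := by
  filter_upwards [ae_restrict_of_ae (coeFn_extendVar v),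
    ae_restrict_of_ae (Lp.coeFn_zero ℝ 1 volume)] with τ h1 h2
  have e1 : (P.perturbedPoint x₀ (extendVar k m t v, 0)).2.1 τ = 0 := h2
  have e2 : (P.perturbedPoint x₀ (extendVar k m t v, 0)).2.2 τ = (Icc 0 t).indicator v.2 τ := h1
  rw [e1, e2]
  simp

theorem IsPerturbation.congr {v : Perturb k} {w w' : ℝ → Euc k} (h : IsPerturbation u v a b w)
    (hw : w =ᵐ[resMeas a b] w') : IsPerturbation u v a b w' := by
  filter_upwards [h, hw] with τ h1 h2
  rwa [← h2]

variable [T2Space M]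

/-- The end-point map and the functional are given by the flow. -/
theorem ControlProblem.endPointMap_eventuallyEq (ht : 0 ≤ t) (hu : MemLp u ⊤ (resMeas 0 t))
    (h : IsFlow 𝓘(ℝ, Euc n) P.f P.L u γ 0 t Ψ) (hx₀ : P.ι x₀ = γ 0) (r : M) :
    ∀ᶠ v in 𝓝 0, P.endPointMap x₀ u t r v = P.flowEndMap Ψ x₀ r (extendVar k m t v, 0) ∧
      P.costMap x₀ u t v = P.flowCostMap Ψ x₀ (extendVar k m t v, 0) := by
  have h1 := (P.tendsto_perturbedPoint hx₀).comp (tendsto_extendVar_prod k m t)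
  filter_upwards [h1.eventually h.traj,
    h1.eventually (h.eventually_eq_of_isTrajOn P.smoothSystem ht hu)] with v e1 e2
  have hw : IsPerturbation u (P.perturbedPoint x₀ (extendVar k m t v, 0)).2 0 t
      (fun τ => u τ + v.2 τ) := by
    refine (P.isPerturbation_extendVar v).congr ?_
    filter_upwards [ae_restrict_mem measurableSet_Icc] with τ hτ
    rw [indicator_of_mem hτ]
  obtain ⟨η, f1, f2, -⟩ := e1 _ hw
  obtain ⟨g1, g2⟩ := isTrajOn_trajectory (X := fun τ q => P.f (u τ + v.2 τ) q) f1
  have f3 : η 0 = P.initialPoint x₀ v.1 := f2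
  rw [f3] at g1 g2
  have h3 := (e2 _ hw _ g1 g2).1
  constructor
  · exact congrArg (fun p : M × ℝ => extChartAt 𝓘(ℝ, Euc n) r p.1) h3
  · exact congrArg Prod.snd h3

theorem IsFlow.eventually_chartedEnd (hS : SmoothSystem 𝓘(ℝ, Euc n) Y L) (hab : a ≤ b)
    (hbc : b ≤ c) (hu : MemLp u ⊤ (resMeas a c)) (h : IsFlow 𝓘(ℝ, Euc n) Y L u γ a b Ψ)
    (h' : IsFlow 𝓘(ℝ, Euc n) Y L u γ b c Ψ') (h'' : IsFlow 𝓘(ℝ, Euc n) Y L u γ a c Ψ'') :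
    ∀ᶠ z in 𝓝 (γ a, 0), (∃ w, IsPerturbation u z.2 a c w ∧ IsPerturbation u 0 b c w) →
      extChartAt 𝓘(ℝ, Euc n) (γ c) (Ψ'' z).1 =
        chartedEnd Ψ' (γ b) (γ c) (extChartAt 𝓘(ℝ, Euc n) (γ b) (Ψ z).1) ∧
      (Ψ'' z).2 = (Ψ z).2 + chartedCost Ψ' (γ b) (extChartAt 𝓘(ℝ, Euc n) (γ b) (Ψ z).1) := by
  have h1 : ∀ᶠ z in 𝓝 (γ a, 0), (Ψ z).1 ∈ (extChartAt 𝓘(ℝ, Euc n) (γ b)).source := by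
    have h2 : ContinuousAt (fun z => (Ψ z).1) (γ a, 0) :=
      continuousAt_fst.comp h.smooth.continuousAt
    rw [ContinuousAt, h.apply_self] at h2
    exact h2.eventually (extChartAt_source_mem_nhds (γ b))
  filter_upwards [h1, h.eventually_eq_comp hS hab hbc hu h' h''] with z hz hz' hw
  rw [hz' hw, chartedEnd, chartedCost, (extChartAt 𝓘(ℝ, Euc n) (γ b)).left_inv hz]
  exact ⟨rfl, rfl⟩

theorem IsFlow.chartedEnd_eventuallyEq (hS : SmoothSystem 𝓘(ℝ, Euc n) Y L) (hab : a ≤ b)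
    (hbc : b ≤ c) (hu : MemLp u ⊤ (resMeas a c)) (h : IsFlow 𝓘(ℝ, Euc n) Y L u γ a b Ψ)
    (h' : IsFlow 𝓘(ℝ, Euc n) Y L u γ b c Ψ') (h'' : IsFlow 𝓘(ℝ, Euc n) Y L u γ a c Ψ'') :
    ∀ᶠ x in 𝓝 (extChartAt 𝓘(ℝ, Euc n) (γ a) (γ a)),
      chartedEnd Ψ'' (γ a) (γ c) x = chartedEnd Ψ' (γ b) (γ c) (chartedEnd Ψ (γ a) (γ b) x) ∧
      chartedCost Ψ'' (γ a) x =
        chartedCost Ψ (γ a) x + chartedCost Ψ' (γ b) (chartedEnd Ψ (γ a) (γ b) x) := by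
  have h1 : Tendsto (fun x => ((extChartAt 𝓘(ℝ, Euc n) (γ a)).symm x, (0 : Perturb k)))
      (𝓝 (extChartAt 𝓘(ℝ, Euc n) (γ a) (γ a))) (𝓝 (γ a, 0)) := by
    have := continuousAt_extChartAt_symm (I := 𝓘(ℝ, Euc n)) (γ a)
    rw [ContinuousAt, extChartAt_to_inv] at this
    exact this.prodMk_nhds tendsto_const_nhds
  filter_upwards [h1.eventually (h.eventually_chartedEnd hS hab hbc hu h' h'')] with x hx
  exact hx ⟨u, isPerturbation_zero u a c, isPerturbation_zero u b c⟩

theorem ControlProblem.flowEndMap_eventuallyEq (ht : 0 ≤ t) (htT : t ≤ T)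
    (hu : MemLp u ⊤ (resMeas 0 T)) (h : IsFlow 𝓘(ℝ, Euc n) P.f P.L u γ 0 t Ψ)
    (h' : IsFlow 𝓘(ℝ, Euc n) P.f P.L u γ t T Ψ') (h'' : IsFlow 𝓘(ℝ, Euc n) P.f P.L u γ 0 T Ψ'')
    (hx₀ : P.ι x₀ = γ 0) :
    ∀ᶠ v in 𝓝 0, P.flowEndMap Ψ'' x₀ (γ T) (extendVar k m t v, 0) =
        chartedEnd Ψ' (γ t) (γ T) (P.flowEndMap Ψ x₀ (γ t) (extendVar k m t v, 0)) ∧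
      P.flowCostMap Ψ'' x₀ (extendVar k m t v, 0) = P.flowCostMap Ψ x₀ (extendVar k m t v, 0) +
        chartedCost Ψ' (γ t) (P.flowEndMap Ψ x₀ (γ t) (extendVar k m t v, 0)) := by
  have h1 := (P.tendsto_perturbedPoint hx₀).comp (tendsto_extendVar_prod k m t)
  filter_upwards [h1.eventually (h.eventually_chartedEnd P.smoothSystem ht htT hu h' h'')]
    with v hv
  refine hv ⟨_, P.isPerturbation_extendVar v, (isPerturbation_zero u t T).congr ?_⟩
  filter_upwards [ae_mem_Ioo t T] with τ hτ
  rw [indicator_of_notMem fun h => (not_le.2 hτ.1) h.2, add_zero]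

/-- Truncation of the variation of the control. -/
theorem ControlProblem.flowMap_truncation (ht : 0 ≤ t) (hu : MemLp u ⊤ (resMeas 0 t))
    (h : IsFlow 𝓘(ℝ, Euc n) P.f P.L u γ 0 t Ψ) (hx₀ : P.ι x₀ = γ 0) {ι : Type*} {𝓁 : Filter ι}
    {S : ι → Set ℝ} (hS : ∀ s, MeasurableSet (S s)) (hS' : ∀ s, volume (S s) ≠ ⊤)
    (h0 : Tendsto (fun s => indicatorConstLp 1 (hS s) (hS' s) (1 : ℝ)) 𝓁 (𝓝 0)) :
    ∀ᶠ s in 𝓁, ∀ᶠ z : ControlVar k m in 𝓝 0,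
      Ψ (P.perturbedPoint x₀ (z, indicatorConstLp 1 (hS s) (hS' s) (1 : ℝ))) =
      Ψ (P.perturbedPoint x₀ ((z.1, z.2 - truncTop volume k (hS s) z.2), 0)) := by
  obtain ⟨U, hU, hUeq⟩ := h.exists_nhds_eq P.smoothSystem ht hu h
  have h1 := (P.tendsto_perturbedPoint hx₀).eventually hU
  have h2 : ∀ᶠ ϑ in 𝓝 (0 : Lp ℝ 1 (volume : Measure ℝ)), ∀ᶠ z in 𝓝 (0 : ControlVar k m),
      P.perturbedPoint x₀ (z, ϑ) ∈ U :=
    Filter.Eventually.curry_nhds ((continuous_swap.tendsto'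
      (0 : Lp ℝ 1 (volume : Measure ℝ) × ControlVar k m) 0 rfl).eventually h1)
  filter_upwards [h0.eventually h2] with s hs
  have h3 : Tendsto (fun z : ControlVar k m =>
      ((z.1, z.2 - truncTop volume k (hS s) z.2), (0 : Lp ℝ 1 (volume : Measure ℝ))))
      (𝓝 0) (𝓝 0) := by
    have : Continuous (fun z : ControlVar k m =>
      ((z.1, z.2 - truncTop volume k (hS s) z.2), (0 : Lp ℝ 1 (volume : Measure ℝ)))) := by
      fun_prop
    exact this.tendsto' 0 0 (by simp)
  filter_upwards [hs, h3.eventually h1] with z hz1 hz2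
  refine hUeq _ hz1 _ hz2 rfl
    ⟨fun τ => u τ + (1 - indicatorConstLp 1 (hS s) (hS' s) (1 : ℝ) τ) • z.2 τ, ?_, ?_⟩
  · filter_upwards [ae_restrict_of_ae (indicatorConstLp_coeFn (p := 1) (hs := hS s) (hμs := hS' s)
      (c := (1 : ℝ)))] with τ h4
    refine ⟨?_, rfl⟩
    have h5 : (P.perturbedPoint x₀ (z, indicatorConstLp 1 (hS s) (hS' s) (1 : ℝ))).2.1 τ =
      (S s).indicator (fun _ => (1 : ℝ)) τ := h4
    rw [h5]
    by_cases hτ : τ ∈ S s <;> simp [hτ]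
  · filter_upwards [ae_restrict_of_ae (indicatorConstLp_coeFn (p := 1) (hs := hS s) (hμs := hS' s)
      (c := (1 : ℝ))), ae_restrict_of_ae (Lp.coeFn_zero ℝ 1 volume),
      ae_restrict_of_ae (Lp.coeFn_sub z.2 (truncTop volume k (hS s) z.2)),
      ae_restrict_of_ae (coeFn_truncTop (hS s) z.2)] with τ h4 h5 h6 h7
    have e1 : (P.perturbedPoint x₀ ((z.1, z.2 - truncTop volume k (hS s) z.2), 0)).2.1 τ = 0 := h5
    have e2 : (P.perturbedPoint x₀ ((z.1, z.2 - truncTop volume k (hS s) z.2), 0)).2.2 τ = _ := h6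
    rw [e1, e2, Pi.sub_apply, h4, h7]
    refine ⟨Or.inl rfl, ?_⟩
    by_cases hτ : τ ∈ S s <;> simp [hτ]

end EndPointMaps

/-! ### The form on the space of all variations -/

section IndexBound

variable {X : Type*} [NormedAddCommGroup X] [NormedSpace ℝ X] {n : ℕ} {F : X → Euc n} {J : X → ℝ}
  {ν : ℝ} {p : Euc n →L[ℝ] ℝ} {Z : Type*} [AddCommGroup Z] [Module ℝ Z] {A : Z →ₗ[ℝ] Euc n}
  {Q : Z →ₗ[ℝ] Z →ₗ[ℝ] ℝ} {e : X →ₗ[ℝ] Z}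

/-- A bound for the index of the Hessian bounds the index of the form on all variations. -/
theorem finrank_le_of_isNegDef (he : Function.Injective e) (hF : ContDiffAt ℝ 2 F 0)
    (hJ : ContDiffAt ℝ 2 J 0) {R' : Euc n →L[ℝ] Euc n} {B : Euc n → Euc n → ℝ} (hB : B 0 0 = 0)
    (hA : ∀ v, fderiv ℝ F 0 v = R' (A (e v)))
    (hQ : ∀ v w, hessForm p ν F J 0 v w = Q (e v) (e w) + B (A (e v)) (A (e w))) {σ : ℝ} {d : ℕ}
    (h : ∀ W : Submodule ℝ X, FiniteDimensional ℝ W → (∀ w : W, diff1 F W w = 0) →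
      (∀ w : W, w ≠ 0 → σ * formQ F J ν p W w w < 0) → Module.finrank ℝ W ≤ d)
    (V : Submodule ℝ Z) (hV : IsNegDef (σ • Q) V) (hVe : V ≤ LinearMap.range e) :
    Module.finrank ℝ V ≤ d + n := by
  have hfin := hV.finite
  let K : Submodule ℝ Z := V ⊓ LinearMap.ker A
  have hKe : (K.comap e).map e = K := Submodule.map_comap_eq_of_le (inf_le_left.trans hVe)
  let E := Submodule.equivMapOfInjective e he (K.comap e)
  have hKfin : FiniteDimensional ℝ K := Submodule.finiteDimensional_of_le inf_le_left
  have hmfin : FiniteDimensional ℝ ((K.comap e).map e) := by rw [hKe]; exact hKfin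
  have hcfin : FiniteDimensional ℝ (K.comap e) := E.symm.finiteDimensional
  have hd : Module.finrank ℝ (K.comap e) ≤ d := by
    refine h _ hcfin (fun w => ?_) (fun w hw => ?_)
    · have h1 : A (e w) = 0 := w.2.2
      rw [diff1_apply hF, hA, h1, map_zero]
    · have h1 : A (e w) = 0 := w.2.2
      rw [formQ_apply hF hJ, hQ, h1, hB, add_zero]
      refine hV.neg (e w) w.2.1 fun h0 => hw (Subtype.ext ?_)
      exact he (h0.trans (map_zero e).symm)
  have h2 : Module.finrank ℝ (K.comap e) = Module.finrank ℝ K := by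
    rw [E.finrank_eq, hKe]
  have h3 := LinearMap.finrank_range_add_finrank_ker (A.domRestrict V)
  have h4 : Module.finrank ℝ (LinearMap.range (A.domRestrict V)) ≤ n := by
    simpa using (LinearMap.range (A.domRestrict V)).finrank_le
  have h5 : Module.finrank ℝ (LinearMap.ker (A.domRestrict V)) = Module.finrank ℝ K := by
    have h6 : (LinearMap.ker (A.domRestrict V)).map V.subtype = K := by
      ext z
      simp [K, Submodule.mem_map, and_comm]
    rw [← h6, LinearEquiv.finrank_eq (Submodule.equivMapOfInjective V.subtype
      V.injective_subtype (LinearMap.ker (A.domRestrict V)))]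
  omega

end IndexBound

section ReducedForm

open Filter

variable {n k m : ℕ} {M N : Type*}
  [TopologicalSpace M] [ChartedSpace (Euc n) M] [IsManifold 𝓘(ℝ, Euc n) ∞ M]
  [TopologicalSpace N] [ChartedSpace (Euc m) N] [IsManifold 𝓘(ℝ, Euc m) ∞ N]
  (P : ControlProblem n k m M N)
  {ν : ℝ} {u : ℝ → Euc k} {γ : ℝ → M} {a b c t T : ℝ} {Ψ Ψ' Ψ'' : M × Perturb k → M × ℝ} {x₀ : N}
  {p p' : Euc n →L[ℝ] ℝ} {A : ControlVar k m →ₗ[ℝ] Euc n}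

theorem injective_extendVar (k m : ℕ) (t : ℝ) : Function.Injective (extendVar k m t) := by
  refine (injective_iff_map_eq_zero _).2 fun v hv => ?_
  have h0 : v.1 = 0 := congrArg Prod.fst (a₂ := (0 : ControlVar k m)) hv
  refine Prod.ext h0 ?_
  have h1 : ‖extendTopLinear volume k measurableSet_Icc v.2‖ = 0 := by
    rw [norm_eq_zero]
    exact congrArg Prod.snd (a₂ := (0 : ControlVar k m)) hv
  rw [norm_extendTopLinear, norm_eq_zero] at h1
  exact h1

/-- The variations with control supported in `[0, t]`. -/
def varSubmodule (k m : ℕ) (t : ℝ) : Submodule ℝ (ControlVar k m) :=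
  LinearMap.range (extendVar k m t).toLinearMap

theorem mem_varSubmodule {z : ControlVar k m} :
    z ∈ varSubmodule k m t ↔ ∀ᵐ τ, τ ∉ Icc 0 t → z.2 τ = 0 := by
  constructor
  · rintro ⟨v, rfl⟩
    filter_upwards [coeFn_extendVar v] with τ h1 h2
    exact h1.trans (indicator_of_notMem h2 _)
  · intro h
    refine ⟨(z.1, LpToLpRestrictCLM ℝ (Euc k) ℝ volume ⊤ (Icc 0 t) z.2), Prod.ext rfl ?_⟩
    refine Lp.ext ((coeFn_truncTop measurableSet_Icc z.2).trans ?_)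
    filter_upwards [h] with τ hτ
    by_cases h1 : τ ∈ Icc 0 t
    · rw [indicator_of_mem h1]
    · rw [indicator_of_notMem h1, hτ h1]

theorem varSubmodule_mono {s t : ℝ} (hst : s ≤ t) : varSubmodule k m s ≤ varSubmodule k m t :=
  fun z hz => by
    rw [mem_varSubmodule] at hz ⊢
    filter_upwards [hz] with τ h1 h2
    exact h1 fun h => h2 ⟨h.1, h.2.trans hst⟩

/-- The second variation minus the pull-back by `A` of the second differential of the flow. -/
def reducedForm (p' : Euc n →L[ℝ] ℝ) (ν : ℝ) (F : ControlVar k m → Euc n) (J : ControlVar k m → ℝ)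
    (R : Euc n → Euc n) (S : Euc n → ℝ) (x : Euc n) (A : ControlVar k m →ₗ[ℝ] Euc n) :
    ControlVar k m →ₗ[ℝ] ControlVar k m →ₗ[ℝ] ℝ :=
  hessForm p' ν F J 0 - (hessForm p' ν R S x).compl₁₂ A A

theorem reducedForm_apply {F : ControlVar k m → Euc n} {J : ControlVar k m → ℝ}
    {R : Euc n → Euc n} {S : Euc n → ℝ} {x : Euc n} (z w : ControlVar k m) :
    reducedForm p' ν F J R S x A z w =
      hessForm p' ν F J 0 z w - hessForm p' ν R S x (A z) (A w) := rfl

/-- Truncation of a variation of the control to the complement of `(s, t]`. -/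
def truncVar (k m : ℕ) (s t : ℝ) : ControlVar k m →L[ℝ] ControlVar k m :=
  (0 : Euc m →L[ℝ] Euc m).prodMap (truncTop volume k (measurableSet_Ioc (a := s) (b := t)))

theorem truncVar_apply (s t : ℝ) (z : ControlVar k m) :
    truncVar k m s t z = ((0 : Euc m), truncTop volume k (measurableSet_Ioc (a := s) (b := t)) z.2) := rfl

theorem norm_truncVar_le (s t : ℝ) (z : ControlVar k m) : ‖truncVar k m s t z‖ ≤ ‖z‖ := by
  rw [truncVar_apply, Prod.norm_mk, norm_zero]
  exact max_le (norm_nonneg z)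
    ((norm_truncTop_le measurableSet_Ioc z.2).trans (norm_snd_le z))

theorem truncVar_truncVar (s t : ℝ) (z : ControlVar k m) :
    truncVar k m s t (truncVar k m s t z) = truncVar k m s t z := by
  rw [truncVar_apply, truncVar_apply, truncTop_truncTop]

theorem prodMk_sub_truncTop (s t : ℝ) (z : ControlVar k m) : (z.1, z.2 - truncTop volume k
    (measurableSet_Ioc (a := s) (b := t)) z.2) = z - truncVar k m s t z := by
  rw [truncVar_apply, Prod.sub_def, sub_zero]

theorem sub_truncVar_mem {s t : ℝ} {z : ControlVar k m} (hz : z ∈ varSubmodule k m t) :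
    z - truncVar k m s t z ∈ varSubmodule k m s := by
  rw [mem_varSubmodule] at hz ⊢
  filter_upwards [hz, Lp.coeFn_sub z.2 (truncTop volume k measurableSet_Ioc z.2),
    coeFn_truncTop (measurableSet_Ioc (a := s) (b := t)) z.2] with τ h1 h2 h3 h4
  rw [← prodMk_sub_truncTop, h2, Pi.sub_apply, h3]
  by_cases hτ : τ ∈ Ioc s t
  · rw [indicator_of_mem hτ, sub_self]
  · rw [indicator_of_notMem hτ, sub_zero]
    refine h1 fun h => ?_
    rcases le_or_gt τ s with h6 | h6
    · exact h4 ⟨h.1, h6⟩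
    · exact hτ ⟨h6, h.2⟩

theorem tendsto_indicatorConstLp_Ioc (t : ℝ) :
    Tendsto (fun s => indicatorConstLp 1 (measurableSet_Ioc (a := s) (b := t))
      (measure_Ioc_lt_top (μ := volume)).ne (1 : ℝ)) (𝓝[<] t) (𝓝 0) := by
  refine squeeze_zero_norm' (a := fun s => t - s) ?_ ?_
  · filter_upwards [self_mem_nhdsWithin] with s hs
    rw [norm_indicatorConstLp one_ne_zero ENNReal.one_ne_top]
    simp [(mem_Iio.1 hs).le]
  · have : Tendsto (fun s => t - s) (𝓝 t) (𝓝 0) := by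
      have h := (continuous_const.sub continuous_id (X := ℝ)).tendsto t (f := fun s => t - s)
      simpa using h
    exact this.mono_left nhdsWithin_le_nhds

theorem ControlProblem.contDiffAt_flowMap_left (h : IsFlow 𝓘(ℝ, Euc n) P.f P.L u γ a b Ψ)
    (hx₀ : P.ι x₀ = γ a) : ContDiffAt ℝ 2 (fun z => P.flowEndMap Ψ x₀ (γ b) (z, 0)) 0 ∧
      ContDiffAt ℝ 2 (fun z => P.flowCostMap Ψ x₀ (z, 0)) 0 := by
  have hi : ContDiffAt ℝ 2 (fun z : ControlVar k m => (z, (0 : Lp ℝ 1 (volume : Measure ℝ)))) 0 :=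
    contDiffAt_id.prodMk contDiffAt_const
  exact ⟨ContDiffAt.comp (g := P.flowEndMap Ψ x₀ (γ b)) (0 : ControlVar k m)
    (contDiffAt_infty.1 (P.contDiffAt_flowEndMap h hx₀) 2) hi,
    ContDiffAt.comp (g := P.flowCostMap Ψ x₀) (0 : ControlVar k m)
    (contDiffAt_infty.1 (P.contDiffAt_flowCostMap h hx₀) 2) hi⟩

variable [T2Space M]

/-- Continuity of the differential of the end-point map and of the reduced form with respect to
truncation of the variations. -/
theorem ControlProblem.tendsto_truncVar (hT : 0 ≤ T) (hu : MemLp u ⊤ (resMeas 0 T))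
    (h : IsFlow 𝓘(ℝ, Euc n) P.f P.L u γ 0 T Ψ) (hx₀ : P.ι x₀ = γ 0)
    {R : Euc n → Euc n} {S : Euc n → ℝ} {x : Euc n} {G : Euc n →ₗ[ℝ] Euc n}
    (hA : ∀ z, A z = G (fderiv ℝ (fun z => P.flowEndMap Ψ x₀ (γ T) (z, 0)) 0 z))
    (z : ControlVar k m) {w : ℝ → ControlVar k m} {C : ℝ} (hw : ∀ s, ‖w s‖ ≤ C) {y : Euc n}
    (hwA : Tendsto (fun s => A (w s)) (𝓝[<] t) (𝓝 y)) :
    Tendsto (fun s => A (truncVar k m s t z)) (𝓝[<] t) (𝓝 0) ∧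
    Tendsto (fun s => reducedForm p ν (fun z => P.flowEndMap Ψ x₀ (γ T) (z, 0))
      (fun z => P.flowCostMap Ψ x₀ (z, 0)) R S x A (truncVar k m s t z) (w s)) (𝓝[<] t) (𝓝 0) := by
  have hF := P.contDiffAt_flowEndMap h hx₀
  have hJ := P.contDiffAt_flowCostMap h hx₀
  obtain ⟨hF2, hJ2⟩ := P.contDiffAt_flowMap_left h hx₀
  have hev := P.flowMap_truncation hT hu h hx₀ (fun s => measurableSet_Ioc (a := s) (b := t))
    (fun s => (measure_Ioc_lt_top (μ := volume)).ne) (tendsto_indicatorConstLp_Ioc t)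
  have kF := tendsto_fderiv_of_truncation hF hF2 (tendsto_indicatorConstLp_Ioc t) (fun s => norm_truncVar_le s t)
    (fun s => truncVar_truncVar s t) (by
      filter_upwards [hev] with s hs
      filter_upwards [hs] with z hz
      rw [← prodMk_sub_truncTop, flowEndMap, flowEndMap, hz]) (.of_forall fun z => rfl) z hw
  have kJ := tendsto_fderiv_of_truncation hJ hJ2 (tendsto_indicatorConstLp_Ioc t) (fun s => norm_truncVar_le s t)
    (fun s => truncVar_truncVar s t) (by
      filter_upwards [hev] with s hs
      filter_upwards [hs] with z hz
      rw [← prodMk_sub_truncTop, flowCostMap, flowCostMap, hz]) (.of_forall fun z => rfl) z hw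
  have kA : Tendsto (fun s => A (truncVar k m s t z)) (𝓝[<] t) (𝓝 0) := by
    simp only [hA]
    have := (G.continuous_of_finiteDimensional.tendsto 0).comp kF.1
    rwa [map_zero] at this
  refine ⟨kA, ?_⟩
  simp only [reducedForm_apply, hessForm_apply]
  have e1 := (p.continuous.tendsto 0).comp kF.2
  rw [map_zero] at e1
  have e2 := kJ.2.const_mul ν
  have c1 : ∀ {G : Type} [NormedAddCommGroup G] [NormedSpace ℝ G] (B : Euc n →L[ℝ] Euc n →L[ℝ] G),
      Tendsto (fun s => B (A (truncVar k m s t z)) (A (w s))) (𝓝[<] t) (𝓝 0) := fun B => by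
    have h1 := (B.continuous₂.tendsto (0, y)).comp (kA.prodMk_nhds hwA)
    simpa [Function.comp_def, Function.uncurry] using h1
  have e3 := (p.continuous.tendsto 0).comp (c1 (fderiv ℝ (fderiv ℝ R) x))
  rw [map_zero] at e3
  have e4 := (c1 (fderiv ℝ (fderiv ℝ S) x)).const_mul ν
  simpa using (e1.sub e2).sub (e3.sub e4)

/-- The first and second differentials of the end-point map at time `t` in terms of the final
time. -/
theorem ControlProblem.endPointMap_differentials (ht : 0 ≤ t) (htT : t ≤ T)
    (hu : MemLp u ⊤ (resMeas 0 T)) (h : IsFlow 𝓘(ℝ, Euc n) P.f P.L u γ 0 t Ψ)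
    (h' : IsFlow 𝓘(ℝ, Euc n) P.f P.L u γ t T Ψ') (h'' : IsFlow 𝓘(ℝ, Euc n) P.f P.L u γ 0 T Ψ'')
    (hx₀ : P.ι x₀ = γ 0)
    (hc : CostateRelation ν p p'
      (fderiv ℝ (chartedEnd Ψ' (γ t) (γ T)) (extChartAt 𝓘(ℝ, Euc n) (γ t) (γ t)))
      (fderiv ℝ (chartedCost Ψ' (γ t)) (extChartAt 𝓘(ℝ, Euc n) (γ t) (γ t))))
    (hinj : Function.Injective
      (fderiv ℝ (chartedEnd Ψ'' (γ 0) (γ T)) (extChartAt 𝓘(ℝ, Euc n) (γ 0) (γ 0))))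
    (hA : ∀ z, fderiv ℝ (chartedEnd Ψ'' (γ 0) (γ T)) (extChartAt 𝓘(ℝ, Euc n) (γ 0) (γ 0)) (A z) =
      fderiv ℝ (fun z => P.flowEndMap Ψ'' x₀ (γ T) (z, 0)) 0 z) :
    ContDiffAt ℝ 2 (P.endPointMap x₀ u t (γ t)) 0 ∧ ContDiffAt ℝ 2 (P.costMap x₀ u t) 0 ∧
    (∀ v, fderiv ℝ (P.endPointMap x₀ u t (γ t)) 0 v =
      fderiv ℝ (chartedEnd Ψ (γ 0) (γ t)) (extChartAt 𝓘(ℝ, Euc n) (γ 0) (γ 0))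
        (A (extendVar k m t v))) ∧
    ∀ v w, hessForm p ν (P.endPointMap x₀ u t (γ t)) (P.costMap x₀ u t) 0 v w =
      reducedForm p' ν (fun z => P.flowEndMap Ψ'' x₀ (γ T) (z, 0))
        (fun z => P.flowCostMap Ψ'' x₀ (z, 0)) (chartedEnd Ψ'' (γ 0) (γ T)) (chartedCost Ψ'' (γ 0))
        (extChartAt 𝓘(ℝ, Euc n) (γ 0) (γ 0)) A (extendVar k m t v) (extendVar k m t w) +
      hessForm p ν (chartedEnd Ψ (γ 0) (γ t)) (chartedCost Ψ (γ 0))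
        (extChartAt 𝓘(ℝ, Euc n) (γ 0) (γ 0)) (A (extendVar k m t v)) (A (extendVar k m t w)) := by
  have hut := MemLp.resMeas_mono (Icc_subset_Icc_right htT) hu
  let e := extendVar k m t
  have he0 : e 0 = 0 := map_zero e
  have hE := P.endPointMap_eventuallyEq ht hut h hx₀ (γ t)
  have hE1 : P.endPointMap x₀ u t (γ t) =ᶠ[𝓝 0] fun v => P.flowEndMap Ψ x₀ (γ t) (e v, 0) :=
    hE.mono fun v hv => hv.1
  have hE2 : P.costMap x₀ u t =ᶠ[𝓝 0] fun v => P.flowCostMap Ψ x₀ (e v, 0) :=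
    hE.mono fun v hv => hv.2
  have g1 : ContDiffAt ℝ 2 (P.endPointMap x₀ u t (γ t)) 0 := by
    refine ContDiffAt.congr_of_eventuallyEq ?_ hE1
    refine ContDiffAt.comp (g := fun z => P.flowEndMap Ψ x₀ (γ t) (z, 0)) (f := e) 0 ?_
      e.contDiff.contDiffAt
    rw [he0]
    exact (P.contDiffAt_flowMap_left h hx₀).1
  have g2 : ContDiffAt ℝ 2 (P.costMap x₀ u t) 0 := by
    refine ContDiffAt.congr_of_eventuallyEq ?_ hE2
    refine ContDiffAt.comp (g := fun z => P.flowCostMap Ψ x₀ (z, 0)) (f := e) 0 ?_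
      e.contDiff.contDiffAt
    rw [he0]
    exact (P.contDiffAt_flowMap_left h hx₀).2
  have hE0 : P.endPointMap x₀ u t (γ t) 0 = extChartAt 𝓘(ℝ, Euc n) (γ t) (γ t) := by
    refine hE1.self_of_nhds.trans ?_
    simp only [he0]
    have := P.perturbedPoint_zero (x₀ := x₀)
    rw [hx₀] at this
    exact congrArg (extChartAt 𝓘(ℝ, Euc n) (γ t)) ((congrArg (fun z => (Ψ z).1) this).trans
      h.apply_self)
  have hC := P.flowEndMap_eventuallyEq ht htT hu h h' h'' hx₀
  have hF₂ : (fun v => P.flowEndMap Ψ'' x₀ (γ T) (e v, 0)) =ᶠ[𝓝 0]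
      fun v => chartedEnd Ψ' (γ t) (γ T) (P.endPointMap x₀ u t (γ t) v) := by
    filter_upwards [hC, hE1] with v h1 h2
    rw [h2]
    exact h1.1
  have hJ₂ : (fun v => P.flowCostMap Ψ'' x₀ (e v, 0)) =ᶠ[𝓝 0] fun v => P.costMap x₀ u t v +
      chartedCost Ψ' (γ t) (P.endPointMap x₀ u t (γ t) v) := by
    filter_upwards [hC, hE1, hE2] with v h1 h2 h3
    rw [h2, h3]
    exact h1.2
  have hR' := contDiffAt_infty.1 h'.contDiffAt_chartedEnd 2
  have hS' := contDiffAt_infty.1 h'.contDiffAt_chartedCost 2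
  have hR := contDiffAt_infty.1 h.contDiffAt_chartedEnd 2
  have hS := contDiffAt_infty.1 h.contDiffAt_chartedCost 2
  have hD := h.chartedEnd_eventuallyEq P.smoothSystem ht htT hu h' h''
  have hself := h.chartedEnd_apply_self
  have t1 := hessForm_transport (p₁ := p) (p₂ := p') (ν := ν) g1 g2 (by rwa [hE0]) (by rwa [hE0]) hF₂ hJ₂
    (by rwa [hE0])
  have t2 := hessForm_transport (p₁ := p) (p₂ := p') (ν := ν) hR hS (by rwa [hself])
    (by rwa [hself]) (hD.mono fun x hx => hx.1) (hD.mono fun x hx => hx.2) (by rwa [hself])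
  have d1 := fderiv_transport g1 (by rwa [hE0]) hF₂
  have d2 := fderiv_transport hR (by rwa [hself]) (hD.mono fun x hx => hx.1)
  rw [hE0] at t1 d1
  rw [hself] at t2 d2
  have hinjt : Function.Injective
      (fderiv ℝ (chartedEnd Ψ (γ 0) (γ t)) (extChartAt 𝓘(ℝ, Euc n) (γ 0) (γ 0))) := fun v w hvw =>
    hinj (by rw [d2, d2, hvw])
  have hsurj := (LinearMap.injective_iff_surjective (f := (fderiv ℝ (chartedEnd Ψ (γ 0) (γ t))
    (extChartAt 𝓘(ℝ, Euc n) (γ 0) (γ 0))).toLinearMap)).1 hinjt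
  have dE : ∀ v, fderiv ℝ (fun v => P.flowEndMap Ψ'' x₀ (γ T) (e v, 0)) 0 v =
      fderiv ℝ (fun z => P.flowEndMap Ψ'' x₀ (γ T) (z, 0)) 0 (e v) := fun v => by
    have := fderiv_comp_clm (g := fun z => P.flowEndMap Ψ'' x₀ (γ T) (z, 0)) e (x := 0)
      (by rw [he0]; exact (P.contDiffAt_flowMap_left h'' hx₀).1.differentiableAt (by norm_num)) v
    rwa [he0] at this
  have hEA : ∀ v, fderiv ℝ (P.endPointMap x₀ u t (γ t)) 0 v =
      fderiv ℝ (chartedEnd Ψ (γ 0) (γ t)) (extChartAt 𝓘(ℝ, Euc n) (γ 0) (γ 0)) (A (e v)) := by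
    intro v
    obtain ⟨y, hy⟩ := hsurj (fderiv ℝ (P.endPointMap x₀ u t (γ t)) 0 v)
    have hy' : fderiv ℝ (chartedEnd Ψ (γ 0) (γ t)) (extChartAt 𝓘(ℝ, Euc n) (γ 0) (γ 0)) y =
      fderiv ℝ (P.endPointMap x₀ u t (γ t)) 0 v := hy
    have h1 : A (e v) = y := hinj (by rw [hA, ← dE, d1, d2, hy'])
    rw [h1, hy']
  refine ⟨g1, g2, hEA, fun v w => ?_⟩
  have t3 := hessForm_comp_clm (p := p') (ν := ν) (F := fun z => P.flowEndMap Ψ'' x₀ (γ T) (z, 0))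
    (J := fun z => P.flowCostMap Ψ'' x₀ (z, 0)) e (x := 0) (by rw [he0]; exact (P.contDiffAt_flowMap_left h'' hx₀).1)
    (by rw [he0]; exact (P.contDiffAt_flowMap_left h'' hx₀).2) v w
  rw [he0] at t3
  have t1' := t1 v w
  have t2' := t2 (A (e v)) (A (e w))
  rw [hEA, hEA] at t1'
  rw [reducedForm_apply]
  change _ = hessForm p' ν _ _ 0 (e v) (e w) - hessForm p' ν _ _ _ (A (e v)) (A (e w)) +
    hessForm p ν _ _ _ (A (e v)) (A (e w))
  linarith

end ReducedForm

/-! ### Jacobi curves -/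

section JacobiCurve

open Filter

variable {n k m : ℕ} {M N : Type*}
  [TopologicalSpace M] [ChartedSpace (Euc n) M] [IsManifold 𝓘(ℝ, Euc n) ∞ M] [T2Space M]
  [TopologicalSpace N] [ChartedSpace (Euc m) N] [IsManifold 𝓘(ℝ, Euc m) ∞ N]
  (P : ControlProblem n k m M N)
  {ν : ℝ} {u : ℝ → Euc k} {γ : ℝ → M} {t T : ℝ} {Ψ : M × Perturb k → M × ℝ} {x₀ : N}
  {l : ℝ → CotBundle n M} {A : ControlVar k m →ₗ[ℝ] Euc n}
  {Q : ControlVar k m →ₗ[ℝ] ControlVar k m →ₗ[ℝ] ℝ}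

/-- The reduced form of the end-point map `flowEndMap` of the flow `Ψ` along `γ`. -/
def ControlProblem.flowForm (p : Euc n →L[ℝ] ℝ) (ν : ℝ) (Ψ : M × Perturb k → M × ℝ) (x₀ : N)
    (γ : ℝ → M) (T : ℝ) (A : ControlVar k m →ₗ[ℝ] Euc n) :
    ControlVar k m →ₗ[ℝ] ControlVar k m →ₗ[ℝ] ℝ :=
  reducedForm p ν (fun z => P.flowEndMap Ψ x₀ (γ T) (z, 0)) (fun z => P.flowCostMap Ψ x₀ (z, 0))
    (chartedEnd Ψ (γ 0) (γ T)) (chartedCost Ψ (γ 0)) (extChartAt 𝓘(ℝ, Euc n) (γ 0) (γ 0)) A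

theorem ControlProblem.flowForm_symm (h : IsFlow 𝓘(ℝ, Euc n) P.f P.L u γ 0 T Ψ)
    (hx₀ : P.ι x₀ = γ 0) (p : Euc n →L[ℝ] ℝ) (z w : ControlVar k m) :
    P.flowForm p ν Ψ x₀ γ T A z w = P.flowForm p ν Ψ x₀ γ T A w z := by
  obtain ⟨hF, hJ⟩ := P.contDiffAt_flowMap_left h hx₀
  rw [flowForm, reducedForm_apply, reducedForm_apply, hessForm_symm hF hJ,
    hessForm_symm (contDiffAt_infty.1 h.contDiffAt_chartedEnd 2)
      (contDiffAt_infty.1 h.contDiffAt_chartedCost 2)]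

/-- Approximation of variations by variations that vanish near the final time. -/
theorem ControlProblem.exists_approx (hT : 0 ≤ T) (hu : MemLp u ⊤ (resMeas 0 T))
    (h : IsFlow 𝓘(ℝ, Euc n) P.f P.L u γ 0 T Ψ) (hx₀ : P.ι x₀ = γ 0) {p : Euc n →L[ℝ] ℝ}
    {G : Euc n →ₗ[ℝ] Euc n}
    (hA : ∀ z, A z = G (fderiv ℝ (fun z => P.flowEndMap Ψ x₀ (γ T) (z, 0)) 0 z))
    {v : ControlVar k m} (hv : v ∈ varSubmodule k m t) :
    ∃ w : ℝ → ControlVar k m, (∀ s, w s ∈ varSubmodule k m s) ∧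
      Tendsto (fun s => A (w s)) (𝓝[<] t) (𝓝 (A v)) ∧
      Tendsto (fun s => P.flowForm p ν Ψ x₀ γ T A (w s) (w s)) (𝓝[<] t)
        (𝓝 (P.flowForm p ν Ψ x₀ γ T A v v)) ∧
      ∀ z, Tendsto (fun s => P.flowForm p ν Ψ x₀ γ T A (w s) z) (𝓝[<] t)
        (𝓝 (P.flowForm p ν Ψ x₀ γ T A v z)) := by
  have key : ∀ {w : ℝ → ControlVar k m} {C : ℝ}, (∀ s, ‖w s‖ ≤ C) → ∀ {y : Euc n},
      Tendsto (fun s => A (w s)) (𝓝[<] t) (𝓝 y) →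
      Tendsto (fun s => A (truncVar k m s t v)) (𝓝[<] t) (𝓝 0) ∧
      Tendsto (fun s => P.flowForm p ν Ψ x₀ γ T A (truncVar k m s t v) (w s)) (𝓝[<] t) (𝓝 0) :=
    fun hw _ hwA => P.tendsto_truncVar hT hu h hx₀ hA v hw hwA
  have h0 := fun z => key (w := fun _ => z) (fun _ => le_rfl) tendsto_const_nhds
  have h1 := (key (fun s => norm_truncVar_le s t v) (h0 0).1).2
  refine ⟨fun s => v - truncVar k m s t v, fun s => sub_truncVar_mem hv, ?_, ?_, fun z => ?_⟩
  · simpa using (h0 0).1.const_sub (A v)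
  · have h2 := ((tendsto_const_nhds (x := P.flowForm p ν Ψ x₀ γ T A v v)).sub
      ((h0 v).2.add (h0 v).2)).add h1
    simp only [add_zero, sub_zero] at h2
    refine h2.congr fun s => ?_
    have h3 := P.flowForm_symm (ν := ν) (A := A) h hx₀ p v (truncVar k m s t v)
    simp only [map_sub, LinearMap.sub_apply, h3]
    ring
  · have h2 := (tendsto_const_nhds (x := P.flowForm p ν Ψ x₀ γ T A v z)).sub (h0 z).2
    rw [sub_zero] at h2
    refine h2.congr fun s => ?_
    rw [map_sub, LinearMap.sub_apply]

/-- The data of the limits along the curve. -/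
theorem exists_limitFrames_of_approx (hQ : ∀ v w, Q v w = Q w v) {d : ℕ}
    (hd : (∀ V, IsNegDef Q V → V ≤ varSubmodule k m T → Module.finrank ℝ V ≤ d) ∨
      ∀ V, IsNegDef (-Q) V → V ≤ varSubmodule k m T → Module.finrank ℝ V ≤ d)
    (happ : ∀ t, ∀ v ∈ varSubmodule k m t, ∃ w : ℝ → ControlVar k m,
      (∀ s, w s ∈ varSubmodule k m s) ∧
      Tendsto (fun s => A (w s)) (𝓝[<] t) (𝓝 (A v)) ∧
      Tendsto (fun s => Q (w s) (w s)) (𝓝[<] t) (𝓝 (Q v v)) ∧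
      ∀ z, Tendsto (fun s => Q (w s) z) (𝓝[<] t) (𝓝 (Q v z))) :
    (∀ t ≤ T, ∃ b, IsLimitFrame A Q (varSubmodule k m t) b) ∧
    ∀ t ∈ Ioc 0 T, ∃ (b : ℝ → Fin n → PhaseSpace n) (b₀ : Fin n → PhaseSpace n),
      (∀ᶠ s in 𝓝[<] t, IsLimitFrame A Q (varSubmodule k m s) (b s)) ∧
      IsLimitFrame A Q (varSubmodule k m t) b₀ ∧ Tendsto b (𝓝[<] t) (𝓝 b₀) := by
  rcases hd with hd | hd
  · refine ⟨fun t ht => exists_isLimitFrame hQ fun V hV hVt =>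
      hd V hV (hVt.trans (varSubmodule_mono ht)), fun t ht => ?_⟩
    refine exists_isLimitFrame_tendsto hQ ht.1 (fun s s' _ hs _ => varSubmodule_mono hs)
      (fun V hV hVt => hd V hV (hVt.trans (varSubmodule_mono ht.2))) fun v hv => ?_
    obtain ⟨w, h1, h2, h3, h4⟩ := happ t v hv
    exact ⟨w, fun s _ => h1 s, h2, h3, fun z _ => h4 z⟩
  · have hQ' : ∀ v w, (-Q) v w = (-Q) w v := fun v w => by
      rw [LinearMap.neg_apply, LinearMap.neg_apply, LinearMap.neg_apply, LinearMap.neg_apply, hQ]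
    refine ⟨fun t ht => ?_, fun t ht => ?_⟩
    · obtain ⟨b, hb⟩ := exists_isLimitFrame (A := A) hQ' fun V hV hVt =>
        hd V hV (hVt.trans (varSubmodule_mono ht))
      exact ⟨_, hb.flip⟩
    · obtain ⟨b, b₀, h1, h2, h3⟩ := exists_isLimitFrame_tendsto (A := A) hQ' ht.1
        (fun s s' _ hs _ => varSubmodule_mono hs)
        (fun V hV hVt => hd V hV (hVt.trans (varSubmodule_mono ht.2))) fun v hv => by
          obtain ⟨w, h1, h2, h3, h4⟩ := happ t v hv
          exact ⟨w, fun s _ => h1 s, h2, h3.neg, fun z _ => (h4 z).neg⟩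
      refine ⟨_, _, h1.mono fun s hs => hs.flip, h2.flip, ?_⟩
      rw [tendsto_pi_nhds] at h3 ⊢
      exact fun i => ((phaseFlip n).continuous_of_finiteDimensional.tendsto _).comp (h3 i)

/-- The values of the Jacobi curve are the spans of the limit frames. -/
theorem ControlProblem.isJacobiValue_iff (ht : t ∈ Icc 0 T) (hu : MemLp u ⊤ (resMeas 0 T))
    (hl : IsTrajOn (cotModel n) (P.hamField ν u) 0 T l)
    (h : IsFlow 𝓘(ℝ, Euc n) P.f P.L u (fun s => (l s).1) 0 T Ψ) (hx₀ : P.ι x₀ = (l 0).1)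
    (hA : ∀ z, fderiv ℝ (chartedEnd Ψ (l 0).1 (l T).1) (extChartAt 𝓘(ℝ, Euc n) (l 0).1 (l 0).1)
      (A z) = fderiv ℝ (fun z => P.flowEndMap Ψ x₀ (l T).1 (z, 0)) 0 z)
    {b : Fin n → PhaseSpace n}
    (hb : IsLimitFrame A (P.flowForm (l T).2 ν Ψ x₀ (fun s => (l s).1) T A)
      (varSubmodule k m t) b) {Λ : Submodule ℝ (PhaseSpace n)} :
    P.IsJacobiValue ν x₀ u l t Λ ↔ Λ = Submodule.span ℝ (range b) := by
  have hut := MemLp.resMeas_mono (Icc_subset_Icc_right ht.2) hu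
  have hlt := hl.mono (Icc_subset_Icc_right ht.2)
  obtain ⟨Ψ₁, h₁⟩ := (P.isTrajOn_proj hlt).exists_isFlow P.smoothSystem ht.1 hut
  obtain ⟨Ψ₂, h₂, hc⟩ := P.exists_isFlow_costate ht.2
    (MemLp.resMeas_mono (Icc_subset_Icc_left ht.1) hu) (hl.mono (Icc_subset_Icc_left ht.1))
  have hinjT := P.injective_fderiv_chartedEnd (ht.1.trans ht.2) hu hl h
  obtain ⟨d1, d2, d3, d4⟩ := P.endPointMap_differentials ht.1 ht.2 hu h₁ h₂ h hx₀
    (h₂.costateRelation_charted hc) hinjT hA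
  have hker := P.ker_hamFlowDeriv ht.1 hut hlt h₁
  have hinj := LinearMap.ker_eq_bot.1 hker
  have hrel := P.hamFlowDeriv_relation ht.1 hut hlt h₁
  have hlag := lDerivative_eq_map_lag (e := (extendVar k m t).toLinearMap) (p := (l t).2)
    (Q := P.flowForm (l T).2 ν Ψ x₀ (fun s => (l s).1) T A)
    (B := fun y w => hessForm (l t).2 ν (chartedEnd Ψ₁ (l 0).1 (l t).1) (chartedCost Ψ₁ (l 0).1)
      (extChartAt 𝓘(ℝ, Euc n) (l 0).1 (l 0).1) y w) d1 d2
    (P.injective_fderiv_chartedEnd ht.1 hut hlt h₁)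
    (Θ := (P.hamFlowDeriv ν u t (l 0)).toLinearMap)
    (LinearMap.injective_iff_surjective.1 hinj) (fun a => (hrel a).1)
    (fun a => (hrel a).2) d3 d4
  have hiff := fun Γ => IsLimitFrame.isLDerivative_iff (Γ := Γ) hb
    (LinearMap.ker_eq_bot.2 (injective_extendVar k m t)) hker (fun W _ => hlag W)
  constructor
  · rintro ⟨Γ, h3, rfl⟩
    rw [(hiff Γ).1 h3]
    exact Submodule.comap_map_eq_of_injective hinj _
  · rintro rfl
    exact ⟨_, (hiff _).2 rfl, (Submodule.comap_map_eq_of_injective hinj _).symm⟩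

/-- Finiteness of an index of the Hessian in terms of the reduced form. -/
theorem ControlProblem.exists_finrank_le (hT : 0 ≤ T) (hu : MemLp u ⊤ (resMeas 0 T))
    (hl : IsTrajOn (cotModel n) (P.hamField ν u) 0 T l)
    (h : IsFlow 𝓘(ℝ, Euc n) P.f P.L u (fun s => (l s).1) 0 T Ψ) (hx₀ : P.ι x₀ = (l 0).1)
    (hA : ∀ z, fderiv ℝ (chartedEnd Ψ (l 0).1 (l T).1) (extChartAt 𝓘(ℝ, Euc n) (l 0).1 (l 0).1)
      (A z) = fderiv ℝ (fun z => P.flowEndMap Ψ x₀ (l T).1 (z, 0)) 0 z)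
    (hQ : Q = P.flowForm (l T).2 ν Ψ x₀ (fun s => (l s).1) T A)
    (hind : HasFinitePosIndex (P.endPointMap x₀ u T (l T).1) (P.costMap x₀ u T) ν (l T).2 ∨
      HasFiniteNegIndex (P.endPointMap x₀ u T (l T).1) (P.costMap x₀ u T) ν (l T).2) :
    ∃ d : ℕ, (∀ V, IsNegDef Q V → V ≤ varSubmodule k m T → Module.finrank ℝ V ≤ d) ∨
      ∀ V, IsNegDef (-Q) V → V ≤ varSubmodule k m T → Module.finrank ℝ V ≤ d := by
  obtain ⟨Ψ₂, h₂, hc⟩ := P.exists_isFlow_costate le_rfl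
    (MemLp.resMeas_mono (Icc_subset_Icc_left hT) hu) (hl.mono (Icc_subset_Icc_left hT))
  obtain ⟨d1, d2, d3, d4⟩ := P.endPointMap_differentials hT le_rfl hu h h₂ h hx₀
    (h₂.costateRelation_charted hc) (P.injective_fderiv_chartedEnd hT hu hl h) hA
  have key := fun σ d hW => finrank_le_of_isNegDef (e := (extendVar k m T).toLinearMap) (σ := σ)
    (p := (l T).2) (Q := Q)
    (B := fun y w => hessForm (l T).2 ν (chartedEnd Ψ (l 0).1 (l T).1) (chartedCost Ψ (l 0).1)
      (extChartAt 𝓘(ℝ, Euc n) (l 0).1 (l 0).1) y w)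
    (d := d) (injective_extendVar k m T) d1 d2 (LinearMap.map_zero _) d3
    (by rw [hQ]; exact d4) hW
  rcases hind with ⟨d, hd⟩ | ⟨d, hd⟩
  · refine ⟨d + n, Or.inl fun V hV hVT => key 1 d ?_ V (by rwa [one_smul]) hVT⟩
    refine fun W hW h1 h2 => hd W hW h1 fun w hw => ?_
    have := h2 w hw
    linarith
  · refine ⟨d + n, Or.inr fun V (hV : IsNegDef (-Q) V) hVT => key (-1) d ?_ V (by
      have h3 : (-1 : ℝ) • Q = -Q := neg_one_smul ℝ Q
      rwa [h3]) hVT⟩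
    refine fun W hW h1 h2 => hd W hW h1 fun w hw => ?_
    have := h2 w hw
    linarith

end JacobiCurve

end

theorem mainTheorem10 {n k m : ℕ} {M N : Type*}
    [TopologicalSpace M] [ChartedSpace (Euc n) M] [IsManifold 𝓘(ℝ, Euc n) ∞ M] [T2Space M]
    [TopologicalSpace N] [ChartedSpace (Euc m) N] [IsManifold 𝓘(ℝ, Euc m) ∞ N]
    (P : ControlProblem n k m M N)
    -- final time, abnormal or normal multiplier
    (T : ℝ) (hT : 0 < T) (ν : ℝ) (hν : ν = 0 ∨ ν = 1)
    -- an admissible pair that starts on the initial submanifold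
    (u : ℝ → Euc k) (hu : MemLp u ⊤ (volume.restrict (Icc (0 : ℝ) T)))
    (q : ℝ → M) (hq : IsTrajectory 𝓘(ℝ, Euc n) (fun t x => P.f (u t) x) T q)
    (x₀ : N) (hx₀ : P.ι x₀ = q 0)
    -- a Hamiltonian lift of the trajectory, whose end point is a Lagrange multiplier
    (l : ℝ → CotBundle n M) (hl : IsTrajectory (cotModel n) (P.hamField ν u) T l)
    (hproj : ∀ t ∈ Icc 0 T, (l t).1 = q t)
    (hcrit : IsLagrangePoint (P.endPointMap x₀ u T (l T).1) (P.costMap x₀ u T) ν (l T).2)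
    -- one of the inertia indices of the Hessian is finite
    (hind : HasFinitePosIndex (P.endPointMap x₀ u T (l T).1) (P.costMap x₀ u T) ν (l T).2 ∨
      HasFiniteNegIndex (P.endPointMap x₀ u T (l T).1) (P.costMap x₀ u T) ν (l T).2) :
    (∀ t ∈ Icc 0 T, ∃ Λ : Submodule ℝ (PhaseSpace n),
      IsLagrangianSubspace Λ ∧ P.IsJacobiValue ν x₀ u l t Λ) ∧
    ∀ 𝓛 : ℝ → Submodule ℝ (PhaseSpace n),
      (∀ t ∈ Icc 0 T, P.IsJacobiValue ν x₀ u l t (𝓛 t)) →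
      ∀ t ∈ Ioc 0 T, ContinuousWithinAt 𝓛 (Iic t) t := by
  have hT' := hT.le
  have hl' : IsTrajOn (cotModel n) (P.hamField ν u) 0 T l := isTrajOn_zero_iff.2 hl
  have hx₀' : P.ι x₀ = (l 0).1 := hx₀.trans (hproj 0 (left_mem_Icc.2 hT')).symm
  obtain ⟨Ψ, h⟩ := (P.isTrajOn_proj hl').exists_isFlow P.smoothSystem hT' hu
  have hinj := P.injective_fderiv_chartedEnd hT' hu hl' h
  obtain ⟨G, hG⟩ := LinearMap.exists_leftInverse_of_injective
    (fderiv ℝ (chartedEnd Ψ (l 0).1 (l T).1)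
      (extChartAt 𝓘(ℝ, Euc n) (l 0).1 (l 0).1)).toLinearMap (LinearMap.ker_eq_bot.2 hinj)
  have hG' := (LinearMap.comp_eq_id_comm ℝ (Euc n)).1 hG
  let A : ControlVar k m →ₗ[ℝ] Euc n :=
    G ∘ₗ (fderiv ℝ (fun z => P.flowEndMap Ψ x₀ (l T).1 (z, 0)) 0).toLinearMap
  have hA : ∀ z, fderiv ℝ (chartedEnd Ψ (l 0).1 (l T).1)
      (extChartAt 𝓘(ℝ, Euc n) (l 0).1 (l 0).1) (A z) =
      fderiv ℝ (fun z => P.flowEndMap Ψ x₀ (l T).1 (z, 0)) 0 z := fun z =>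
    LinearMap.congr_fun hG' (fderiv ℝ (fun z => P.flowEndMap Ψ x₀ (l T).1 (z, 0)) 0 z)
  obtain ⟨d, hd⟩ := P.exists_finrank_le hT' hu hl' h hx₀' hA rfl hind
  obtain ⟨h1, h2⟩ := exists_limitFrames_of_approx (A := A) (P.flowForm_symm h hx₀' (l T).2) hd
    fun t v hv => P.exists_approx hT' hu h hx₀' (fun z => rfl) hv
  refine ⟨fun t ht => ?_, fun 𝓛 h𝓛 t ht => ?_⟩
  · obtain ⟨b, hb⟩ := h1 t ht.2
    exact ⟨_, hb.isLagrangianSubspace, (P.isJacobiValue_iff ht hu hl' h hx₀' hA hb).2 rfl⟩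
  · obtain ⟨b, b₀, e1, e2, e3⟩ := h2 t ht
    rw [← continuousWithinAt_Iio_iff_Iic, ContinuousWithinAt,
      (P.isJacobiValue_iff ⟨ht.1.le, ht.2⟩ hu hl' h hx₀' hA e2).1 (h𝓛 t ⟨ht.1.le, ht.2⟩)]
    refine (tendsto_span e2.linearIndependent e3).congr' ?_
    filter_upwards [e1, Ioo_mem_nhdsLT ht.1] with s hs hs0
    have hs' : s ∈ Icc 0 T := ⟨hs0.1.le, hs0.2.le.trans ht.2⟩
    exact ((P.isJacobiValue_iff hs' hu hl' h hx₀' hA hs).1 (h𝓛 s hs')).symm
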